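/- Theorem 5.3. Work with oriented knotoid diagrams in the plane $\mathbb{R}^2$: generic immersions of an oriented interval in $\mathbb{R}^2$ with over/under information at each double point. A knotoid is a class of diagrams under planar isotopy and Reidemeister moves performed away from the two endpoints. A knotoid is knot-type if it has a diagram with both endpoints in the infinite region; its mirror is obtained by changing all crossings of a diagram. Let $R_3=\mathbb{Z}/3\mathbb{Z}$ with $x^y=2y-x$. An $(R_3,R_3)$-coloring $c$ of a diagram $D$ assigns an element of $R_3$ to each arc and to each region of $D$ such that, with normals of the strand pointing to its left, (a) at each crossing with over-arc $y$, if $x$ and $x'$ are the under-arcs on the sides from which and to which the normal of the over-arc points, then $c(x')=c(x)^{c(y)}$; (b) if $r_1,r_2$ are the regions on the two sides of an edge of an arc $a$ and the normal points from $r_1$ to $r_2$, then $c(r_2)=c(r_1)^{c(a)}$; in particular $c(r)^{c(a)}=c(r)$ for the region $r$ around an endpoint of the strand and the arc $a$ ending there. Let $\mathbb{Z}_3=\langle u\mid u^3=1\rangle$ and $\theta_3(x,y,z)=u^{(x-y)(y-z)z(x+z)}$. The local weight $W(v,c)\in\mathbb{Z}_3$ of a crossing $v$ of sign $\varepsilon$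 is $\theta_3(y,x_1,x_2)^{\varepsilon}$, where $y$ is the color of the region at $v$ from which both normals point away, $x_1$ the color of the under-arc adjacent to this region, and $x_2$ the color of the over-arc. With $Y_0=\{0\}$ let $$\Phi'_{\theta_3}(D)_{Y_0}=\sum_{c}\prod_v W(v,c)\in\mathbb{Z}[\mathbb{Z}_3],$$ the sum over all $(R_3,R_3)$-colorings $c$ of $D$ in which the infinite region has color $0$. For $n\ge 1$ let $T_n$ be the knotoid of the alternating diagram of the twist knot with $n$ half-twists, cut open at one of the two edges joining the two clasp crossings so that both endpoints lie in the infinite region; the crossings of the twist region are negative, and those of the clasp are positive if $n$ is even and negative if $n$ is odd. Then the shadow quandle cocycle invariant distinguishes infinitely many knot-type knotoids from their mirrors: there are infinitely many knot-type knotoids $\kappa$ such that $\Phi'_{\theta_3}(D)_{Y_0}\neq\Phi'_{\theta_3}(E)_{Y_0}$ for all diagrams $D$ of $\kappa$ and all diagrams $E$ of the mirror of $\kappa$. More precisely, the knotoids $T_{m+1}$ with $m\ge 0$ a multiple of $9$ are knot-type, there are infinitely many of them up to equivalence, and for each such $m$ $$\Phi'_{\theta_3}(D)_{Y_0}=1+2u^2\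 \text{ for every diagram } D \text{ of } T_{m+1},\qquad \Phi'_{\theta_3}(E)_{Y_0}=1+2u\ \text{ for every diagram } E \text{ of the mirror of } T_{m+1}.$$ -/

import Mathlib

/-! ### Quandles, quandle sets and shadow cocycles

A quandle is Mathlib's `Quandle`; the element `x ^ y` of the mathematical text is `y ◃ x`. -/

open scoped Quandles

/-- A set `Y` on which a quandle `X` acts: each `y ↦ y * x` is a bijection and
`(y * a) * b = (y * b) * (a ^ b)`. -/
class QuandleSet (X Y : Type) [Quandle X] where
  op : Y → X → Y
  op_bijective : ∀ x : X, Function.Bijective fun y : Y => op y x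
  op_op : ∀ (y : Y) (a b : X), op (op y a) b = op (op y b) (b ◃ a)

/-- Every quandle `X` is an `X`-set through its own operation `y * x = y ^ x`. -/
instance QuandleSet.self (X : Type) [Quandle X] : QuandleSet X X where
  op y x := x ◃ y
  op_bijective x := (Rack.act' x).bijective
  op_op _ _ _ := Shelf.self_distrib

/-- A quandle 2-cocycle of `(X, Y)` with values in a (multiplicatively written) abelian group. -/
structure QuandleCocycle (X Y A : Type) [Quandle X] [QuandleSet X Y] [CommGroup A] where
  toFun : Y → X → X → A
  cocycle : ∀ (y : Y) (x₁ x₂ x₃ : X),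
    (toFun y x₂ x₃)⁻¹ * toFun (QuandleSet.op y x₁) x₂ x₃ * toFun y x₁ x₃
      * (toFun (QuandleSet.op y x₂) (x₂ ◃ x₁) x₃)⁻¹ * (toFun y x₁ x₂)⁻¹
      * toFun (QuandleSet.op y x₃) (x₃ ◃ x₁) (x₃ ◃ x₂) = 1
  degenerate : ∀ (y : Y) (x : X), toFun y x x = 1

/-- The dihedral quandle of order three: `ℤ/3` with `x ^ y = 2 * y - x`. -/
abbrev R3 : Type := Quandle.Dihedral 3

instance : Finite R3 := inferInstanceAs (Finite (ZMod 3))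

/-- The cyclic group of order three, written multiplicatively. -/
abbrev Z3 : Type := Multiplicative (ZMod 3)

/-- The exponent of `u` in `θ₃(x, y, z) = u ^ ((x - y) (y - z) z (x + z))`. -/
def thetaExponent (x y z : ZMod 3) : ZMod 3 := (x - y) * (y - z) * z * (x + z)

/-- The cocycle `θ₃ : R₃ × R₃ × R₃ → ℤ₃ = ⟨u | u³ = 1⟩`. -/
def theta3 : QuandleCocycle R3 R3 Z3 where
  toFun x y z := Multiplicative.ofAdd (thetaExponent x y z)
  cocycle := by
    change ∀ y x₁ x₂ x₃ : ZMod 3, -thetaExponent y x₂ x₃ + thetaExponent (2 * x₁ - y) x₂ x₃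
      + thetaExponent y x₁ x₃ + -thetaExponent (2 * x₂ - y) (2 * x₂ - x₁) x₃
      + -thetaExponent y x₁ x₂
      + thetaExponent (2 * x₃ - y) (2 * x₃ - x₁) (2 * x₃ - x₂) = 0
    decide
  degenerate := by
    change ∀ y x : ZMod 3, thetaExponent y x x = 0
    decide

/-! ### Knotoid diagrams in the plane -/

/-- An oriented signed Gauss code with `n` crossings: the combinatorial type of a generic immersed
oriented interval with crossing information.  Travelling from the image of `0` to the image of `1`,
the strand passes `2 * n` times through a crossing; `pass i = (c, b)` says that the `i`-th passage
is through the crossing `c`, over it if `b = true` and under it if `b = false`.  `sign c = true`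
means that the crossing `c` is positive. -/
structure GaussCode (n : ℕ) where
  pass : Fin (2 * n) ≃ Fin n × Bool
  sign : Fin n → Bool

/-- The sides of the `2 * n + 1` edges into which the crossings cut the strand. Edge `i` leads to
the `i`-th passage, edge `i + 1` leaves it; `(i, true)` is the left side of the edge `i` and
`(i, false)` its right side. -/
abbrev Side (n : ℕ) : Type := Fin (2 * n + 1) × Bool

namespace GaussCode

variable {n : ℕ} (G : GaussCode n)

/-- Draw a crossing with both of its strands running upwards. This is the passage of the strand that
runs from the lower left to the upper right: the over-strand of a positive crossing, the
under-strand of a negative one. -/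
def toRight (c : Fin n) : Fin (2 * n) := G.pass.symm (c, G.sign c)

/-- The passage through `c` of the strand that runs from the lower right to the upper left. -/
def toLeft (c : Fin n) : Fin (2 * n) := G.pass.symm (c, !G.sign c)

/-- Two sides of edges that follow each other along the boundary of a region: the
two sides that meet in one of the four corners of a crossing, or the two sides of the first and of
the last edge, which meet at an endpoint of the strand. -/
inductive Corner : Side n → Side n → Prop
  | north (c : Fin n) : Corner ((G.toRight c).succ, true) ((G.toLeft c).succ, false)
  | west (c : Fin n) : Corner ((G.toLeft c).succ, true) ((G.toRight c).castSucc, true)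
  | south (c : Fin n) : Corner ((G.toRight c).castSucc, false) ((G.toLeft c).castSucc, true)
  | east (c : Fin n) : Corner ((G.toLeft c).castSucc, false) ((G.toRight c).succ, false)
  | first : Corner (0, true) (0, false)
  | last : Corner (Fin.last (2 * n), true) (Fin.last (2 * n), false)

/-- The regions of the diagram, each given by the sides of edges along its boundary. -/
def Region : Type := Quot G.Corner

/-- The region on the given side of an edge. -/
def regionAt (d : Side n) : G.Region := Quot.mk _ d

/-- The code is realized by a diagram in the sphere: as a graph with `n + 2` vertices and `2 * n + 1`
edges, cellularly embedded with these regions as faces, it has Euler characteristic `2`. -/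
def Planar : Prop := Nat.card G.Region = n + 1

/-- Consecutive edges of the strand that are joined by an over-passage. -/
inductive OverJoined : Fin (2 * n + 1) → Fin (2 * n + 1) → Prop
  | over (c : Fin n) :
      OverJoined (G.pass.symm (c, true)).castSucc (G.pass.symm (c, true)).succ

/-- The arcs of the diagram: the pieces into which the under-passages cut the strand. -/
def Arc : Type := Quot G.OverJoined

/-- The arc that contains the given edge. -/
def arcAt (e : Fin (2 * n + 1)) : G.Arc := Quot.mk _ e

/-- The over-arc of a crossing. -/
def overArc (c : Fin n) : G.Arc := G.arcAt (G.pass.symm (c, true)).castSucc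

/-- The under-edge of a crossing that lies to the right of its over-strand. -/
def underRight (c : Fin n) : Fin (2 * n + 1) :=
  if G.sign c then (G.pass.symm (c, false)).castSucc else (G.pass.symm (c, false)).succ

/-- The under-edge of a crossing that lies to the left of its over-strand. -/
def underLeft (c : Fin n) : Fin (2 * n + 1) :=
  if G.sign c then (G.pass.symm (c, false)).succ else (G.pass.symm (c, false)).castSucc

/-- The mirror image: all crossings are changed. -/
def mirror : GaussCode n where
  pass := G.pass.trans (Equiv.prodCongr (Equiv.refl _) Equiv.boolNot)
  sign c := !G.sign c

end GaussCode

/-- An oriented knotoid diagram with `n` crossings in the plane, up to planar isotopy: a Gauss code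
that is realized in the sphere, together with the region that contains the point at infinity. -/
structure KnotoidDiagram (n : ℕ) extends GaussCode n where
  planar : toGaussCode.Planar
  outer : toGaussCode.Region

namespace GaussCode

variable {n : ℕ} (G : GaussCode n)

theorem mirror_toRight (c : Fin n) : G.mirror.toRight c = G.toRight c := by
  simp [toRight, mirror, Equiv.boolNot]

theorem mirror_toLeft (c : Fin n) : G.mirror.toLeft c = G.toLeft c := by
  simp [toLeft, mirror, Equiv.boolNot]

theorem mirror_corner : G.mirror.Corner = G.Corner := by
  ext a b
  constructor
  · rintro (c | c | c | c | _ | _)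
    iterate 4 · rw [mirror_toRight, mirror_toLeft]; constructor
    iterate 2 · constructor
  · have key : ∀ c, G.toRight c = G.mirror.toRight c := fun c => (G.mirror_toRight c).symm
    have key' : ∀ c, G.toLeft c = G.mirror.toLeft c := fun c => (G.mirror_toLeft c).symm
    rintro (c | c | c | c | _ | _)
    iterate 4 · rw [key, key']; constructor
    iterate 2 · constructor

theorem mirror_region : G.mirror.Region = G.Region := by
  rw [Region, Region, mirror_corner]

end GaussCode

namespace KnotoidDiagram

variable {n : ℕ}

/-- The mirror image of a knotoid diagram: all crossings are changed, the underlying immersed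
interval and the infinite region stay the same. -/
def mirror (D : KnotoidDiagram n) : KnotoidDiagram n where
  toGaussCode := D.toGaussCode.mirror
  planar := by
    have h := D.planar
    rwa [GaussCode.Planar, ← D.toGaussCode.mirror_region] at h
  outer := Quot.map id (fun a b h => by rw [D.toGaussCode.mirror_corner]; exact h) D.outer

/-- The infinite region is to be found at the side `d` of an edge. -/
def OuterAt (D : KnotoidDiagram n) (d : Side n) : Prop := D.outer = D.regionAt d

/-- `D'` has all crossings of `D`, placed by `ι`, and possibly further ones; on its way
the strand of `D'` makes the passages of `D`, placed by `e`, in the same order.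
That is, `D` arises from `D'` if the remaining crossings are deleted. -/
def Inserts {m n : ℕ} (D : KnotoidDiagram m) (D' : KnotoidDiagram n) (ι : Fin m ↪ Fin n)
    (e : Fin (2 * m) ↪o Fin (2 * n)) : Prop :=
  (∀ c, D'.sign (ι c) = D.sign c) ∧ ∀ i, D'.pass (e i) = (ι (D.pass i).1, (D.pass i).2)

/-- The edge `x'` of `D'` is a piece of the edge `x` of `D`: it comes after the same passages of `D`,
where `e` places these passages among those of `D'`. -/
def IsPiece {m n : ℕ} (e : Fin (2 * m) ↪o Fin (2 * n)) (x : Fin (2 * m + 1))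
    (x' : Fin (2 * n + 1)) : Prop :=
  ∀ k, k.val < x.val ↔ (e k).val < x'.val

/-- The infinite regions of `D` and `D'` correspond to each other when the crossings of `D'` that do
not belong to `D` are deleted. Here `moved` holds the edges of `D'` around the monogon or
bigon that disappears; away from them the strand does not move. -/
def SameOuter {m n : ℕ} (D : KnotoidDiagram m) (D' : KnotoidDiagram n)
    (e : Fin (2 * m) ↪o Fin (2 * n)) (moved : Set (Fin (2 * n + 1))) : Prop :=
  ∃ x x' s, IsPiece e x x' ∧ x' ∉ moved ∧ D.OuterAt (x, s) ∧ D'.OuterAt (x', s)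

/-- Two sides of edges meet in a corner. -/
def Meet (D : KnotoidDiagram n) (d d' : Side n) : Prop :=
  D.toGaussCode.Corner d d' ∨ D.toGaussCode.Corner d' d

/-- Renumbering of the crossings and the Reidemeister moves on knotoid diagrams. The moves take place
in a disk away from both endpoints and away from the point at infinity. -/
inductive Move : (Σ n, KnotoidDiagram n) → (Σ n, KnotoidDiagram n) → Prop
  | renumber {n : ℕ} (D D' : KnotoidDiagram n) (ρ : Equiv.Perm (Fin n))
      (sign : ∀ c, D'.sign (ρ c) = D.sign c)
      (pass : ∀ i, D'.pass i = (ρ (D.pass i).1, (D.pass i).2))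
      (outer : ∃ d, D.OuterAt d ∧ D'.OuterAt d) :
      Move ⟨n, D⟩ ⟨n, D'⟩
  /-- First move: `D'` has one more crossing `c`, with two consecutive passages. -/
  | r1 {n : ℕ} (D : KnotoidDiagram n) (D' : KnotoidDiagram (n + 1))
      (ι : Fin n ↪ Fin (n + 1)) (e : Fin (2 * n) ↪o Fin (2 * (n + 1)))
      (inserts : Inserts D D' ι e) (c : Fin (n + 1)) (new : c ∉ Set.range ι)
      (i i' : Fin (2 * (n + 1))) (next : i'.val = i.val + 1)
      (loop : (D'.pass i).1 = c ∧ (D'.pass i').1 = c)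
      (outer : SameOuter D D' e {i.succ}) :
      Move ⟨n, D⟩ ⟨n + 1, D'⟩
  /-- Second move: `D'` has two more crossings `p` and `q` of opposite signs, which are the corners
  of a bigon: one strand runs over both of them, consecutively, and another strand, or another part
  of the same strand, runs under both of them, consecutively. -/
  | r2 {n : ℕ} (D : KnotoidDiagram n) (D' : KnotoidDiagram (n + 2))
      (ι : Fin n ↪ Fin (n + 2)) (e : Fin (2 * n) ↪o Fin (2 * (n + 2)))
      (inserts : Inserts D D' ι e) (p q : Fin (n + 2)) (p_new : p ∉ Set.range ι) (q_new : q ∉ Set.range ι)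
      (signs : D'.sign p ≠ D'.sign q)
      (i i' j j' : Fin (2 * (n + 2))) (next : i'.val = i.val + 1) (next' : j'.val = j.val + 1)
      (overs : D'.pass i = (p, true) ∧ D'.pass i' = (q, true))
      (unders : ({D'.pass j, D'.pass j'} : Set (Fin (n + 2) × Bool)) = {(p, false), (q, false)})
      (outer : SameOuter D D' e {i.succ, j.succ}) :
      Move ⟨n, D⟩ ⟨n + 2, D'⟩
  /-- Third move: three edges (those from the passage `i` to `i'`, from `j` to `j'` and from
  `k` to `k'`) bound a triangle with corners `p`, `q`, `r`. The first belongs to a strand that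
  runs over the other two, the third to a strand that runs under the other two. The move reverses the
  order of the two passages on each of the three strands. -/
  | r3 {n : ℕ} (D D' : KnotoidDiagram n) (p q r : Fin n) (hpq : p ≠ q) (hpr : p ≠ r) (hqr : q ≠ r)
      (i i' j j' k k' : Fin (2 * n))
      (hi : i'.val = i.val + 1) (hj : j'.val = j.val + 1) (hk : k'.val = k.val + 1)
      (top : ({D.pass i, D.pass i'} : Set (Fin n × Bool)) = {(p, true), (q, true)})
      (middle : ({D.pass j, D.pass j'} : Set (Fin n × Bool)) = {(p, false), (r, true)})
      (bottom : ({D.pass k, D.pass k'} : Set (Fin n × Bool)) = {(q, false), (r, false)})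
      (s t u : Bool) (corner₁ : D.Meet (i.succ, s) (j.succ, t))
      (corner₂ : D.Meet (j.succ, t) (k.succ, u)) (corner₃ : D.Meet (k.succ, u) (i.succ, s))
      (sign : ∀ c, D'.sign c = D.sign c)
      (swap₁ : D'.pass i = D.pass i' ∧ D'.pass i' = D.pass i)
      (swap₂ : D'.pass j = D.pass j' ∧ D'.pass j' = D.pass j)
      (swap₃ : D'.pass k = D.pass k' ∧ D'.pass k' = D.pass k)
      (others : ∀ x, x ≠ i → x ≠ i' → x ≠ j → x ≠ j' → x ≠ k → x ≠ k' → D'.pass x = D.pass x)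
      (outer : ∃ d : Side n, d.1 ≠ i.succ ∧ d.1 ≠ j.succ ∧ d.1 ≠ k.succ ∧
        D.OuterAt d ∧ D'.OuterAt d) :
      Move ⟨n, D⟩ ⟨n, D'⟩

end KnotoidDiagram

/-- Knotoids in the plane: the classes of the equivalence relation on knotoid diagrams that is
generated by the Reidemeister moves. -/
def Knotoid : Type := Quot KnotoidDiagram.Move

/-- The knotoid that a diagram represents. -/
def KnotoidDiagram.knotoid {n : ℕ} (D : KnotoidDiagram n) : Knotoid := Quot.mk _ ⟨n, D⟩

theorem KnotoidDiagram.mirror_inserts {m n : ℕ} {D : KnotoidDiagram m} {D' : KnotoidDiagram n}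
    {ι : Fin m ↪ Fin n} {e : Fin (2 * m) ↪o Fin (2 * n)} (h : Inserts D D' ι e) :
    Inserts D.mirror D'.mirror ι e := by
  refine ⟨fun c => ?_, fun i => ?_⟩
  · simp [mirror, GaussCode.mirror, h.1 c]
  · simp [mirror, GaussCode.mirror, h.2 i]

theorem KnotoidDiagram.mirror_outerAt {n : ℕ} {D : KnotoidDiagram n} {d : Side n}
    (h : D.OuterAt d) : D.mirror.OuterAt d := by
  unfold OuterAt at h
  simp only [OuterAt, mirror, h]
  rfl

theorem KnotoidDiagram.mirror_sameOuter {m n : ℕ} {D : KnotoidDiagram m} {D' : KnotoidDiagram n}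
    {e : Fin (2 * m) ↪o Fin (2 * n)} {moved : Set (Fin (2 * n + 1))}
    (h : SameOuter D D' e moved) : SameOuter D.mirror D'.mirror e moved := by
  obtain ⟨x, x', s, h₁, h₀, h₂, h₃⟩ := h
  exact ⟨x, x', s, h₁, h₀, mirror_outerAt h₂, mirror_outerAt h₃⟩

theorem KnotoidDiagram.mirror_meet {n : ℕ} {D : KnotoidDiagram n} {d d' : Side n}
    (h : D.Meet d d') : D.mirror.Meet d d' := by
  unfold Meet
  change D.toGaussCode.mirror.Corner d d' ∨ D.toGaussCode.mirror.Corner d' d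
  rw [GaussCode.mirror_corner]
  exact h

theorem KnotoidDiagram.mirror_pass {n : ℕ} (D : KnotoidDiagram n) (i : Fin (2 * n)) :
    D.mirror.pass i = ((D.pass i).1, !(D.pass i).2) := by
  simp [mirror, GaussCode.mirror, Prod.map]

theorem KnotoidDiagram.mirror_pair {n : ℕ} {D : KnotoidDiagram n} {i i' : Fin (2 * n)}
    {p q : Fin n} {a b : Bool}
    (h : ({D.pass i, D.pass i'} : Set (Fin n × Bool)) = {(p, a), (q, b)}) :
    ({D.mirror.pass i, D.mirror.pass i'} : Set (Fin n × Bool)) = {(p, !a), (q, !b)} := by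
  have := congrArg (Set.image fun x : Fin n × Bool => (x.1, !x.2)) h
  simpa [Set.image_pair, mirror_pass] using this

theorem KnotoidDiagram.mirror_move {x y : Σ n, KnotoidDiagram n} (h : Move x y) :
    Move ⟨x.1, x.2.mirror⟩ ⟨y.1, y.2.mirror⟩ := by
  cases h with
  | renumber D D' ρ sign pass outer =>
    obtain ⟨d, h₁, h₂⟩ := outer
    refine .renumber _ _ ρ (fun c => ?_) (fun i => ?_) ⟨d, mirror_outerAt h₁, mirror_outerAt h₂⟩
    · simp [mirror, GaussCode.mirror, sign c]
    · simp [mirror_pass, pass i]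
  | r1 D D' ι e inserts c new i i' next loop outer =>
    refine .r1 _ _ ι e (mirror_inserts inserts) c new i i' next ?_ (mirror_sameOuter outer)
    simpa [mirror_pass] using loop
  | r2 D D' ι e inserts p q p_new q_new signs i i' j j' next next' overs unders outer =>
    have outer' := mirror_sameOuter outer
    rw [Set.pair_comm] at outer'
    have hover : ({D'.pass i, D'.pass i'} : Set (Fin _ × Bool)) = {(p, true), (q, true)} := by
      rw [overs.1, overs.2]
    have hover' : ({D'.mirror.pass i, D'.mirror.pass i'} : Set (Fin _ × Bool))
        = {(p, false), (q, false)} := mirror_pair hover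
    have hs : D'.mirror.sign p ≠ D'.mirror.sign q := by
      simpa [mirror, GaussCode.mirror] using signs
    have hne : D'.pass j ≠ D'.pass j' := fun h => by
      have := D'.pass.injective h
      rw [this] at next'
      omega
    have hj : D'.pass j ∈ ({(p, false), (q, false)} : Set (Fin _ × Bool)) := by
      rw [← unders]; simp
    have hj' : D'.pass j' ∈ ({(p, false), (q, false)} : Set (Fin _ × Bool)) := by
      rw [← unders]; simp
    simp only [Set.mem_insert_iff, Set.mem_singleton_iff] at hj hj'
    rcases hj with hj | hj <;> rcases hj' with hj' | hj'
    · exact absurd (hj.trans hj'.symm) hne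
    · exact .r2 _ _ ι e (mirror_inserts inserts) p q p_new q_new hs
        j j' i i' next' next (by simp [mirror_pass, hj, hj']) hover' outer'
    · exact .r2 _ _ ι e (mirror_inserts inserts) q p q_new p_new hs.symm
        j j' i i' next' next (by simp [mirror_pass, hj, hj']) (hover'.trans (Set.pair_comm _ _))
        outer'
    · exact absurd (hj.trans hj'.symm) hne
  | r3 D D' p q r hpq hpr hqr i i' j j' k k' hi hj hk top middle bottom s t u c₁ c₂ c₃ sign
      s₁ s₂ s₃ others outer =>
    obtain ⟨d, h₁, h₂, h₃, h₄, h₅⟩ := outer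
    refine .r3 _ _ r q p hqr.symm hpr.symm hpq.symm k k' j j' i i' hk hj hi
      ((mirror_pair bottom).trans (Set.pair_comm _ _))
      ((mirror_pair middle).trans (Set.pair_comm _ _))
      ((mirror_pair top).trans (Set.pair_comm _ _)) u t s ?_ ?_ ?_ (fun c => ?_)
      ?_ ?_ ?_ (fun x h₁ h₂ h₃ h₄ h₅ h₆ => ?_) ⟨d, h₃, h₂, h₁, mirror_outerAt h₄, mirror_outerAt h₅⟩
    · exact mirror_meet c₂.symm
    · exact mirror_meet c₁.symm
    · exact mirror_meet c₃.symm
    · simp [mirror, GaussCode.mirror, sign c]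
    · simp [mirror_pass, s₃.1, s₃.2]
    · simp [mirror_pass, s₂.1, s₂.2]
    · simp [mirror_pass, s₁.1, s₁.2]
    · rw [mirror_pass, mirror_pass, others x h₅ h₆ h₃ h₄ h₁ h₂]

/-- The mirror image of a knotoid. -/
def Knotoid.mirror : Knotoid → Knotoid :=
  Quot.map (fun x => ⟨x.1, x.2.mirror⟩) fun _ _ h => KnotoidDiagram.mirror_move h

/-- A knot-type knotoid: some diagram of it has both endpoints in the infinite region. -/
def Knotoid.IsKnotType (κ : Knotoid) : Prop :=
  ∃ (n : ℕ) (D : KnotoidDiagram n), D.knotoid = κ ∧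
    D.OuterAt (0, true) ∧ D.OuterAt (Fin.last (2 * n), true)

/-! ### Shadow colorings and the shadow quandle cocycle invariant -/

namespace KnotoidDiagram

variable {n : ℕ}

/-- An `(X, Y)`-coloring. The co-orientation normal of the strand points to its left. The last
condition says `c(r₁) * c(a) = c(r₂)` if the normal of an edge of the arc `a` points from `r₁` to
`r₂`; at the first and at the last edge, where `r₁ = r₂`, it is the condition at an endpoint. -/
structure Coloring (D : KnotoidDiagram n) (X Y : Type) [Quandle X] [QuandleSet X Y] where
  arc : D.Arc → X
  region : D.Region → Y
  crossing : ∀ c, arc (D.arcAt (D.underLeft c)) =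
    arc (D.overArc c) ◃ arc (D.arcAt (D.underRight c))
  edge : ∀ e, region (D.regionAt (e, true)) =
    QuandleSet.op (region (D.regionAt (e, false))) (arc (D.arcAt e))

variable {X Y A : Type} [Quandle X] [QuandleSet X Y] [CommGroup A]

instance (D : KnotoidDiagram n) [Finite X] [Finite Y] : Finite (D.Coloring X Y) := by
  have : Finite D.Arc := inferInstanceAs (Finite (Quot _))
  have : Finite D.Region := inferInstanceAs (Finite (Quot _))
  refine Finite.of_injective (fun c => (c.arc, c.region)) fun c c' h => ?_
  cases c; cases c'
  simpa using h

/-- The side of an edge in the specified region of a crossing: both normals at the crossing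
point away from this region, so it lies to the right of both strands. -/
def specified (D : KnotoidDiagram n) (c : Fin n) : Side n := ((D.toRight c).succ, false)

/-- The local weight `f(y, x₁, x₂) ^ (±1)` of a crossing, with `y`, `x₁`, `x₂` the colors of the
specified region, of the under-arc adjacent to it, and of the over-arc. -/
def localWeight (D : KnotoidDiagram n) (f : QuandleCocycle X Y A) (col : D.Coloring X Y)
    (c : Fin n) : A :=
  let w := f.toFun (col.region (D.regionAt (D.specified c)))
    (col.arc (D.arcAt (D.underRight c))) (col.arc (D.overArc c))
  if D.sign c then w else w⁻¹

/-- The shadow quandle cocycle invariant `Φ'_f(D)_{Y₀}`, an element of the group ring `ℤ[A]`: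
the sum, over all `(X, Y)`-colorings that color the infinite region by an element of `Y₀`, of the
product of the local weights. -/
noncomputable def shadowInvariant (D : KnotoidDiagram n) [Finite X] [Finite Y]
    (f : QuandleCocycle X Y A) (Y₀ : Set Y) : MonoidAlgebra ℤ A :=
  ∑ᶠ (col : D.Coloring X Y) (_ : col.region D.outer ∈ Y₀),
    MonoidAlgebra.of ℤ A (∏ c, D.localWeight f col c)

/-- The invariant `Φ'_{θ₃}(D)_{Y₀}` with respect to `(R₃, R₃)` and `Y₀ = {0}`. -/
noncomputable def theta3Invariant (D : KnotoidDiagram n) : MonoidAlgebra ℤ Z3 :=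
  D.shadowInvariant theta3 {(0 : ZMod 3)}

end KnotoidDiagram

/-- The generator `u` of `ℤ₃ = ⟨u | u³ = 1⟩`, in the group ring `ℤ[ℤ₃]`. -/
noncomputable def uGen : MonoidAlgebra ℤ Z3 := MonoidAlgebra.of ℤ Z3 (Multiplicative.ofAdd 1)

/-! ### Twist knotoids -/

/-- The crossing of the `i`-th passage in the twist diagram with `n` half-twists. The crossings `0`
and `n + 1` form the clasp, the crossings `1, …, n` the twist region. The passages are
`0, 1, …, n`, then the two clasp crossings (`0, n + 1` if `n` is even, `n + 1, 0` if `n` is odd),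
then `n, …, 1` and finally `n + 1`. -/
def twistCrossing (n i : ℕ) : ℕ :=
  if i ≤ n then i
  else if i = n + 1 then (if Even n then 0 else n + 1)
  else if i = n + 2 then (if Even n then n + 1 else 0)
  else if i = 2 * n + 3 then n + 1
  else 2 * n + 3 - i

theorem twistCrossing_lt (n i : ℕ) : twistCrossing n i < n + 2 := by
  unfold twistCrossing
  split_ifs <;> omega

/-- The passages of the twist diagram, alternately under and over. -/
def twistPass (n : ℕ) (i : Fin (2 * (n + 2))) : Fin (n + 2) × Bool :=
  (⟨twistCrossing n i, twistCrossing_lt n i⟩, decide (Odd i.val))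

theorem twistPass_bijective (n : ℕ) : Function.Bijective (twistPass n) := by
  rw [Fintype.bijective_iff_injective_and_card]
  refine ⟨fun i j h => ?_, by simp [mul_comm]⟩
  have hi := i.isLt
  have hj := j.isLt
  simp only [twistPass, Prod.mk.injEq, Fin.mk.injEq, decide_eq_decide, twistCrossing,
    Nat.odd_iff, Nat.even_iff] at h
  ext
  obtain ⟨h₁, h₂⟩ := h
  split_ifs at h₁ <;> omega

/-- The Gauss code of the alternating diagram of the twist knot with `n` half-twists, cut open at an
arc of the clasp. The crossings of the twist region are negative; those of the clasp
are positive if `n` is even, negative if `n` is odd. -/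
noncomputable def twistCode (n : ℕ) : GaussCode (n + 2) where
  pass := Equiv.ofBijective (twistPass n) (twistPass_bijective n)
  sign c := decide ((c.val = 0 ∨ c.val = n + 1) ∧ Even n)

theorem twistCode_symm (n : ℕ) (c : Fin (n + 2)) (b : Bool) :
    twistCrossing n ((twistCode n).pass.symm (c, b)) = c ∧
      (b = true ↔ ((twistCode n).pass.symm (c, b)).val % 2 = 1) := by
  have h : twistPass n ((twistCode n).pass.symm (c, b)) = (c, b) :=
    (twistCode n).pass.apply_symm_apply (c, b)
  simp only [twistPass, Prod.mk.injEq, Fin.ext_iff] at h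
  refine ⟨h.1, ?_⟩
  have h₂ := h.2
  cases b <;> simp [Nat.odd_iff] at h₂ ⊢ <;> omega

/-- The regions of the twist diagram: the number of the region at a side of an edge. -/
def twistRegion (n : ℕ) (e : ℕ) (s : Bool) : ℕ :=
  if e = 0 ∨ e = 2 * n + 4 then n
  else if e ≤ n + 1 then
    (match s, e % 2 with
      | true, 0 => e - 1
      | true, _ => n + 1
      | false, 0 => n + 2
      | false, _ => e - 1)
  else if e = n + 2 then
    (match s, n % 2 with
      | true, 0 => 0
      | true, _ => n
      | false, 0 => n
      | false, _ => 0)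
  else
    (match s, e % 2 with
      | true, 0 => 2 * n + 3 - e
      | true, _ => n + 2
      | false, 0 => n + 1
      | false, _ => 2 * n + 3 - e)

/-- The position `i` of the passage through the crossing `c` whose over-crossing property is `b`. -/
theorem twist_position {n c i : ℕ} {b : Prop} (hi : i < 2 * (n + 2))
    (h : twistCrossing n i = c) (hb : b ↔ i % 2 = 1) :
    (i = c ∧ c ≤ n ∧ (b ↔ c % 2 = 1)) ∨ (c = 0 ∧ n % 2 = 0 ∧ i = n + 1 ∧ b) ∨
      (c = n + 1 ∧ n % 2 = 1 ∧ i = n + 1 ∧ ¬ b) ∨ (c = 0 ∧ n % 2 = 1 ∧ i = n + 2 ∧ b) ∨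
      (c = n + 1 ∧ n % 2 = 0 ∧ i = n + 2 ∧ ¬ b) ∨ (c = n + 1 ∧ i = 2 * n + 3 ∧ b) ∨
      (1 ≤ c ∧ c ≤ n ∧ i = 2 * n + 3 - c ∧ (b ↔ c % 2 = 0)) := by
  simp only [twistCrossing, Nat.even_iff] at h
  by_cases hb' : b <;> simp only [hb', true_iff, false_iff, not_true_eq_false, not_false_eq_true,
    and_true, and_false, false_or] at hb ⊢ <;> split_ifs at h <;> omega

/-- The positions of the two passages through each crossing of the twist diagram. -/
theorem twistCode_cases (n : ℕ) (c : Fin (n + 2)) (i k : ℕ)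
    (hi : i = ((twistCode n).toRight c).val) (hk : k = ((twistCode n).toLeft c).val) :
    (n % 2 = 0 ∧ c.val = 0 ∧ i = n + 1 ∧ k = 0) ∨ (n % 2 = 1 ∧ c.val = 0 ∧ i = 0 ∧ k = n + 2) ∨
    (n % 2 = 0 ∧ c.val = n + 1 ∧ i = 2 * n + 3 ∧ k = n + 2) ∨
    (n % 2 = 1 ∧ c.val = n + 1 ∧ i = n + 1 ∧ k = 2 * n + 3) ∨
    (1 ≤ c.val ∧ c.val ≤ n ∧ c.val % 2 = 0 ∧ i = c.val ∧ k = 2 * n + 3 - c.val) ∨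
    (1 ≤ c.val ∧ c.val ≤ n ∧ c.val % 2 = 1 ∧ i = 2 * n + 3 - c.val ∧ k = c.val) := by
  have h₁ := twistCode_symm n c ((twistCode n).sign c)
  have h₂ := twistCode_symm n c (!(twistCode n).sign c)
  have hs : (twistCode n).sign c = true ↔ ((c.val = 0 ∨ c.val = n + 1) ∧ n % 2 = 0) := by
    simp [twistCode, Nat.even_iff]
  have hs' : (!(twistCode n).sign c) = true ↔ ¬ ((c.val = 0 ∨ c.val = n + 1) ∧ n % 2 = 0) := by
    rw [← hs]; simp
  have hi₂ := twist_position ((twistCode n).toRight c).isLt h₁.1 h₁.2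
  have hk₂ := twist_position ((twistCode n).toLeft c).isLt h₂.1 h₂.2
  have hc := c.isLt
  rw [hs, ← hi] at hi₂
  rw [hs', ← hk] at hk₂
  clear h₁ h₂ hs hs' hi hk
  generalize c.val = c at *
  by_cases h : (c = 0 ∨ c = n + 1) ∧ n % 2 = 0 <;>
    simp only [h, true_iff, false_iff, not_true_eq_false, not_false_eq_true,
      and_true, and_false, false_or] at hi₂ hk₂ <;>
    rcases hi₂ with h₁ | h₁ | h₁ | h₁ | h₁ <;> rcases hk₂ with h₂ | h₂ | h₂ | h₂ | h₂ <;>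
    first
    | (exfalso; omega)
    | (refine Or.inl ⟨?_, ?_, ?_, ?_⟩ <;> omega)
    | (refine Or.inr (Or.inl ⟨?_, ?_, ?_, ?_⟩) <;> omega)
    | (refine Or.inr (Or.inr (Or.inl ⟨?_, ?_, ?_, ?_⟩)) <;> omega)
    | (refine Or.inr (Or.inr (Or.inr (Or.inl ⟨?_, ?_, ?_, ?_⟩))) <;> omega)
    | (refine Or.inr (Or.inr (Or.inr (Or.inr (Or.inl ⟨?_, ?_, ?_, ?_, ?_⟩)))) <;> omega)
    | (refine Or.inr (Or.inr (Or.inr (Or.inr (Or.inr ⟨?_, ?_, ?_, ?_, ?_⟩)))) <;> omega)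

theorem twistRegion_end {n e : ℕ} {s : Bool} (h : e = 0 ∨ e = 2 * n + 4) :
    twistRegion n e s = n := by
  simp [twistRegion, h]

theorem twistRegion_low_even {n e : ℕ} (h₁ : 1 ≤ e) (h₂ : e ≤ n + 1) (h : e % 2 = 0) :
    twistRegion n e true = e - 1 ∧ twistRegion n e false = n + 2 := by
  have : ¬ (e = 0 ∨ e = 2 * n + 4) := by omega
  simp [twistRegion, this, h₂, h]

theorem twistRegion_low_odd {n e : ℕ} (h₂ : e ≤ n + 1) (h : e % 2 = 1) :
    twistRegion n e true = n + 1 ∧ twistRegion n e false = e - 1 := by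
  have : ¬ (e = 0 ∨ e = 2 * n + 4) := by omega
  simp [twistRegion, this, h₂, h]

theorem twistRegion_mid_even {n e : ℕ} (h₁ : e = n + 2) (h : n % 2 = 0) :
    twistRegion n e true = 0 ∧ twistRegion n e false = n := by
  subst h₁
  have h₂ : ¬ n + 2 ≤ n + 1 := by omega
  simp [twistRegion, h₂, h]
  omega

theorem twistRegion_mid_odd {n e : ℕ} (h₁ : e = n + 2) (h : n % 2 = 1) :
    twistRegion n e true = n ∧ twistRegion n e false = 0 := by
  subst h₁
  have h₂ : ¬ n + 2 ≤ n + 1 := by omega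
  simp [twistRegion, h₂, h]
  omega

theorem twistRegion_high_even {n e : ℕ} (h₁ : n + 3 ≤ e) (h₂ : e ≤ 2 * n + 3) (h : e % 2 = 0) :
    twistRegion n e true = 2 * n + 3 - e ∧ twistRegion n e false = n + 1 := by
  have h₃ : ¬ (e = 0 ∨ e = 2 * n + 4) := by omega
  have h₄ : ¬ e ≤ n + 1 := by omega
  have h₅ : ¬ e = n + 2 := by omega
  simp [twistRegion, h₃, h₄, h₅, h]

theorem twistRegion_high_odd {n e : ℕ} (h₁ : n + 3 ≤ e) (h : e % 2 = 1) :
    twistRegion n e true = n + 2 ∧ twistRegion n e false = 2 * n + 3 - e := by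
  have h₃ : ¬ (e = 0 ∨ e = 2 * n + 4) := by omega
  have h₄ : ¬ e ≤ n + 1 := by omega
  have h₅ : ¬ e = n + 2 := by omega
  simp [twistRegion, h₃, h₄, h₅, h]

theorem twistRegion_values (n : ℕ) : ∀ e, e < 2 * n + 5 →
      ((e = 0 ∨ e = 2 * n + 4) ∧ twistRegion n e true = n ∧ twistRegion n e false = n) ∨
      ((1 ≤ e ∧ e ≤ n + 1 ∧ e % 2 = 0) ∧
        twistRegion n e true = e - 1 ∧ twistRegion n e false = n + 2) ∨
      ((e ≤ n + 1 ∧ e % 2 = 1) ∧ twistRegion n e true = n + 1 ∧ twistRegion n e false = e - 1) ∨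
      ((e = n + 2 ∧ n % 2 = 0) ∧ twistRegion n e true = 0 ∧ twistRegion n e false = n) ∨
      ((e = n + 2 ∧ n % 2 = 1) ∧ twistRegion n e true = n ∧ twistRegion n e false = 0) ∨
      ((n + 3 ≤ e ∧ e ≤ 2 * n + 3 ∧ e % 2 = 0) ∧
        twistRegion n e true = 2 * n + 3 - e ∧ twistRegion n e false = n + 1) ∨
      ((n + 3 ≤ e ∧ e ≤ 2 * n + 3 ∧ e % 2 = 1) ∧
        twistRegion n e true = n + 2 ∧ twistRegion n e false = 2 * n + 3 - e) := by
  intro e h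
  have cases : (e = 0 ∨ e = 2 * n + 4) ∨ (1 ≤ e ∧ e ≤ n + 1 ∧ e % 2 = 0) ∨
      (e ≤ n + 1 ∧ e % 2 = 1) ∨ (e = n + 2 ∧ n % 2 = 0) ∨ (e = n + 2 ∧ n % 2 = 1) ∨
      (n + 3 ≤ e ∧ e ≤ 2 * n + 3 ∧ e % 2 = 0) ∨ (n + 3 ≤ e ∧ e ≤ 2 * n + 3 ∧ e % 2 = 1) := by
    omega
  rcases cases with h | h | h | h | h | h | h
  · exact .inl ⟨h, twistRegion_end h, twistRegion_end h⟩
  · exact .inr (.inl ⟨h, twistRegion_low_even h.1 h.2.1 h.2.2⟩)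
  · exact .inr (.inr (.inl ⟨h, twistRegion_low_odd h.1 h.2⟩))
  · exact .inr (.inr (.inr (.inl ⟨h, twistRegion_mid_even h.1 h.2⟩)))
  · exact .inr (.inr (.inr (.inr (.inl ⟨h, twistRegion_mid_odd h.1 h.2⟩))))
  · exact .inr (.inr (.inr (.inr (.inr (.inl ⟨h, twistRegion_high_even h.1 h.2.1 h.2.2⟩)))))
  · exact .inr (.inr (.inr (.inr (.inr (.inr ⟨h, twistRegion_high_odd h.1 h.2.2⟩)))))

theorem twistRegion_lt (n e : ℕ) (s : Bool) (he : e < 2 * n + 5) :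
    twistRegion n e s < n + 3 := by
  unfold twistRegion
  split_ifs <;> (try split) <;> omega

theorem twistRegion_aux {n c i k : ℕ} (h :
    (n % 2 = 0 ∧ c = 0 ∧ i = n + 1 ∧ k = 0) ∨ (n % 2 = 1 ∧ c = 0 ∧ i = 0 ∧ k = n + 2) ∨
    (n % 2 = 0 ∧ c = n + 1 ∧ i = 2 * n + 3 ∧ k = n + 2) ∨
    (n % 2 = 1 ∧ c = n + 1 ∧ i = n + 1 ∧ k = 2 * n + 3) ∨
    (1 ≤ c ∧ c ≤ n ∧ c % 2 = 0 ∧ i = c ∧ k = 2 * n + 3 - c) ∨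
    (1 ≤ c ∧ c ≤ n ∧ c % 2 = 1 ∧ i = 2 * n + 3 - c ∧ k = c)) :
    twistRegion n (i + 1) true = twistRegion n (k + 1) false ∧
    twistRegion n (k + 1) true = twistRegion n i true ∧
    twistRegion n i false = twistRegion n k true ∧
    twistRegion n k false = twistRegion n (i + 1) false := by
  have full := twistRegion_values n
  have hb : i < 2 * n + 4 ∧ k < 2 * n + 4 := by omega
  have f₁ := full i (by omega)
  have f₂ := full k (by omega)
  have f₃ := full (i + 1) (by omega)
  have f₄ := full (k + 1) (by omega)
  clear full
  generalize twistRegion n i true = a₁ at *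
  generalize twistRegion n i false = a₂ at *
  generalize twistRegion n k true = a₃ at *
  generalize twistRegion n k false = a₄ at *
  generalize twistRegion n (i + 1) true = a₅ at *
  generalize twistRegion n (i + 1) false = a₆ at *
  generalize twistRegion n (k + 1) true = a₇ at *
  generalize twistRegion n (k + 1) false = a₈ at *
  rcases h with h | h | h | h | h | h <;>
  (rcases f₁ with f₁ | f₁ | f₁ | f₁ | f₁ | f₁ | f₁ <;> try (exfalso; omega)) <;>
  (rcases f₂ with f₂ | f₂ | f₂ | f₂ | f₂ | f₂ | f₂ <;> try (exfalso; omega)) <;>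
  (rcases f₃ with f₃ | f₃ | f₃ | f₃ | f₃ | f₃ | f₃ <;> try (exfalso; omega)) <;>
  (rcases f₄ with f₄ | f₄ | f₄ | f₄ | f₄ | f₄ | f₄ <;> try (exfalso; omega)) <;>
  refine ⟨?_, ?_, ?_, ?_⟩ <;> omega

theorem twistRegion_corner (n : ℕ) {d d' : Side (n + 2)} (h : (twistCode n).Corner d d') :
    twistRegion n d.1 d.2 = twistRegion n d'.1 d'.2 := by
  have key := fun c => twistRegion_aux (twistCode_cases n c _ _ rfl rfl)
  rcases h with (c | c | c | c | _ | _)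
  · exact (key c).1
  · exact (key c).2.1
  · exact (key c).2.2.1
  · exact (key c).2.2.2
  · simp [twistRegion]
  · simp [twistRegion, mul_add]

/-- The region of the twist diagram at a side of the edge with the number `e`. -/
noncomputable def twistSide (n e : ℕ) (s : Bool) : (twistCode n).Region :=
  if h : e < 2 * (n + 2) + 1 then (twistCode n).regionAt (⟨e, h⟩, s)
  else (twistCode n).regionAt (0, true)

theorem twistSide_val (n : ℕ) (e : Fin (2 * (n + 2) + 1)) (s : Bool) :
    twistSide n e s = (twistCode n).regionAt (e, s) := by
  simp only [twistSide, e.isLt, dite_true]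

theorem twistSide_ends (n : ℕ) : twistSide n 0 true = twistSide n 0 false ∧
    twistSide n (2 * n + 4) true = twistSide n (2 * n + 4) false := by
  have h₁ := fun s => twistSide_val n 0 s
  have h₂ := fun s => twistSide_val n (Fin.last (2 * (n + 2))) s
  simp only [Fin.val_zero, Fin.val_last] at h₁ h₂
  rw [show 2 * n + 4 = 2 * (n + 2) by ring, h₁, h₁, h₂, h₂]
  exact ⟨Quot.sound .first, Quot.sound .last⟩

theorem twistSide_corner (n c : ℕ) (hc : c < n + 2) : ∃ i k : ℕ,
    ((n % 2 = 0 ∧ c = 0 ∧ i = n + 1 ∧ k = 0) ∨ (n % 2 = 1 ∧ c = 0 ∧ i = 0 ∧ k = n + 2) ∨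
    (n % 2 = 0 ∧ c = n + 1 ∧ i = 2 * n + 3 ∧ k = n + 2) ∨
    (n % 2 = 1 ∧ c = n + 1 ∧ i = n + 1 ∧ k = 2 * n + 3) ∨
    (1 ≤ c ∧ c ≤ n ∧ c % 2 = 0 ∧ i = c ∧ k = 2 * n + 3 - c) ∨
    (1 ≤ c ∧ c ≤ n ∧ c % 2 = 1 ∧ i = 2 * n + 3 - c ∧ k = c)) ∧
    twistSide n (i + 1) true = twistSide n (k + 1) false ∧
    twistSide n (k + 1) true = twistSide n i true ∧
    twistSide n i false = twistSide n k true ∧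
    twistSide n k false = twistSide n (i + 1) false := by
  refine ⟨_, _, twistCode_cases n ⟨c, hc⟩ _ _ rfl rfl, ?_⟩
  have h₁ := fun s => twistSide_val n ((twistCode n).toRight ⟨c, hc⟩).succ s
  have h₂ := fun s => twistSide_val n ((twistCode n).toRight ⟨c, hc⟩).castSucc s
  have h₃ := fun s => twistSide_val n ((twistCode n).toLeft ⟨c, hc⟩).succ s
  have h₄ := fun s => twistSide_val n ((twistCode n).toLeft ⟨c, hc⟩).castSucc s
  simp only [Fin.val_succ, Fin.val_castSucc] at h₁ h₂ h₃ h₄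
  simp only [h₁, h₂, h₃, h₄]
  exact ⟨Quot.sound (.north _), Quot.sound (.west _), Quot.sound (.south _),
    Quot.sound (.east _)⟩

theorem twistSide_even {n c : ℕ} (h₁ : 1 ≤ c) (h₂ : c ≤ n) (h : c % 2 = 0) :
    twistSide n (c + 1) true = twistSide n (2 * n + 4 - c) false ∧
    twistSide n (2 * n + 4 - c) true = twistSide n c true ∧
    twistSide n c false = twistSide n (2 * n + 3 - c) true := by
  obtain ⟨i, k, h', a₁, a₂, a₃, -⟩ := twistSide_corner n c (by omega)
  obtain ⟨rfl, rfl⟩ : i = c ∧ k = 2 * n + 3 - c := by omega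
  rw [show 2 * n + 3 - i + 1 = 2 * n + 4 - i by omega] at a₁ a₂
  exact ⟨a₁, a₂, a₃⟩

theorem twistSide_odd {n c : ℕ} (h₂ : c ≤ n) (h : c % 2 = 1) :
    twistSide n (2 * n + 4 - c) true = twistSide n (c + 1) false ∧
    twistSide n (2 * n + 3 - c) false = twistSide n c true ∧
    twistSide n c false = twistSide n (2 * n + 4 - c) false := by
  obtain ⟨i, k, h', a₁, a₂, a₃, a₄⟩ := twistSide_corner n c (by omega)
  obtain ⟨rfl, rfl⟩ : k = c ∧ i = 2 * n + 3 - c := by omega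
  rw [show 2 * n + 3 - k + 1 = 2 * n + 4 - k by omega] at a₁ a₄
  exact ⟨a₁, a₃, a₄⟩

theorem twistSide_chain_odd {n : ℕ} (j : ℕ) (h : 2 * j + 1 ≤ n + 1) :
    twistSide n (2 * j + 1) true = twistSide n 1 true := by
  induction j with
  | zero => rfl
  | succ j ih =>
    have h₁ := (twistSide_odd (n := n) (c := 2 * j + 1) (by omega) (by omega)).2.1
    have h₂ := (twistSide_even (n := n) (c := 2 * j + 2) (by omega) (by omega) (by omega)).1
    rw [show 2 * n + 4 - (2 * j + 2) = 2 * n + 3 - (2 * j + 1) by omega, h₁,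
      ih (by omega)] at h₂
    exact h₂

theorem twistSide_chain_even {n : ℕ} (j : ℕ) (h : 2 * j + 2 ≤ n + 1) :
    twistSide n (2 * j + 2) false = twistSide n (2 * n + 3) true := by
  induction j with
  | zero => exact (twistSide_odd (n := n) (c := 1) (by omega) (by omega)).1.symm
  | succ j ih =>
    have h₁ := (twistSide_even (n := n) (c := 2 * j + 2) (by omega) (by omega) (by omega)).2.2
    have h₂ := (twistSide_odd (n := n) (c := 2 * j + 3) (by omega) (by omega)).1
    rw [show 2 * n + 4 - (2 * j + 3) = 2 * n + 3 - (2 * j + 2) by omega, ← h₁,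
      ih (by omega)] at h₂
    exact h₂.symm

/-- A side of an edge for each region of the twist diagram. -/
noncomputable def twistRep (n j : ℕ) : (twistCode n).Region :=
  if j ≤ n then twistSide n (j + 1) (decide (j % 2 = 1))
  else if j = n + 1 then twistSide n 1 true else twistSide n (2 * n + 3) true

theorem twistRep_low {n j : ℕ} (h : j ≤ n) :
    twistRep n j = twistSide n (j + 1) (decide (j % 2 = 1)) := by
  simp [twistRep, h]

theorem twistRep_outer (n : ℕ) : twistSide n 0 true = twistRep n n ∧
    twistSide n (2 * n + 4) true = twistRep n n ∧
    (n % 2 = 0 → twistSide n (n + 2) true = twistRep n 0 ∧ twistSide n (n + 2) false = twistRep n n ∧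
      twistSide n (n + 3) false = twistRep n n ∧
      twistSide n (n + 3) true = twistSide n (2 * n + 3) true) ∧
    (n % 2 = 1 → twistSide n (n + 2) true = twistRep n n ∧ twistSide n (n + 2) false = twistRep n 0 ∧
      twistSide n (n + 3) true = twistRep n n ∧
      twistSide n (n + 3) false = twistSide n 1 true) := by
  obtain ⟨e₁, e₂⟩ := twistSide_ends n
  obtain ⟨i, k, h, a₁, a₂, a₃, a₄⟩ := twistSide_corner n 0 (by omega)
  obtain ⟨i', k', h', b₁, b₂, b₃, b₄⟩ := twistSide_corner n (n + 1) (by omega)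
  rw [twistRep_low le_rfl, twistRep_low (Nat.zero_le n)]
  rcases Nat.mod_two_eq_zero_or_one n with hn | hn
  · obtain ⟨rfl, rfl⟩ : i = n + 1 ∧ k = 0 := by omega
    obtain ⟨rfl, rfl⟩ : i' = 2 * n + 3 ∧ k' = n + 2 := by omega
    simp [hn] at *
    grind
  · obtain ⟨rfl, rfl⟩ : i = 0 ∧ k = n + 2 := by omega
    obtain ⟨rfl, rfl⟩ : i' = n + 1 ∧ k' = 2 * n + 3 := by omega
    simp [hn] at *
    grind

theorem twistSide_eq_rep (n e : ℕ) (s : Bool) (he : e < 2 * n + 5) :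
    twistSide n e s = twistRep n (twistRegion n e s) := by
  obtain ⟨o₁, o₂, o₃, o₄⟩ := twistRep_outer n
  obtain ⟨e₁, e₂⟩ := twistSide_ends n
  have hU : twistRep n (n + 1) = twistSide n 1 true := by simp [twistRep]
  have hW : twistRep n (n + 2) = twistSide n (2 * n + 3) true := by simp [twistRep]
  rcases twistRegion_values n e he with ⟨h, v, w⟩ | ⟨h, v, w⟩ | ⟨h, v, w⟩ | ⟨h, v, w⟩ | ⟨h, v, w⟩ |
    ⟨h, v, w⟩ | ⟨h, v, w⟩
  · rcases h with rfl | rfl <;> cases s <;> simp only [v, w]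
    · rw [← e₁, o₁]
    · rw [o₁]
    · rw [← e₂, o₂]
    · rw [o₂]
  · cases s
    · obtain ⟨j, rfl⟩ : ∃ j, e = 2 * j + 2 := ⟨e / 2 - 1, by omega⟩
      rw [w, hW, twistSide_chain_even j h.2.1]
    · obtain ⟨j, rfl⟩ : ∃ j, e = j + 1 := ⟨e - 1, by omega⟩
      rw [v, Nat.add_sub_cancel, twistRep_low (by omega), decide_eq_true (by omega)]
  · cases s
    · obtain ⟨j, rfl⟩ : ∃ j, e = j + 1 := ⟨e - 1, by omega⟩
      rw [w, Nat.add_sub_cancel, twistRep_low (by omega), decide_eq_false (by omega)]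
    · obtain ⟨j, rfl⟩ : ∃ j, e = 2 * j + 1 := ⟨e / 2, by omega⟩
      rw [v, hU, twistSide_chain_odd j h.1]
  · obtain ⟨rfl, hn⟩ := h
    cases s
    · rw [w, (o₃ hn).2.1]
    · rw [v, (o₃ hn).1]
  · obtain ⟨rfl, hn⟩ := h
    cases s
    · rw [w, (o₄ hn).2.1]
    · rw [v, (o₄ hn).1]
  · by_cases h₃ : e = n + 3
    · subst h₃
      have hn : n % 2 = 1 := by omega
      cases s
      · rw [w, hU, (o₄ hn).2.2.2]
      · rw [v, (o₄ hn).2.2.1]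
        congr 1
        omega
    · obtain ⟨c, rfl, hc⟩ : ∃ c, e = 2 * n + 4 - c ∧ c ≤ n := ⟨2 * n + 4 - e, by omega, by omega⟩
      obtain ⟨a₁, a₂, a₃⟩ := twistSide_even (n := n) (c := c) (by omega) (by omega) (by omega)
      cases s
      · obtain ⟨j, rfl⟩ : ∃ j, c = 2 * j := ⟨c / 2, by omega⟩
        rw [w, hU, ← a₁, twistSide_chain_odd j (by omega)]
      · obtain ⟨j, rfl⟩ : ∃ j, c = j + 1 := ⟨c - 1, by omega⟩
        rw [v, a₂, show 2 * n + 3 - (2 * n + 4 - (j + 1)) = j by omega, twistRep_low (by omega),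
          decide_eq_true (by omega)]
  · by_cases h₃ : e = n + 3
    · subst h₃
      have hn : n % 2 = 0 := by omega
      cases s
      · rw [w, (o₃ hn).2.2.1]
        congr 1
        omega
      · rw [v, hW, (o₃ hn).2.2.2]
    · obtain ⟨c, rfl, hc⟩ : ∃ c, e = 2 * n + 4 - c ∧ c ≤ n := ⟨2 * n + 4 - e, by omega, by omega⟩
      obtain ⟨a₁, a₂, a₃⟩ := twistSide_odd (n := n) (c := c) (by omega) (by omega)
      cases s
      · obtain ⟨j, rfl⟩ : ∃ j, c = j + 1 := ⟨c - 1, by omega⟩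
        rw [w, ← a₃, show 2 * n + 3 - (2 * n + 4 - (j + 1)) = j by omega, twistRep_low (by omega),
          decide_eq_false (by omega)]
      · obtain ⟨j, rfl⟩ : ∃ j, c = 2 * j + 1 := ⟨c / 2, by omega⟩
        rw [v, hW, a₁, ← twistSide_chain_even j (by omega)]

theorem twistCode_planar (n : ℕ) : (twistCode n).Planar := by
  let f : (twistCode n).Region → Fin (n + 3) := Quot.lift
    (fun d => ⟨twistRegion n d.1 d.2, twistRegion_lt n _ _ (by have := d.1.isLt; omega)⟩)
    (fun d d' h => by simp only [Fin.mk.injEq]; exact twistRegion_corner n h)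
  have hf : Function.Bijective f := by
    constructor
    · rintro ⟨d⟩ ⟨d'⟩ h
      have h' : twistRegion n d.1 d.2 = twistRegion n d'.1 d'.2 := congrArg Fin.val h
      have h₁ := twistSide_eq_rep n d.1 d.2 (by have := d.1.isLt; omega)
      have h₂ := twistSide_eq_rep n d'.1 d'.2 (by have := d'.1.isLt; omega)
      rw [← h', ← h₁, twistSide_val, twistSide_val] at h₂
      exact h₂.symm
    · intro j
      have key : ∀ (e : ℕ) (s : Bool), e < 2 * n + 5 → twistRegion n e s = j → ∃ a, f a = j :=
        fun e s he h => ⟨(twistCode n).regionAt (⟨e, by omega⟩, s), Fin.ext h⟩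
      have hj := j.isLt
      by_cases h₁ : j.val ≤ n
      · rcases Nat.mod_two_eq_zero_or_one (j.val + 1) with h | h
        · exact key (j + 1) true (by omega)
            ((twistRegion_low_even (by omega) (by omega) h).1.trans (by omega))
        · exact key (j + 1) false (by omega)
            ((twistRegion_low_odd (by omega) h).2.trans (by omega))
      · by_cases h₂ : j.val = n + 1
        · exact key 1 true (by omega) ((twistRegion_low_odd (by omega) rfl).1.trans h₂.symm)
        · exact key (2 * n + 3) true (by omega)
            ((twistRegion_high_odd (by omega) (by omega)).1.trans (by omega))
  rw [GaussCode.Planar, Nat.card_eq_of_bijective f hf, Nat.card_fin]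

/-- The twist knotoid diagram `T_n`, with both endpoints in the infinite region. -/
noncomputable def twistDiagram (n : ℕ) : KnotoidDiagram (n + 2) where
  toGaussCode := twistCode n
  planar := twistCode_planar n
  outer := (twistCode n).regionAt (0, true)

/-- The twist knotoid `T_n`. -/
noncomputable def twistKnotoid (n : ℕ) : Knotoid := (twistDiagram n).knotoid

/-! The shadow cocycle sum does not change under the Reidemeister moves, and for the twist diagrams
it can be computed explicitly.

Invariance. A coloring is recorded edge by edge, as the color of the arc together with the color of
the region on the right (`coloringEquiv`). The colors at a crossing then form one pattern in three
parameters `y`, `x`, `z`. As all quandle actions are invertible, the over-color and one under-edge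
determine the pattern (`IsCrossing.unique`). For each move, the colorings of the two diagrams that
agree away from the monogon, bigon or triangle correspond bijectively, with the same color at
infinity and the same product of weights (`Move.coloringsCorrespond`). A kink has weight `f y x x =
1`; the two crossings of a bigon have equal colors and opposite signs; the weights at a triangle
before and after the third move are the six factors of the cocycle condition
(`stateWeight_triangle`). The delicate point is the second move: a Gauss code does not say that the
two strands run along a common region before the move. This follows from planarity, by counting
regions (`regionAt_eq_of_bigon`).

Twist diagrams. For odd `N`, the colorings of `T_n` by the dihedral quandle of order `N` are
parametrized by pairs `(b, d)` with `(2n + 1) d = 0` (`twistColoring_bijective`). Both ends have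
color `b`, the arcs in the twist region run through an arithmetic progression of difference `d`, and
the clasp closes up exactly under this condition. The endpoint condition then forces the colors of
the regions. Counting colorings with `N = 2n' + 1` separates `T_n` from `T_n'` for `n < n'`
(`twistKnotoid_injective`).

For `N = 3` and `n = m + 1` with `9 ∣ m` the condition on `d` is void, and the infinite region has
color `b = 0`. The crossing `c ≤ n` contributes `u ^ (-c² d²)` and the remaining clasp crossing
contributes `1`. The sum of the squares is `1` modulo three, so a coloring contributes `u ^ (-d²)`,
and `d = 0, 1, 2` give `1 + 2u²`. Reversing the strand and exchanging the clasp crossings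
interchanges over- and under-passages (`twistCode_rev`). Hence the colorings of the mirror image are
those of the diagram read backwards, with inverse weights, and the sum becomes `1 + 2u`. -/

/-! ### Colorings of the edges of a knotoid diagram -/

namespace GaussCode

variable {n : ℕ} (G : GaussCode n)

/-- The edge of the over-strand of `c` on the side `m` of the under-strand (`true` is left). -/
def overAt (c : Fin n) (m : Bool) : Fin (2 * n + 1) :=
  if m = G.sign c then (G.pass.symm (c, true)).castSucc else (G.pass.symm (c, true)).succ

/-- The edge of the under-strand of `c` on the side `s` of the over-strand (`true` is left). -/
def underAt (c : Fin n) (s : Bool) : Fin (2 * n + 1) :=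
  if s = G.sign c then (G.pass.symm (c, false)).succ else (G.pass.symm (c, false)).castSucc

theorem underRight_eq (c : Fin n) : G.underRight c = G.underAt c false := by
  unfold underRight underAt
  cases G.sign c <;> simp

theorem underLeft_eq (c : Fin n) : G.underLeft c = G.underAt c true := by
  unfold underLeft underAt
  cases G.sign c <;> simp

/-- The edge before or after a passage. -/
def edgeAt (w : Fin n × Bool) (after : Bool) : Fin (2 * n + 1) :=
  if after then (G.pass.symm w).succ else (G.pass.symm w).castSucc

theorem overAt_eq_edgeAt (c : Fin n) (m : Bool) :
    G.overAt c m = G.edgeAt (c, true) (xor m (G.sign c)) := by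
  unfold overAt edgeAt
  cases G.sign c <;> cases m <;> simp

theorem underAt_eq_edgeAt (c : Fin n) (s : Bool) :
    G.underAt c s = G.edgeAt (c, false) (!xor s (G.sign c)) := by
  unfold underAt edgeAt
  cases G.sign c <;> cases s <;> simp

theorem overAt_eq_or (c : Fin n) (m : Bool) :
    G.overAt c m = (G.pass.symm (c, true)).castSucc ∨
      G.overAt c m = (G.pass.symm (c, true)).succ := by
  unfold overAt
  split_ifs <;> simp

theorem overAt_sign (c : Fin n) :
    G.overAt c (G.sign c) = (G.pass.symm (c, true)).castSucc ∧
      G.overAt c (!G.sign c) = (G.pass.symm (c, true)).succ := by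
  simp [overAt]

theorem underAt_sign (c : Fin n) :
    G.underAt c (!G.sign c) = (G.pass.symm (c, false)).castSucc ∧
      G.underAt c (G.sign c) = (G.pass.symm (c, false)).succ := by
  simp [underAt]

/-- The quadrant on the side `t` of the over-strand and `m` of the under-strand lies between `overAt
c m` and `underAt c t`, whatever the sign. This removes the sign and the compass directions from the
later arguments. -/
theorem corner_cases {d d' : Side n} (h : G.Corner d d') :
    (∃ c t m, d = (G.overAt c m, t) ∧ d' = (G.underAt c t, m)) ∨
      (∃ c t m, d' = (G.overAt c m, t) ∧ d = (G.underAt c t, m)) ∨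
      (d = (0, true) ∧ d' = (0, false)) ∨
      (d = (Fin.last (2 * n), true) ∧ d' = (Fin.last (2 * n), false)) := by
  rcases h with (c | c | c | c | _ | _)
  iterate 4
    · rcases hs : G.sign c with _ | _
      all_goals
        first
        | (refine .inl ⟨c, ?_⟩
           simp [overAt, underAt, toRight, toLeft, hs]; done)
        | (refine .inr (.inl ⟨c, ?_⟩)
           simp [overAt, underAt, toRight, toLeft, hs])
  · exact .inr (.inr (.inl ⟨rfl, rfl⟩))
  · exact .inr (.inr (.inr ⟨rfl, rfl⟩))

theorem regionAt_over (c : Fin n) (t m : Bool) :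
    G.regionAt (G.overAt c m, t) = G.regionAt (G.underAt c t, m) := by
  have h₁ : G.regionAt _ = G.regionAt _ := Quot.sound (Corner.north (G := G) c)
  have h₂ : G.regionAt _ = G.regionAt _ := Quot.sound (Corner.west (G := G) c)
  have h₃ : G.regionAt _ = G.regionAt _ := Quot.sound (Corner.south (G := G) c)
  have h₄ : G.regionAt _ = G.regionAt _ := Quot.sound (Corner.east (G := G) c)
  rcases hs : G.sign c with _ | _ <;> cases t <;> cases m <;>
    simp [overAt, underAt, toRight, toLeft, hs] at h₁ h₂ h₃ h₄ ⊢ <;> grind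

end GaussCode

/-! ### The pattern of colors around one crossing. -/

section States

variable {X Y : Type} [Quandle X] [QuandleSet X Y]

/-- The colors of the over-arc and of the region to its right, at the over-edge on the side `m` of
the under-strand. The region to the right of both strands has color `y`, the under-arc there
has color `x`, and the over-arc has color `z`. -/
def overState (y : Y) (x z : X) (m : Bool) : X × Y :=
  (z, cond m (QuandleSet.op y x) y)

/-- The colors of the under-arc and of the region to its right, at the under-edge on the side `s`
of the over-strand. -/
def underState (y : Y) (x z : X) (s : Bool) : X × Y :=
  (cond s (z ◃ x) x, cond s (QuandleSet.op y z) y)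

/-- The color of the region on the side `s` of an edge. -/
def sideColor (p : X × Y) (s : Bool) : Y :=
  cond s (QuandleSet.op p.2 p.1) p.2

theorem op_injective {a : X} {y y' : Y} (h : QuandleSet.op y a = QuandleSet.op y' a) : y = y' :=
  (QuandleSet.op_bijective a).1 h

theorem exists_op (a : X) (y : Y) : ∃ y', QuandleSet.op y' a = y :=
  (QuandleSet.op_bijective a).2 y

/-- A quadrant gets the same color from either of its two edges. Only the quadrant left of both
strands needs an axiom: there the two strands are crossed in different orders, which is
`QuandleSet.op_op`. -/
theorem sideColor_over (y : Y) (x z : X) (m t : Bool) :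
    sideColor (overState y x z m) t = sideColor (underState y x z t) m := by
  cases m <;> cases t
  iterate 3 · rfl
  · exact QuandleSet.op_op y x z

theorem sideColor_injective {p p' : X × Y} (s : Bool) (h : p.1 = p'.1)
    (h' : sideColor p s = sideColor p' s) : p = p' := by
  obtain ⟨x, y⟩ := p
  obtain ⟨x', y'⟩ := p'
  obtain rfl : x = x' := h
  cases s
  · exact Prod.ext rfl h'
  · exact Prod.ext rfl (op_injective h')

theorem underState_injective {y y' : Y} {x x' z : X} {s : Bool}
    (h : underState y x z s = underState y' x' z s) : y = y' ∧ x = x' := by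
  cases s <;> simp only [underState, cond_true, cond_false, Prod.mk.injEq] at h
  · exact ⟨h.2, h.1⟩
  · exact ⟨op_injective h.2, (Rack.left_cancel z).1 h.1⟩

/-- Both actions of `z` can be undone. This produces the parameters of a new crossing when a strand
of color `z` is pushed over an edge colored `p`. -/
theorem exists_underState (z : X) (s : Bool) (p : X × Y) : ∃ y x, underState y x z s = p := by
  cases s
  · exact ⟨p.2, p.1, rfl⟩
  · obtain ⟨y, hy⟩ := exists_op z p.2
    obtain ⟨x, hx⟩ := (Rack.act' z).surjective p.1
    exact ⟨y, x, Prod.ext hx hy⟩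

/-- The coloring rule at a crossing, for the colors `o` and `u` at the edges of the over-strand and
of the under-strand on the two sides of the other strand. -/
def IsCrossing (o u : Bool → X × Y) : Prop :=
  ∃ y x z, (∀ m, o m = overState y x z m) ∧ ∀ s, u s = underState y x z s

/-- The over-color and one under-edge determine the colors at a crossing. -/
theorem IsCrossing.eq_states {o u : Bool → X × Y} (h : IsCrossing o u) {y : Y} {x z : X} {m s : Bool}
    (ho : (o m).1 = z) (hu : u s = underState y x z s) :
    (∀ m, o m = overState y x z m) ∧ ∀ s, u s = underState y x z s := by
  obtain ⟨y', x', z', h₁, h₂⟩ := h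
  rw [h₁] at ho
  obtain rfl : z' = z := ho
  rw [h₂] at hu
  obtain ⟨rfl, rfl⟩ := underState_injective hu
  exact ⟨h₁, h₂⟩

/-- The over-arc keeps its color through the crossing, so its color may be read off on different
sides `m`, `m'` in the two patterns; the under-edge then gives `y` and `x` by invertibility. -/
theorem IsCrossing.unique {o u o' u' : Bool → X × Y} (h : IsCrossing o u) (h' : IsCrossing o' u')
    {m m' s : Bool} (ho : (o m).1 = (o' m').1) (hu : u s = u' s) : o = o' ∧ u = u' := by
  obtain ⟨y, x, z, h₁, h₂⟩ := h
  have hz : (o m).1 = z := by rw [h₁]; rfl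
  have := h'.eq_states (y := y) (x := x) (z := z) (m := m') (s := s) (by rw [← ho, hz])
    (by rw [← hu, h₂])
  exact ⟨funext fun m => by rw [h₁, this.1], funext fun s => by rw [h₂, this.2]⟩

theorem IsCrossing.fst_eq {o u : Bool → X × Y} (h : IsCrossing o u) (m m' : Bool) :
    (o m).1 = (o m').1 := by
  obtain ⟨y, x, z, h₁, -⟩ := h
  rw [h₁, h₁]; rfl

end States

namespace GaussCode

variable {n : ℕ} (G : GaussCode n) {X Y A : Type} [Quandle X] [QuandleSet X Y] [CommGroup A]

/-- A coloring, given by the color of the arc and of the region on the right at each edge. -/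
structure IsEdgeColoring (q : Fin (2 * n + 1) → X × Y) : Prop where
  crossing : ∀ c, IsCrossing (fun m => q (G.overAt c m)) (fun s => q (G.underAt c s))
  first : QuandleSet.op (q 0).2 (q 0).1 = (q 0).2
  last : QuandleSet.op (q (Fin.last (2 * n))).2 (q (Fin.last (2 * n))).1 = (q (Fin.last (2 * n))).2

/-- The weight of the colors at a crossing of sign `b`. -/
def stateWeight (f : QuandleCocycle X Y A) (b : Bool) (y : Y) (x z : X) : A :=
  if b then f.toFun y x z else (f.toFun y x z)⁻¹

/-- The local weight of a crossing, in terms of the colors at the edges. -/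
def edgeWeight (f : QuandleCocycle X Y A) (q : Fin (2 * n + 1) → X × Y) (c : Fin n) : A :=
  stateWeight f (G.sign c) (q (G.underAt c false)).2 (q (G.underAt c false)).1
    (q (G.overAt c false)).1

theorem edgeWeight_eq (f : QuandleCocycle X Y A) {q : Fin (2 * n + 1) → X × Y} {c : Fin n} {y : Y}
    {x z : X} {m : Bool} (ho : q (G.overAt c m) = overState y x z m)
    (hu : ∀ s, q (G.underAt c s) = underState y x z s)
    (h : IsCrossing (fun m => q (G.overAt c m)) (fun s => q (G.underAt c s))) :
    G.edgeWeight f q c = stateWeight f (G.sign c) y x z := by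
  have hz : (q (G.overAt c false)).1 = z := by
    rw [h.fst_eq false m]; simp only [ho]; rfl
  rw [edgeWeight, hz, hu]; rfl

end GaussCode

/-! ### Colorings of arcs and regions as colorings of edges. -/

namespace KnotoidDiagram

variable {n : ℕ} (D : KnotoidDiagram n) {X Y A : Type} [Quandle X] [QuandleSet X Y] [CommGroup A]

variable (X Y) in
/-- The colorings of a diagram, given by the colors at the edges. -/
def EdgeColoring : Type := {q : Fin (2 * n + 1) → X × Y // D.toGaussCode.IsEdgeColoring q}

variable {D}

theorem Coloring.ext' {c c' : D.Coloring X Y} (h₁ : c.arc = c'.arc) (h₂ : c.region = c'.region) :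
    c = c' := by
  cases c; cases c'; simp_all

theorem Coloring.arc_over (col : D.Coloring X Y) (c : Fin n) (m : Bool) :
    col.arc (D.arcAt (D.overAt c m)) = col.arc (D.overArc c) := by
  rcases D.overAt_eq_or c m with h | h
  · rw [h]; rfl
  · rw [h]
    exact congrArg col.arc (Quot.sound (GaussCode.OverJoined.over c)).symm

/-- The colors at the edges, from those of the arcs and regions. -/
def Coloring.toEdge (col : D.Coloring X Y) : D.EdgeColoring X Y :=
  ⟨fun e => (col.arc (D.arcAt e), col.region (D.regionAt (e, false))), by
    refine ⟨fun c => ?_, ?_, ?_⟩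
    · have hu := col.crossing c
      rw [D.underLeft_eq, D.underRight_eq] at hu
      have ho := col.arc_over c
      -- From the quadrant right of both strands, crossing the under-edge or the over-edge leads to
      -- the two adjacent quadrants. The fourth quadrant imposes nothing new.
      have e₁ := col.edge (D.underAt c false)
      have e₂ := col.edge (D.overAt c false)
      have r₁ := D.regionAt_over c false false
      have r₂ := D.regionAt_over c false true
      have r₃ := D.regionAt_over c true false
      rw [ho] at e₂
      refine ⟨col.region (D.regionAt (D.underAt c false, false)),
        col.arc (D.arcAt (D.underAt c false)), col.arc (D.overArc c), fun m => ?_, fun s => ?_⟩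
      · cases m
        · exact Prod.ext (ho _) (congrArg col.region r₁)
        · exact Prod.ext (ho _) ((congrArg col.region r₂).trans e₁)
      · cases s
        · rfl
        · refine Prod.ext hu ((congrArg col.region r₃).symm.trans (e₂.trans ?_))
          exact congrArg (QuandleSet.op · _) (congrArg col.region r₁)
    · exact (col.edge 0).symm.trans (congrArg col.region (Quot.sound GaussCode.Corner.first))
    · exact (col.edge _).symm.trans (congrArg col.region (Quot.sound GaussCode.Corner.last))⟩

/-- Colors of sides descend to regions: the quadrants are handled by `sideColor_over`, and the
corners at the endpoints are the two end conditions of an edge coloring. -/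
theorem EdgeColoring.side_corner (q : D.EdgeColoring X Y) {d d' : Side n}
    (h : D.toGaussCode.Corner d d') : sideColor (q.1 d.1) d.2 = sideColor (q.1 d'.1) d'.2 := by
  have key : ∀ c t m, sideColor (q.1 (D.overAt c m)) t = sideColor (q.1 (D.underAt c t)) m := by
    intro c t m
    obtain ⟨y, x, z, h₁, h₂⟩ := q.2.crossing c
    simp only at h₁ h₂
    rw [h₁, h₂, sideColor_over]
  rcases D.toGaussCode.corner_cases h with ⟨c, t, m, rfl, rfl⟩ | ⟨c, t, m, rfl, rfl⟩ | ⟨rfl, rfl⟩ |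
    ⟨rfl, rfl⟩
  · exact key c t m
  · exact (key c t m).symm
  · exact q.2.first
  · exact q.2.last

/-- The color of a region, from the colors at the edges. -/
def EdgeColoring.region (q : D.EdgeColoring X Y) : D.Region → Y :=
  Quot.lift (fun d => sideColor (q.1 d.1) d.2) fun _ _ h => q.side_corner h

theorem EdgeColoring.region_regionAt (q : D.EdgeColoring X Y) (d : Side n) :
    q.region (D.regionAt d) = sideColor (q.1 d.1) d.2 := rfl

theorem EdgeColoring.over_eq (q : D.EdgeColoring X Y) (c : Fin n) :
    (q.1 (D.pass.symm (c, true)).castSucc).1 = (q.1 (D.pass.symm (c, true)).succ).1 := by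
  rw [← (D.overAt_sign c).1, ← (D.overAt_sign c).2]
  exact (q.2.crossing c).fst_eq _ _

/-- The colors of arcs and regions, from the colors at the edges. -/
def EdgeColoring.toColoring (q : D.EdgeColoring X Y) : D.Coloring X Y where
  arc := Quot.lift (fun e => (q.1 e).1) (by rintro _ _ ⟨c⟩; exact q.over_eq c)
  region := q.region
  crossing c := by
    obtain ⟨y, x, z, h₁, h₂⟩ := q.2.crossing c
    rw [D.underLeft_eq, D.underRight_eq]
    change (q.1 (D.underAt c true)).1 = (q.1 _).1 ◃ (q.1 (D.underAt c false)).1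
    rw [← (D.overAt_sign c).1]
    simp only at h₁ h₂
    rw [h₁, h₂, h₂]; rfl
  edge e := rfl

variable (D X Y) in
/-- A coloring of the arcs and regions is the same as a coloring of the edges. -/
def coloringEquiv : D.Coloring X Y ≃ D.EdgeColoring X Y where
  toFun := Coloring.toEdge
  invFun := EdgeColoring.toColoring
  left_inv col := by
    refine Coloring.ext' ?_ ?_
    · ext ⟨e⟩; rfl
    · ext ⟨e, s⟩
      cases s
      · rfl
      · exact (col.edge e).symm
  right_inv q := rfl

theorem region_eq (col : D.Coloring X Y) (r : D.Region) :
    col.region r = (coloringEquiv D X Y col).region r :=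
  congrArg (fun c : D.Coloring X Y => c.region r) ((coloringEquiv D X Y).left_inv col).symm

/-- The specified region is named through the edge leaving `toRight`, an over-edge or an under-edge
according to the sign. In both cases this edge borders on the quadrant right of both strands. -/
theorem localWeight_eq (f : QuandleCocycle X Y A) (col : D.Coloring X Y) (c : Fin n) :
    D.localWeight f col c = D.edgeWeight f (coloringEquiv D X Y col).1 c := by
  have h : D.regionAt (D.specified c) = D.regionAt (D.underAt c false, false) := by
    rw [← D.regionAt_over c false false, specified]
    rcases hs : D.sign c with _ | _
    · rw [D.regionAt_over c false false]
      simp [GaussCode.toRight, GaussCode.underAt, hs]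
    · simp [GaussCode.toRight, GaussCode.overAt, hs]
  have ho := col.arc_over c false
  change _ = GaussCode.stateWeight f (D.sign c) (col.region (D.regionAt (D.underAt c false, false)))
    (col.arc (D.arcAt (D.underAt c false))) (col.arc (D.arcAt (D.overAt c false)))
  rw [ho, localWeight, h, D.underRight_eq]; rfl

/-- The invariant as a sum over colorings of the edges. -/
theorem shadowInvariant_eq [Finite X] [Finite Y] (f : QuandleCocycle X Y A) (Y₀ : Set Y) :
    D.shadowInvariant f Y₀ = ∑ᶠ (q : D.EdgeColoring X Y) (_ : q.region D.outer ∈ Y₀),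
      MonoidAlgebra.of ℤ A (∏ c, D.edgeWeight f q.1 c) := by
  refine finsum_eq_of_bijective _ (coloringEquiv D X Y).bijective fun col => ?_
  simp only [region_eq, localWeight_eq]

end KnotoidDiagram

/-! ### Three strands crossing each other pairwise, and the cocycle condition. -/

section Cube

variable {X Y A : Type} [Quandle X] [QuandleSet X Y] [CommGroup A]

/-- The colors at an edge of the top strand, on the side `m` of the middle strand and on the side
`b` of the bottom strand. Right of all three strands the region has color `y`, and there the bottom,
middle and top strands have colors `x₁`, `x₂`, `x₃`. -/
def topState (y : Y) (x₁ x₂ x₃ : X) (m b : Bool) : X × Y :=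
  overState (cond b (QuandleSet.op y x₁) y) x₂ x₃ m

/-- The colors at an edge of the middle strand. -/
def middleState (y : Y) (x₁ x₂ x₃ : X) (t b : Bool) : X × Y :=
  underState (cond b (QuandleSet.op y x₁) y) x₂ x₃ t

/-- The colors at an edge of the bottom strand. -/
def bottomState (y : Y) (x₁ x₂ x₃ : X) (t m : Bool) : X × Y :=
  underState (cond m (QuandleSet.op y x₂) y) (cond m (x₂ ◃ x₁) x₁) x₃ t

/-- The definition reads the edge at the crossing with the middle strand; this form reads it at the
crossing with the bottom strand. The two readings agree by `QuandleSet.op_op`, needed only left of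
both lower strands. -/
theorem topState_eq (y : Y) (x₁ x₂ x₃ : X) (m b : Bool) :
    topState y x₁ x₂ x₃ m b =
      overState (cond m (QuandleSet.op y x₂) y) (cond m (x₂ ◃ x₁) x₁) x₃ b := by
  cases m <;> cases b
  iterate 3 · rfl
  · exact Prod.ext rfl (QuandleSet.op_op y x₁ x₂)

theorem middleState_eq (y : Y) (x₁ x₂ x₃ : X) (t b : Bool) :
    middleState y x₁ x₂ x₃ t b =
      overState (cond t (QuandleSet.op y x₃) y) (cond t (x₃ ◃ x₁) x₁) (cond t (x₃ ◃ x₂) x₂) b := by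
  cases t <;> cases b
  iterate 3 · rfl
  · exact Prod.ext rfl (QuandleSet.op_op y x₁ x₃)

/-- Left of both upper strands the bottom strand has been acted on by them in two orders. The arc
colors agree by self-distributivity, the region colors by `QuandleSet.op_op`. -/
theorem bottomState_eq (y : Y) (x₁ x₂ x₃ : X) (t m : Bool) :
    bottomState y x₁ x₂ x₃ t m =
      underState (cond t (QuandleSet.op y x₃) y) (cond t (x₃ ◃ x₁) x₁) (cond t (x₃ ◃ x₂) x₂) m := by
  cases t <;> cases m
  iterate 3 · rfl
  · exact Prod.ext Shelf.self_distrib (QuandleSet.op_op y x₂ x₃)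

theorem isCrossing_top_middle (y : Y) (x₁ x₂ x₃ : X) (b : Bool) :
    IsCrossing (fun m => topState y x₁ x₂ x₃ m b) (fun t => middleState y x₁ x₂ x₃ t b) :=
  ⟨_, _, _, fun _ => rfl, fun _ => rfl⟩

theorem isCrossing_top_bottom (y : Y) (x₁ x₂ x₃ : X) (m : Bool) :
    IsCrossing (fun b => topState y x₁ x₂ x₃ m b) (fun t => bottomState y x₁ x₂ x₃ t m) :=
  ⟨_, _, _, fun _ => topState_eq .., fun _ => rfl⟩

theorem isCrossing_middle_bottom (y : Y) (x₁ x₂ x₃ : X) (t : Bool) :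
    IsCrossing (fun b => middleState y x₁ x₂ x₃ t b) (fun m => bottomState y x₁ x₂ x₃ t m) :=
  ⟨_, _, _, fun _ => middleState_eq .., fun _ => bottomState_eq ..⟩

/-- The colors at the three crossings of a triangle are determined by those right of all strands. -/
theorem exists_cube {oP uP oQ uQ oR uR : Bool → X × Y} (hP : IsCrossing oP uP)
    (hQ : IsCrossing oQ uQ) (hR : IsCrossing oR uR) {s t u : Bool} (h₁ : oP t = oQ u)
    (h₂ : uP s = oR u) (h₃ : uQ s = uR t) : ∃ y x₁ x₂ x₃,
      ((∀ m, oP m = topState y x₁ x₂ x₃ m u) ∧ ∀ a, uP a = middleState y x₁ x₂ x₃ a u) ∧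
      ((∀ b, oQ b = topState y x₁ x₂ x₃ t b) ∧ ∀ a, uQ a = bottomState y x₁ x₂ x₃ a t) ∧
      (∀ b, oR b = middleState y x₁ x₂ x₃ s b) ∧ ∀ m, uR m = bottomState y x₁ x₂ x₃ s m := by
  obtain ⟨yP, x₂, x₃, oP', uP'⟩ := hP
  obtain ⟨yQ, xQ, zQ, oQ', uQ'⟩ := hQ
  obtain rfl : zQ = x₃ := by
    rw [oP', oQ'] at h₁
    exact (congrArg Prod.fst h₁).symm
  -- The crossing of top and bottom sees the bottom color on the side `t` of the middle strand;
  -- undoing the action of `x₂` moves it to the right of all strands. Likewise `y` is moved back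
  -- across the bottom strand.
  obtain ⟨x₁, rfl⟩ : ∃ x₁, cond t (x₂ ◃ x₁) x₁ = xQ := by
    cases t
    · exact ⟨xQ, rfl⟩
    · exact (Rack.act' x₂).surjective xQ
  obtain ⟨y, rfl⟩ : ∃ y, cond u (QuandleSet.op y x₁) y = yP := by
    cases u
    · exact ⟨yP, rfl⟩
    · exact exists_op x₁ yP
  -- The two crossings on the top strand share an edge, so their region colors come from the same
  -- `y`.
  obtain rfl : cond t (QuandleSet.op y x₂) y = yQ := by
    have h := h₁
    rw [oP', oQ'] at h
    change topState y x₁ x₂ zQ t u = _ at h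
    rw [topState_eq] at h
    replace h := congrArg Prod.snd h
    cases u
    · exact h
    · exact op_injective h
  have e₂ : oR u = middleState y x₁ x₂ zQ s u := by rw [← h₂, uP']; rfl
  have e₃ : uR t = bottomState y x₁ x₂ zQ s t := by rw [← h₃, uQ']; rfl
  rw [bottomState_eq] at e₃
  -- The third crossing has no freedom left: its over-color and one of its under-edges are edges of
  -- the triangle that are already known.
  have hR' := hR.eq_states (m := u) (by rw [e₂, middleState_eq]; rfl) e₃
  refine ⟨y, x₁, x₂, zQ, ⟨oP', uP'⟩, ⟨fun b => ?_, uQ'⟩, fun b => ?_, fun m => ?_⟩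
  · rw [topState_eq, oQ']
  · rw [middleState_eq, hR'.1]
  · rw [bottomState_eq, hR'.2]

/-- The cocycle condition: the product of the weights at a triangle does not change in a third
Reidemeister move. -/
theorem stateWeight_triangle (f : QuandleCocycle X Y A) (y : Y) (x₁ x₂ x₃ : X)
    {s t u p q r : Bool} (hq : (xor t p) = !xor u q) (hr : (xor s q) = !xor t r) 
    (hr' : (!xor s p) = !xor u r) :
    GaussCode.stateWeight f p (cond u (QuandleSet.op y x₁) y) x₂ x₃ *
      GaussCode.stateWeight f q (cond t (QuandleSet.op y x₂) y) (cond t (x₂ ◃ x₁) x₁) x₃ *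
      GaussCode.stateWeight f r (cond s (QuandleSet.op y x₃) y) (cond s (x₃ ◃ x₁) x₁)
        (cond s (x₃ ◃ x₂) x₂) =
    GaussCode.stateWeight f p (cond (!u) (QuandleSet.op y x₁) y) x₂ x₃ *
      GaussCode.stateWeight f q (cond (!t) (QuandleSet.op y x₂) y) (cond (!t) (x₂ ◃ x₁) x₁) x₃ *
      GaussCode.stateWeight f r (cond (!s) (QuandleSet.op y x₃) y) (cond (!s) (x₃ ◃ x₁) x₁)
        (cond (!s) (x₃ ◃ x₂) x₂) := by
  have h := f.cocycle y x₁ x₂ x₃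
  apply Additive.ofMul.injective
  replace h := congrArg Additive.ofMul h
  -- The sign relations determine `q` and `r` from the sides and `p`; the inconsistent cases are
  -- void. Each crossing contributes a pair of opposite faces of a cube, and in every remaining case
  -- these six factors form the cocycle condition up to inversion.
  cases s <;> cases t <;> cases u <;> cases p <;> cases q <;> cases r <;>
    simp [GaussCode.stateWeight] at * <;> grind

end Cube

/-! ### A criterion for the colorings of two diagrams to correspond. -/

namespace KnotoidDiagram

/-- Corresponding colorings of two diagrams, with the same color of the infinite region and the same
product of weights. -/
def ColoringsCorrespond (x y : Σ n, KnotoidDiagram n) (X Y A : Type) [Quandle X] [QuandleSet X Y]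
    [CommGroup A] : Prop :=
  ∃ φ : x.2.EdgeColoring X Y → y.2.EdgeColoring X Y, Function.Bijective φ ∧
    ∀ q, (φ q).region y.2.outer = q.region x.2.outer ∧
      ∀ f : QuandleCocycle X Y A, ∏ c, y.2.edgeWeight f (φ q).1 c = ∏ c, x.2.edgeWeight f q.1 c

variable {m n : ℕ} {D : KnotoidDiagram m} {D' : KnotoidDiagram n}
  {X Y A : Type} [Quandle X] [QuandleSet X Y] [CommGroup A]

/-- Colorings correspond if outside of the set `S` of edges they are the same, where `π` maps the
edges of `D'` to those of `D`. -/
theorem coloringsCorrespond_of_agree (π : Fin (2 * n + 1) → Fin (2 * m + 1))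
    (S : Set (Fin (2 * n + 1)))
    (unique' : ∀ q₁ q₂ : D.EdgeColoring X Y, (∀ x', x' ∉ S → q₁.1 (π x') = q₂.1 (π x')) →
      q₁.1 = q₂.1)
    (extend : ∀ q : D.EdgeColoring X Y, ∃ q' : D'.EdgeColoring X Y,
      (∀ x', x' ∉ S → q'.1 x' = q.1 (π x')) ∧
      ∀ f : QuandleCocycle X Y A, ∏ c, D'.edgeWeight f q'.1 c = ∏ c, D.edgeWeight f q.1 c)
    (restrict : ∀ q' : D'.EdgeColoring X Y, ∃ q : D.EdgeColoring X Y,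
      ∀ x', x' ∉ S → q'.1 x' = q.1 (π x'))
    (unique : ∀ q₁ q₂ : D'.EdgeColoring X Y, (∀ x', x' ∉ S → q₁.1 x' = q₂.1 x') → q₁.1 = q₂.1)
    (outer : ∃ x' s, x' ∉ S ∧ D.OuterAt (π x', s) ∧ D'.OuterAt (x', s)) :
    ColoringsCorrespond ⟨m, D⟩ ⟨n, D'⟩ X Y A := by
  -- Injectivity comes from `unique'`, since old colorings are visible outside of `S`. For
  -- surjectivity a coloring is restricted and extended again, and `unique` identifies the result.
  choose φ hφ hw using extend
  refine ⟨φ, ⟨fun q₁ q₂ h => ?_, fun q' => ?_⟩, fun q => ⟨?_, hw q⟩⟩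
  · refine Subtype.ext (unique' _ _ fun x' hx' => ?_)
    rw [← hφ q₁ x' hx', ← hφ q₂ x' hx', h]
  · obtain ⟨q, hq⟩ := restrict q'
    exact ⟨q, Subtype.ext (unique _ _ fun x' hx' => by rw [hφ q x' hx', hq x' hx'])⟩
  · obtain ⟨x', s, hx', h₁, h₂⟩ := outer
    change (φ q).region D'.outer = q.region D.outer
    rw [show D'.outer = _ from h₂, show D.outer = _ from h₁, EdgeColoring.region_regionAt,
      EdgeColoring.region_regionAt, hφ q x' hx']

/-! ### The third move -/

end KnotoidDiagram

namespace GaussCode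

variable {n : ℕ}

/-- An inner edge has just two descriptions: it leaves the passage `l` and leads to the next passage
`l'`. -/
theorem edgeAt_eq_succ {G : GaussCode n} {w : Fin n × Bool} {α : Bool} {l l' : Fin (2 * n)}
    (hl : l'.val = l.val + 1) (h : G.edgeAt w α = l.succ) :
    (G.pass l = w ∧ α = true) ∨ (G.pass l' = w ∧ α = false) := by
  cases α <;> simp only [edgeAt, if_true, Bool.false_eq_true, if_false, Fin.ext_iff, Fin.val_succ,
    Fin.val_castSucc] at h
  · refine .inr ⟨?_, rfl⟩
    rw [show l' = G.pass.symm w from Fin.ext (by omega), Equiv.apply_symm_apply]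
  · refine .inl ⟨?_, rfl⟩
    rw [show l = G.pass.symm w from Fin.ext (by omega), Equiv.apply_symm_apply]

theorem edgeAt_not_ne (G : GaussCode n) (w : Fin n × Bool) (α : Bool) :
    G.edgeAt w (!α) ≠ G.edgeAt w α := by
  cases α <;> simp [edgeAt, Fin.ext_iff]

/-- The edges at two consecutive passages before and after the passages are exchanged. -/
theorem edgeAt_swap {G G' : GaussCode n} {l l' : Fin (2 * n)} (hl : l'.val = l.val + 1)
    (swap : G'.pass l = G.pass l' ∧ G'.pass l' = G.pass l) {w w' : Fin n × Bool} (hw : w ≠ w')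
    {α β : Bool} (h : G.edgeAt w α = l.succ) (h' : G.edgeAt w' β = l.succ) :
    α = !β ∧ G'.edgeAt w (!α) = l.succ ∧ G'.edgeAt w' (!β) = l.succ ∧
      G'.edgeAt w α = G.edgeAt w' (!β) ∧ G'.edgeAt w' β = G.edgeAt w (!α) := by
  have key : ∀ (H : GaussCode n) (v : Fin n × Bool) x, H.pass x = v → H.pass.symm v = x :=
    fun H v x e => by rw [← e, Equiv.symm_apply_apply]
  rcases edgeAt_eq_succ hl h with ⟨e, rfl⟩ | ⟨e, rfl⟩ <;>
  rcases edgeAt_eq_succ hl h' with ⟨e', rfl⟩ | ⟨e', rfl⟩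
  · exact absurd (e.symm.trans e') hw
  · have e₁ := key _ _ _ e
    have e₂ := key _ _ _ e'
    have e₃ := key G' _ _ (swap.2.trans e)
    have e₄ := key G' _ _ (swap.1.trans e')
    simp [edgeAt, e₁, e₂, e₃, e₄, Fin.ext_iff, hl]
  · have e₁ := key _ _ _ e
    have e₂ := key _ _ _ e'
    have e₃ := key G' _ _ (swap.1.trans e)
    have e₄ := key G' _ _ (swap.2.trans e')
    simp [edgeAt, e₁, e₂, e₃, e₄, Fin.ext_iff, hl]
  · exact absurd (e.symm.trans e') hw

/-- The codes `G` and `G'` differ by a third Reidemeister move. The crossings of the triangle are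
`p` (top and middle strand), `q` (top and bottom strand) and `r` (middle and bottom strand), its
edges are `a`, `b`, `c`, and in `G` it lies on the sides `s`, `t`, `u` of the top, middle and
bottom strands. -/
structure Triangle (G G' : GaussCode n) (p q r : Fin n) (a b c : Fin (2 * n + 1))
    (s t u : Bool) : Prop where
  ne_pq : p ≠ q
  ne_pr : p ≠ r
  ne_qr : q ≠ r
  top₁ : G.overAt p t = a
  top₂ : G.overAt q u = a
  middle₁ : G.underAt p s = b
  middle₂ : G.overAt r u = b
  bottom₁ : G.underAt q s = c
  bottom₂ : G.underAt r t = c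
  top₁' : G'.overAt p (!t) = a
  top₂' : G'.overAt q (!u) = a
  middle₁' : G'.underAt p (!s) = b
  middle₂' : G'.overAt r (!u) = b
  bottom₁' : G'.underAt q (!s) = c
  bottom₂' : G'.underAt r (!t) = c
  top_swap₁ : G'.overAt p t = G.overAt q (!u)
  top_swap₂ : G'.overAt q u = G.overAt p (!t)
  middle_swap₁ : G'.underAt p s = G.overAt r (!u)
  middle_swap₂ : G'.overAt r u = G.underAt p (!s)
  bottom_swap₁ : G'.underAt q s = G.underAt r (!t)
  bottom_swap₂ : G'.underAt r t = G.underAt q (!s)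
  ne_ab : a ≠ b
  ne_ac : a ≠ c
  ne_bc : b ≠ c
  inner : ∀ e, e = a ∨ e = b ∨ e = c → e ≠ 0 ∧ e ≠ Fin.last (2 * n) ∧ e ≠ G.overAt p (!t) ∧
    e ≠ G.overAt q (!u) ∧ e ≠ G.underAt p (!s) ∧ e ≠ G.overAt r (!u) ∧ e ≠ G.underAt q (!s) ∧
    e ≠ G.underAt r (!t)
  others : ∀ x, x ≠ p → x ≠ q → x ≠ r → ∀ m, G'.overAt x m = G.overAt x m ∧
    G'.underAt x m = G.underAt x m ∧ ∀ e, e = a ∨ e = b ∨ e = c →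
      e ≠ G.overAt x m ∧ e ≠ G.underAt x m
  sign : ∀ x, G'.sign x = G.sign x
  sign_top : (xor t (G.sign p)) = !xor u (G.sign q)
  sign_middle : (!xor s (G.sign p)) = !xor u (G.sign r)
  sign_bottom : (xor s (G.sign q)) = !xor t (G.sign r)

/-- The inverse of a third move is a third move, with the triangle on the other side of each strand.
One extension lemma therefore serves both directions. -/
theorem Triangle.symm {G G' : GaussCode n} {p q r : Fin n} {a b c : Fin (2 * n + 1)}
    {s t u : Bool} (h : Triangle G G' p q r a b c s t u) :
    Triangle G' G p q r a b c (!s) (!t) (!u) := by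
  have h₁ := h.sign_top
  have h₂ := h.sign_middle
  have h₃ := h.sign_bottom
  refine ⟨h.ne_pq, h.ne_pr, h.ne_qr, h.top₁', h.top₂', h.middle₁', h.middle₂', h.bottom₁',
    h.bottom₂', ?_, ?_, ?_, ?_, ?_, ?_, ?_, ?_, ?_, ?_, ?_, ?_, h.ne_ab, h.ne_ac, h.ne_bc,
    fun e he => ?_, fun x hp hq hr m => ?_, fun x => (h.sign x).symm, ?_, ?_, ?_⟩
  · rw [Bool.not_not]; exact h.top₁
  · rw [Bool.not_not]; exact h.top₂
  · rw [Bool.not_not]; exact h.middle₁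
  · rw [Bool.not_not]; exact h.middle₂
  · rw [Bool.not_not]; exact h.bottom₁
  · rw [Bool.not_not]; exact h.bottom₂
  · simpa using h.top_swap₂.symm
  · simpa using h.top_swap₁.symm
  · simpa using h.middle_swap₂.symm
  · simpa using h.middle_swap₁.symm
  · simpa using h.bottom_swap₂.symm
  · simpa using h.bottom_swap₁.symm
  · have := h.inner e he
    simp only [Bool.not_not, h.top_swap₁, h.top_swap₂, h.middle_swap₁, h.middle_swap₂,
      h.bottom_swap₁, h.bottom_swap₂]
    tauto
  · have := h.others x hp hq hr m
    rw [this.1, this.2.1]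
    exact ⟨rfl, rfl, this.2.2⟩
  iterate 3
    rw [h.sign, h.sign]
    revert h₁ h₂ h₃
    cases s <;> cases t <;> cases u <;> cases G.sign p <;> cases G.sign q <;> cases G.sign r <;>
      decide

variable {X Y A : Type} [Quandle X] [QuandleSet X Y] [CommGroup A]

/-- A third Reidemeister move carries colorings to colorings. -/
theorem Triangle.extend {G G' : GaussCode n} {p q r : Fin n} {a b c : Fin (2 * n + 1)}
    {s t u : Bool} (h : Triangle G G' p q r a b c s t u) {col : Fin (2 * n + 1) → X × Y}
    (hcol : G.IsEdgeColoring col) : ∃ col' : Fin (2 * n + 1) → X × Y, G'.IsEdgeColoring col' ∧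
      (∀ e, e ∉ ({a, b, c} : Set _) → col' e = col e) ∧
      ∀ f : QuandleCocycle X Y A, ∏ x, G'.edgeWeight f col' x = ∏ x, G.edgeWeight f col x := by
  obtain ⟨y, x₁, x₂, x₃, ⟨p₁, p₂⟩, ⟨q₁, q₂⟩, r₁, r₂⟩ := exists_cube (s := s) (t := t) (u := u)
    (hcol.crossing p) (hcol.crossing q) (hcol.crossing r)
    (by simp only [h.top₁, h.top₂]) (by simp only [h.middle₁, h.middle₂])
    (by simp only [h.bottom₁, h.bottom₂])
  classical
  -- Only the edges of the triangle are recolored. Since the triangle passes to the other side of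
  -- each strand, they receive the states of the same cube with all sides negated.
  let col' : Fin (2 * n + 1) → X × Y := fun e =>
    if e = a then topState y x₁ x₂ x₃ (!t) (!u) else if e = b then middleState y x₁ x₂ x₃ (!s) (!u)
    else if e = c then bottomState y x₁ x₂ x₃ (!s) (!t) else col e
  have ha : col' a = topState y x₁ x₂ x₃ (!t) (!u) := by simp [col']
  have hb : col' b = middleState y x₁ x₂ x₃ (!s) (!u) := by simp [col', h.ne_ab.symm]
  have hc : col' c = bottomState y x₁ x₂ x₃ (!s) (!t) := by
    simp [col', h.ne_ac.symm, h.ne_bc.symm]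
  have hn : ∀ e, e ∉ ({a, b, c} : Set _) → col' e = col e := by
    intro e he
    simp only [Set.mem_insert_iff, Set.mem_singleton_iff, not_or] at he
    simp [col', he]
  have hn' : ∀ e, (∀ e', e' = a ∨ e' = b ∨ e' = c → e' ≠ e) → col' e = col e := by
    intro e he
    refine hn e fun h => ?_
    simp only [Set.mem_insert_iff, Set.mem_singleton_iff] at h
    exact he e h rfl
  have both : ∀ {P : Bool → Prop} (x : Bool), P x → P (!x) → ∀ y, P y := by
    intro P x h₁ h₂ y
    cases x <;> cases y <;> assumption
  -- After the exchange of passages, the outer edge at one crossing of a strand is the former outer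
  -- edge at the other one, whose cube state is known. The remaining edge is the recolored inner
  -- one. The five facts below are of the same kind.
  have P₁ : ∀ m, col' (G'.overAt p m) = topState y x₁ x₂ x₃ m (!u) := by
    refine both t ?_ ?_
    · rw [h.top_swap₁, hn' _ fun e he => (h.inner e he).2.2.2.1, q₁]
    · rw [h.top₁', ha]
  have P₂ : ∀ m, col' (G'.underAt p m) = middleState y x₁ x₂ x₃ m (!u) := by
    refine both s ?_ ?_
    · rw [h.middle_swap₁, hn' _ fun e he => (h.inner e he).2.2.2.2.2.1, r₁]
    · rw [h.middle₁', hb]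
  have Q₁ : ∀ m, col' (G'.overAt q m) = topState y x₁ x₂ x₃ (!t) m := by
    refine both u ?_ ?_
    · rw [h.top_swap₂, hn' _ fun e he => (h.inner e he).2.2.1, p₁]
    · rw [h.top₂', ha]
  have Q₂ : ∀ m, col' (G'.underAt q m) = bottomState y x₁ x₂ x₃ m (!t) := by
    refine both s ?_ ?_
    · rw [h.bottom_swap₁, hn' _ fun e he => (h.inner e he).2.2.2.2.2.2.2, r₂]
    · rw [h.bottom₁', hc]
  have R₁ : ∀ m, col' (G'.overAt r m) = middleState y x₁ x₂ x₃ (!s) m := by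
    refine both u ?_ ?_
    · rw [h.middle_swap₂, hn' _ fun e he => (h.inner e he).2.2.2.2.1, p₂]
    · rw [h.middle₂', hb]
  have R₂ : ∀ m, col' (G'.underAt r m) = bottomState y x₁ x₂ x₃ (!s) m := by
    refine both t ?_ ?_
    · rw [h.bottom_swap₂, hn' _ fun e he => (h.inner e he).2.2.2.2.2.2.1, q₂]
    · rw [h.bottom₂', hc]
  have others : ∀ x, x ≠ p → x ≠ q → x ≠ r → ∀ m, col' (G'.overAt x m) = col (G.overAt x m) ∧
      col' (G'.underAt x m) = col (G.underAt x m) := by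
    intro x hp hq hr m
    obtain ⟨h₁, h₂, h₃⟩ := h.others x hp hq hr m
    rw [h₁, h₂]
    exact ⟨hn' _ fun e he => (h₃ e he).1, hn' _ fun e he => (h₃ e he).2⟩
  have cross : ∀ x, IsCrossing (fun m => col' (G'.overAt x m)) (fun m => col' (G'.underAt x m)) := by
    intro x
    by_cases hp : x = p
    · subst hp; simp only [P₁, P₂]; exact isCrossing_top_middle ..
    by_cases hq : x = q
    · subst hq; simp only [Q₁, Q₂]; exact isCrossing_top_bottom ..
    by_cases hr : x = r
    · subst hr; simp only [R₁, R₂]; exact isCrossing_middle_bottom ..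
    · simp only [others x hp hq hr]; exact hcol.crossing x
  refine ⟨col', ⟨cross, ?_, ?_⟩, hn, fun f => ?_⟩
  · rw [hn' 0 fun e he => (h.inner e he).1]; exact hcol.first
  · rw [hn' _ fun e he => (h.inner e he).2.1]; exact hcol.last
  · have split : ∀ g : Fin n → A, ∏ x, g x = g p * g q * g r * ∏ x ∈ {p, q, r}ᶜ, g x := by
      intro g
      rw [← Finset.prod_mul_prod_compl {p, q, r}, Finset.prod_insert (by simp [h.ne_pq, h.ne_pr]),
        Finset.prod_insert (by simp [h.ne_qr]), Finset.prod_singleton]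
      simp only [mul_assoc]
    rw [split, split]
    congr 1
    · rw [G'.edgeWeight_eq f (m := false) (P₁ _) P₂ (cross p),
        G'.edgeWeight_eq f (m := false) ((Q₁ _).trans (topState_eq ..)) Q₂ (cross q),
        G'.edgeWeight_eq f (m := false) ((R₁ _).trans (middleState_eq ..))
          (fun s => (R₂ s).trans (bottomState_eq ..)) (cross r),
        G.edgeWeight_eq f (m := false) (p₁ _) p₂ (hcol.crossing p),
        G.edgeWeight_eq f (m := false) ((q₁ _).trans (topState_eq ..)) q₂ (hcol.crossing q),
        G.edgeWeight_eq f (m := false) ((r₁ _).trans (middleState_eq ..))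
          (fun s => (r₂ s).trans (bottomState_eq ..)) (hcol.crossing r), h.sign, h.sign, h.sign]
      exact (stateWeight_triangle f y x₁ x₂ x₃ h.sign_top h.sign_bottom h.sign_middle).symm
    · refine Finset.prod_congr rfl fun x hx => ?_
      simp only [Finset.mem_compl, Finset.mem_insert, Finset.mem_singleton, not_or] at hx
      simp only [edgeWeight, others x hx.1 hx.2.1 hx.2.2, h.sign]

/-- A coloring is determined by its values outside of the triangle. -/
theorem Triangle.unique {G G' : GaussCode n} {p q r : Fin n} {a b c : Fin (2 * n + 1)}
    {s t u : Bool} (h : Triangle G G' p q r a b c s t u) {q₁ q₂ : Fin (2 * n + 1) → X × Y}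
    (h₁ : G.IsEdgeColoring q₁) (h₂ : G.IsEdgeColoring q₂)
    (agree : ∀ e, e ∉ ({a, b, c} : Set _) → q₁ e = q₂ e) : q₁ = q₂ := by
  have agree' : ∀ e, (∀ e', e' = a ∨ e' = b ∨ e' = c → e' ≠ e) → q₁ e = q₂ e := by
    intro e he
    refine agree e fun h => ?_
    simp only [Set.mem_insert_iff, Set.mem_singleton_iff] at h
    exact he e h rfl
  -- The outer edges at `p` determine `a` and `b`, those at `q` determine `c`; the crossing `r` is
  -- not needed.
  have hp := (h₁.crossing p).unique (h₂.crossing p) (m := !t) (m' := !t) (s := !s)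
    (congrArg Prod.fst (agree' _ fun e he => (h.inner e he).2.2.1))
    (agree' _ fun e he => (h.inner e he).2.2.2.2.1)
  have hq := (h₁.crossing q).unique (h₂.crossing q) (m := !u) (m' := !u) (s := !s)
    (congrArg Prod.fst (agree' _ fun e he => (h.inner e he).2.2.2.1))
    (agree' _ fun e he => (h.inner e he).2.2.2.2.2.2.1)
  have ha := congrFun hp.1 t
  have hb := congrFun hp.2 s
  have hc := congrFun hq.2 s
  simp only [h.top₁, h.middle₁, h.bottom₁] at ha hb hc
  funext e
  by_cases he : e ∈ ({a, b, c} : Set _)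
  · simp only [Set.mem_insert_iff, Set.mem_singleton_iff] at he
    rcases he with rfl | rfl | rfl <;> assumption
  · exact agree e he

end GaussCode

namespace GaussCode

variable {n : ℕ}

theorem edgeAt_ne_zero_last {l l' : Fin (2 * n)} (hl : l'.val = l.val + 1) :
    l.succ ≠ 0 ∧ l.succ ≠ Fin.last (2 * n) := by
  have := l'.isLt
  simp only [ne_eq, Fin.ext_iff, Fin.val_succ, Fin.val_zero, Fin.val_last]
  omega

end GaussCode

namespace KnotoidDiagram

variable {n : ℕ}

theorem meet_cases {D : KnotoidDiagram n} {e e' : Fin (2 * n + 1)} {s t : Bool}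
    (h : D.Meet (e, s) (e', t)) (h₀ : e ≠ 0) (h₁ : e ≠ Fin.last (2 * n)) :
    ∃ c, (D.overAt c t = e ∧ D.underAt c s = e') ∨ (D.underAt c t = e ∧ D.overAt c s = e') := by
  rcases h with h | h <;>
    rcases D.toGaussCode.corner_cases h with ⟨c, a, b, h₂, h₃⟩ | ⟨c, a, b, h₂, h₃⟩ | ⟨h₂, h₃⟩ |
      ⟨h₂, h₃⟩ <;>
    simp only [Prod.mk.injEq] at h₂ h₃ <;> obtain ⟨h₂, rfl⟩ := h₂ <;> obtain ⟨h₃, rfl⟩ := h₃ <;>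
    first
    | exact absurd h₂ h₀
    | exact absurd h₂ h₁
    | exact absurd h₃ h₀
    | exact absurd h₃ h₁
    | exact ⟨c, .inl ⟨h₂.symm, h₃.symm⟩⟩
    | exact ⟨c, .inr ⟨h₂.symm, h₃.symm⟩⟩
    | exact ⟨c, .inl ⟨h₃.symm, h₂.symm⟩⟩
    | exact ⟨c, .inr ⟨h₃.symm, h₂.symm⟩⟩

/-- The corners of the move come without names. A crossing at a corner has its over-edge on one of
the two meeting edges and its under-edge on the other, and the lists of passages on the three
strands leave only one crossing for each corner. The sign relations come from the order of the
passages along each strand. -/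
theorem triangle_of_r3 {D D' : KnotoidDiagram n} {p q r : Fin n} (hpq : p ≠ q) (hpr : p ≠ r)
    (hqr : q ≠ r) {i i' j j' k k' : Fin (2 * n)}
    (hi : i'.val = i.val + 1) (hj : j'.val = j.val + 1) (hk : k'.val = k.val + 1)
    (top : ({D.pass i, D.pass i'} : Set (Fin n × Bool)) = {(p, true), (q, true)})
    (middle : ({D.pass j, D.pass j'} : Set (Fin n × Bool)) = {(p, false), (r, true)})
    (bottom : ({D.pass k, D.pass k'} : Set (Fin n × Bool)) = {(q, false), (r, false)})
    {s t u : Bool} (corner₁ : D.Meet (i.succ, s) (j.succ, t))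
    (corner₂ : D.Meet (j.succ, t) (k.succ, u)) (corner₃ : D.Meet (k.succ, u) (i.succ, s))
    (sign : ∀ c, D'.sign c = D.sign c)
    (swap₁ : D'.pass i = D.pass i' ∧ D'.pass i' = D.pass i)
    (swap₂ : D'.pass j = D.pass j' ∧ D'.pass j' = D.pass j)
    (swap₃ : D'.pass k = D.pass k' ∧ D'.pass k' = D.pass k)
    (others : ∀ x, x ≠ i → x ≠ i' → x ≠ j → x ≠ j' → x ≠ k → x ≠ k' → D'.pass x = D.pass x) :
    GaussCode.Triangle D.toGaussCode D'.toGaussCode p q r i.succ j.succ k.succ s t u := by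
  have hT : ∀ w, D.pass i = w ∨ D.pass i' = w ↔ w = (p, true) ∨ w = (q, true) := by
    intro w
    simpa [eq_comm] using Set.ext_iff.1 top w
  have hM : ∀ w, D.pass j = w ∨ D.pass j' = w ↔ w = (p, false) ∨ w = (r, true) := by
    intro w
    simpa [eq_comm] using Set.ext_iff.1 middle w
  have hB : ∀ w, D.pass k = w ∨ D.pass k' = w ↔ w = (q, false) ∨ w = (r, false) := by
    intro w
    simpa [eq_comm] using Set.ext_iff.1 bottom w
  have eT : ∀ {w α}, D.edgeAt w α = i.succ → w = (p, true) ∨ w = (q, true) := fun h =>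
    (hT _).1 ((GaussCode.edgeAt_eq_succ hi h).imp And.left And.left)
  have eM : ∀ {w α}, D.edgeAt w α = j.succ → w = (p, false) ∨ w = (r, true) := fun h =>
    (hM _).1 ((GaussCode.edgeAt_eq_succ hj h).imp And.left And.left)
  have eB : ∀ {w α}, D.edgeAt w α = k.succ → w = (q, false) ∨ w = (r, false) := fun h =>
    (hB _).1 ((GaussCode.edgeAt_eq_succ hk h).imp And.left And.left)
  have ni := GaussCode.edgeAt_ne_zero_last hi
  have nj := GaussCode.edgeAt_ne_zero_last hj
  have nk := GaussCode.edgeAt_ne_zero_last hk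
  have c₁ : D.overAt p t = i.succ ∧ D.underAt p s = j.succ := by
    obtain ⟨c, ⟨h₁, h₂⟩ | ⟨h₁, h₂⟩⟩ := meet_cases corner₁ ni.1 ni.2
    · have h₃ := h₂
      rw [D.underAt_eq_edgeAt] at h₃
      rcases eM h₃ with h | h <;> simp only [Prod.mk.injEq] at h
      · rw [← h.1]; exact ⟨h₁, h₂⟩
      · simp at h
    · rw [D.underAt_eq_edgeAt] at h₁
      rcases eT h₁ with h | h <;> simp at h
  have c₂ : D.overAt r u = j.succ ∧ D.underAt r t = k.succ := by
    obtain ⟨c, ⟨h₁, h₂⟩ | ⟨h₁, h₂⟩⟩ := meet_cases corner₂ nj.1 nj.2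
    · have h₃ := h₁
      rw [D.overAt_eq_edgeAt] at h₃
      rcases eM h₃ with h | h <;> simp only [Prod.mk.injEq] at h
      · simp at h
      · rw [← h.1]; exact ⟨h₁, h₂⟩
    · rw [D.overAt_eq_edgeAt] at h₂
      rcases eB h₂ with h | h <;> simp at h
  have c₃ : D.overAt q u = i.succ ∧ D.underAt q s = k.succ := by
    obtain ⟨c, ⟨h₁, h₂⟩ | ⟨h₁, h₂⟩⟩ := meet_cases corner₃ nk.1 nk.2
    · rw [D.overAt_eq_edgeAt] at h₁
      rcases eB h₁ with h | h <;> simp at h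
    · have h₃ := h₁
      have h₄ := h₂
      rw [D.underAt_eq_edgeAt] at h₃
      rw [D.overAt_eq_edgeAt] at h₄
      -- Both lists are needed here: the bottom strand allows `q` or `r`, the top strand `p` or `q`.
      rcases eB h₃ with h | h <;> rcases eT h₄ with h' | h' <;> simp only [Prod.mk.injEq] at h h'
      · exact absurd (h'.1.symm.trans h.1) hpq
      · rw [← h.1]; exact ⟨h₂, h₁⟩
      · exact absurd (h'.1.symm.trans h.1) hpr
      · exact absurd (h'.1.symm.trans h.1) hqr
  have sT := GaussCode.edgeAt_swap hi swap₁ (w := (p, true)) (w' := (q, true)) (by simp [hpq])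
    (by rw [← D.overAt_eq_edgeAt]; exact c₁.1) (by rw [← D.overAt_eq_edgeAt]; exact c₃.1)
  have sM := GaussCode.edgeAt_swap hj swap₂ (w := (p, false)) (w' := (r, true)) (by simp)
    (by rw [← D.underAt_eq_edgeAt]; exact c₁.2) (by rw [← D.overAt_eq_edgeAt]; exact c₂.1)
  have sB := GaussCode.edgeAt_swap hk swap₃ (w := (q, false)) (w' := (r, false)) (by simp [hqr])
    (by rw [← D.underAt_eq_edgeAt]; exact c₃.2) (by rw [← D.underAt_eq_edgeAt]; exact c₂.2)
  have nT : ∀ w α, w ≠ (p, true) → w ≠ (q, true) → i.succ ≠ D.edgeAt w α := fun w α h₁ h₂ h =>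
    (eT h.symm).elim h₁ h₂
  have nM : ∀ w α, w ≠ (p, false) → w ≠ (r, true) → j.succ ≠ D.edgeAt w α := fun w α h₁ h₂ h =>
    (eM h.symm).elim h₁ h₂
  have nB : ∀ w α, w ≠ (q, false) → w ≠ (r, false) → k.succ ≠ D.edgeAt w α := fun w α h₁ h₂ h =>
    (eB h.symm).elim h₁ h₂
  have c₁' := c₁
  have c₂' := c₂
  have c₃' := c₃
  simp only [D.overAt_eq_edgeAt, D.underAt_eq_edgeAt] at c₁' c₂' c₃'
  have flip₁ : ∀ (w : Fin n × Bool) (a b : Bool) e, D.edgeAt w (xor a b) = e →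
      e ≠ D.edgeAt w (xor (!a) b) := by
    rintro w a b e rfl
    rw [Bool.not_xor]; exact (D.edgeAt_not_ne _ _).symm
  have flip₂ : ∀ (w : Fin n × Bool) (a b : Bool) e, D.edgeAt w (!xor a b) = e →
      e ≠ D.edgeAt w (!xor (!a) b) := by
    rintro w a b e rfl
    rw [Bool.not_xor]; exact (D.edgeAt_not_ne _ _).symm
  have hTM : i.succ ≠ j.succ := by
    rw [← c₁'.2]; exact nT _ _ (by simp) (by simp)
  have hTB : i.succ ≠ k.succ := by
    rw [← c₂'.2]; exact nT _ _ (by simp) (by simp)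
  have hMB : j.succ ≠ k.succ := by
    rw [← c₂'.2]; exact nM _ _ (by simp [hpr.symm]) (by simp)
  refine ⟨hpq, hpr, hqr, c₁.1, c₃.1, c₁.2, c₂.1, c₃.2, c₂.2, ?_, ?_, ?_, ?_, ?_, ?_, ?_, ?_, ?_, ?_,
    ?_, ?_, hTM, hTB, hMB, ?_, ?_, sign, sT.1, sM.1, by simpa using sB.1⟩
  iterate 12
    simp only [Bool.not_not] at sT sM sB
    simp only [D'.overAt_eq_edgeAt, D'.underAt_eq_edgeAt, D.overAt_eq_edgeAt,
      D.underAt_eq_edgeAt, sign, Bool.not_xor, Bool.not_not, sT.2.1, sT.2.2.1, sT.2.2.2.1,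
      sT.2.2.2.2, sM.2.1, sM.2.2.1, sM.2.2.2.1, sM.2.2.2.2, sB.2.1, sB.2.2.1, sB.2.2.2.1,
      sB.2.2.2.2]
  · rintro e (rfl | rfl | rfl)
    · simp only [D.overAt_eq_edgeAt, D.underAt_eq_edgeAt]
      refine ⟨ni.1, ni.2, flip₁ _ _ _ _ c₁'.1, flip₁ _ _ _ _ c₃'.1, ?_, ?_, ?_, ?_⟩ <;>
        refine nT _ _ ?_ ?_ <;> simp [hpr.symm, hqr.symm]
    · simp only [D.overAt_eq_edgeAt, D.underAt_eq_edgeAt]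
      refine ⟨nj.1, nj.2, ?_, ?_, flip₂ _ _ _ _ c₁'.2, flip₁ _ _ _ _ c₂'.1, ?_, ?_⟩ <;>
        refine nM _ _ ?_ ?_ <;> simp [hpr, hqr, hpq.symm, hpr.symm]
    · simp only [D.overAt_eq_edgeAt, D.underAt_eq_edgeAt]
      refine ⟨nk.1, nk.2, ?_, ?_, ?_, ?_, flip₂ _ _ _ _ c₃'.2, flip₂ _ _ _ _ c₂'.2⟩ <;>
        refine nB _ _ ?_ ?_ <;> simp [hpr, hpq]
  · intro x hp hq hr m
    have hs : ∀ b, D'.pass.symm (x, b) = D.pass.symm (x, b) := by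
      intro b
      rw [Equiv.symm_apply_eq]
      have ne : ∀ l, (D.pass l).1 ≠ x → D.pass.symm (x, b) ≠ l := by
        rintro l h rfl
        simp at h
      have h₁ : ∀ l w, D.pass l = w → w.1 ≠ x → (D.pass l).1 ≠ x := by
        rintro l w rfl h; exact h
      have key : ∀ l, (D.pass l = (p, true) ∨ D.pass l = (q, true)) ∨
          (D.pass l = (p, false) ∨ D.pass l = (r, true)) ∨
          (D.pass l = (q, false) ∨ D.pass l = (r, false)) → D.pass.symm (x, b) ≠ l := by
        rintro l ((h | h) | (h | h) | (h | h)) <;>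
          exact ne l (h₁ l _ h (by first | exact Ne.symm hp | exact Ne.symm hq | exact Ne.symm hr))
      rw [others _ (key _ (.inl ((hT _).1 (.inl rfl)))) (key _ (.inl ((hT _).1 (.inr rfl))))
        (key _ (.inr (.inl ((hM _).1 (.inl rfl))))) (key _ (.inr (.inl ((hM _).1 (.inr rfl)))))
        (key _ (.inr (.inr ((hB _).1 (.inl rfl))))) (key _ (.inr (.inr ((hB _).1 (.inr rfl))))),
        Equiv.apply_symm_apply]
    refine ⟨by simp [GaussCode.overAt, hs, sign], by simp [GaussCode.underAt, hs, sign], ?_⟩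
    rintro e (rfl | rfl | rfl) <;> simp only [D.overAt_eq_edgeAt, D.underAt_eq_edgeAt]
    · constructor <;> refine nT _ _ ?_ ?_ <;> simp [hp, hq]
    · constructor <;> refine nM _ _ ?_ ?_ <;> simp [hp, hr]
    · constructor <;> refine nB _ _ ?_ ?_ <;> simp [hq, hr]

/-- The number of edges is unchanged, so the edges are matched by the identity. Restriction is
extension along the inverse move. -/
theorem coloringsCorrespond_of_triangle {D D' : KnotoidDiagram n} {p q r : Fin n}
    {a b c : Fin (2 * n + 1)} {s t u : Bool}
    (h : GaussCode.Triangle D.toGaussCode D'.toGaussCode p q r a b c s t u)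
    (outer : ∃ d : Side n, d.1 ∉ ({a, b, c} : Set _) ∧ D.OuterAt d ∧ D'.OuterAt d)
    (X Y A : Type) [Quandle X] [QuandleSet X Y] [CommGroup A] :
    ColoringsCorrespond ⟨n, D⟩ ⟨n, D'⟩ X Y A := by
  refine coloringsCorrespond_of_agree id {a, b, c} (fun q₁ q₂ hq => h.unique q₁.2 q₂.2 hq)
    (fun q => ?_) (fun q => ?_) (fun q₁ q₂ hq => h.symm.unique q₁.2 q₂.2 hq) ?_
  · obtain ⟨q', h₁, h₂, h₃⟩ := h.extend (A := A) q.2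
    exact ⟨⟨q', h₁⟩, h₂, h₃⟩
  · obtain ⟨q', h₁, h₂, -⟩ := h.symm.extend (A := A) q.2
    exact ⟨⟨q', h₁⟩, fun x hx => (h₂ x hx).symm⟩
  · obtain ⟨⟨e, s⟩, h₁, h₂, h₃⟩ := outer
    exact ⟨e, s, h₁, h₂, h₃⟩

end KnotoidDiagram

/-! ### Insertion of crossings -/

section PieceMap

variable {m n : ℕ} (e : Fin (2 * m) ↪o Fin (2 * n))

/-- The edge of which an edge is a piece. -/
def pieceMap (x' : Fin (2 * n + 1)) : Fin (2 * m + 1) :=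
  ⟨(Finset.univ.filter fun k => (e k).val < x'.val).card,
    Nat.lt_succ_of_le ((Finset.card_le_univ _).trans_eq (Fintype.card_fin _))⟩

theorem pieceMap_castSucc (k : Fin (2 * m)) : pieceMap e (e k).castSucc = k.castSucc := by
  ext
  simp only [pieceMap, Fin.val_castSucc, Fin.val_fin_lt, e.lt_iff_lt]
  rw [Finset.filter_gt_eq_Iio, Fin.card_Iio]

theorem pieceMap_succ (k : Fin (2 * m)) : pieceMap e (e k).succ = k.succ := by
  ext
  simp only [pieceMap, Fin.val_succ, Nat.lt_succ_iff, Fin.val_fin_le, e.le_iff_le]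
  rw [Finset.filter_ge_eq_Iic, Fin.card_Iic]

theorem pieceMap_zero : pieceMap e 0 = 0 := by
  ext
  simp [pieceMap]

theorem pieceMap_last : pieceMap e (Fin.last (2 * n)) = Fin.last (2 * m) := by
  ext
  simp [pieceMap]

theorem pieceMap_new {l : Fin (2 * n)} (h : l ∉ Set.range e) :
    pieceMap e l.succ = pieceMap e l.castSucc := by
  ext
  simp only [pieceMap, Fin.val_succ, Fin.val_castSucc]
  congr 1
  refine Finset.filter_congr fun k _ => ?_
  have : (e k).val ≠ l.val := fun h' => h ⟨k, Fin.ext h'⟩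
  omega

theorem KnotoidDiagram.IsPiece.pieceMap_eq {e : Fin (2 * m) ↪o Fin (2 * n)} {x : Fin (2 * m + 1)}
    {x' : Fin (2 * n + 1)} (h : IsPiece e x x') : pieceMap e x' = x := by
  ext
  simp only [pieceMap, ← h _]
  rw [Fin.card_filter_val_lt]
  omega

/-- A function of the edges that does not change at the new passages is a function of the old
edges. -/
theorem exists_eq_comp_pieceMap {α : Type*} (g : Fin (2 * n + 1) → α)
    (h : ∀ l ∉ Set.range e, g l.succ = g l.castSucc) :
    ∃ k : Fin (2 * m + 1) → α, ∀ x', g x' = k (pieceMap e x') := by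
  -- Each old edge is represented by its first piece, the one at the start of the strand or just
  -- after an old passage.
  let rep : Fin (2 * m + 1) → Fin (2 * n + 1) := Fin.cases 0 fun k => (e k).succ
  refine ⟨fun x => g (rep x), fun x' => ?_⟩
  induction x' using Fin.induction with
  | zero => simp [pieceMap_zero, rep]
  | succ l ih =>
    by_cases hl : l ∈ Set.range e
    · obtain ⟨k, rfl⟩ := hl
      simp [pieceMap_succ, rep]
    · rw [h l hl, ih, pieceMap_new e hl]

end PieceMap

namespace KnotoidDiagram

variable {m n : ℕ} {D : KnotoidDiagram m} {D' : KnotoidDiagram n} {ι : Fin m ↪ Fin n}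
  {e : Fin (2 * m) ↪o Fin (2 * n)}

theorem Inserts.pass_symm (h : Inserts D D' ι e) (c : Fin m) (b : Bool) :
    D'.pass.symm (ι c, b) = e (D.pass.symm (c, b)) := by
  rw [Equiv.symm_apply_eq, h.2, Equiv.apply_symm_apply]

/-- An old crossing keeps both of its passages, so a passage that does not come from `D` belongs to
a new crossing. -/
theorem Inserts.mem_range_iff (h : Inserts D D' ι e) (l : Fin (2 * n)) :
    l ∈ Set.range e ↔ (D'.pass l).1 ∈ Set.range ι := by
  constructor
  · rintro ⟨k, rfl⟩
    rw [h.2]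
    exact ⟨_, rfl⟩
  · rintro ⟨c, hc⟩
    refine ⟨D.pass.symm (c, (D'.pass l).2), ?_⟩
    rw [← h.pass_symm, hc, Equiv.symm_apply_apply]

theorem Inserts.pieceMap_edgeAt (h : Inserts D D' ι e) (c : Fin m) (b α : Bool) :
    pieceMap e (D'.edgeAt (ι c, b) α) = D.edgeAt (c, b) α := by
  cases α <;> simp [GaussCode.edgeAt, h.pass_symm, pieceMap_succ, pieceMap_castSucc]

theorem Inserts.pieceMap_overAt (h : Inserts D D' ι e) (c : Fin m) (s : Bool) :
    pieceMap e (D'.overAt (ι c) s) = D.overAt c s := by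
  rw [D'.overAt_eq_edgeAt, D.overAt_eq_edgeAt, h.pieceMap_edgeAt, h.1]

theorem Inserts.pieceMap_underAt (h : Inserts D D' ι e) (c : Fin m) (s : Bool) :
    pieceMap e (D'.underAt (ι c) s) = D.underAt c s := by
  rw [D'.underAt_eq_edgeAt, D.underAt_eq_edgeAt, h.pieceMap_edgeAt, h.1]

/-- All edges in `S` join two passages through new crossings. -/
def NewEdges (D' : KnotoidDiagram n) (ι : Fin m ↪ Fin n) (S : Set (Fin (2 * n + 1))) : Prop :=
  ∀ x ∈ S, ∃ l l' : Fin (2 * n), l'.val = l.val + 1 ∧ x = l.succ ∧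
    (D'.pass l).1 ∉ Set.range ι ∧ (D'.pass l').1 ∉ Set.range ι

variable {S : Set (Fin (2 * n + 1))}

theorem NewEdges.edgeAt_notMem (hS : NewEdges D' ι S) (c : Fin m) (b α : Bool) :
    D'.edgeAt (ι c, b) α ∉ S := by
  intro h
  obtain ⟨l, l', hl, h', h₁, h₂⟩ := hS _ h
  rcases GaussCode.edgeAt_eq_succ hl h' with ⟨h, -⟩ | ⟨h, -⟩
  · exact h₁ ⟨c, by rw [h]⟩
  · exact h₂ ⟨c, by rw [h]⟩

theorem NewEdges.overAt_notMem (hS : NewEdges D' ι S) (c : Fin m) (s : Bool) :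
    D'.overAt (ι c) s ∉ S := by
  rw [D'.overAt_eq_edgeAt]; exact hS.edgeAt_notMem c _ _

theorem NewEdges.underAt_notMem (hS : NewEdges D' ι S) (c : Fin m) (s : Bool) :
    D'.underAt (ι c) s ∉ S := by
  rw [D'.underAt_eq_edgeAt]; exact hS.edgeAt_notMem c _ _

theorem NewEdges.zero_notMem (hS : NewEdges D' ι S) : 0 ∉ S := by
  intro h
  obtain ⟨l, l', hl, h', -⟩ := hS _ h
  exact (GaussCode.edgeAt_ne_zero_last hl).1 h'.symm

theorem NewEdges.last_notMem (hS : NewEdges D' ι S) : Fin.last (2 * n) ∉ S := by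
  intro h
  obtain ⟨l, l', hl, h', -⟩ := hS _ h
  exact (GaussCode.edgeAt_ne_zero_last hl).2 h'.symm

/-- The first piece of an edge begins at the start of the strand or at an old crossing, hence is not
in `S`. So no old color is lost when only the edges outside of `S` are compared. -/
theorem Inserts.exists_piece (h : Inserts D D' ι e) (hS : NewEdges D' ι S) (x : Fin (2 * m + 1)) :
    ∃ x', x' ∉ S ∧ pieceMap e x' = x := by
  refine Fin.cases ⟨0, hS.zero_notMem, pieceMap_zero e⟩ (fun k => ⟨(e k).succ, ?_, ?_⟩) x
  · have := hS.edgeAt_notMem (D.pass k).1 (D.pass k).2 true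
    simpa [GaussCode.edgeAt, h.pass_symm] using this
  · exact pieceMap_succ e k

variable {X Y A : Type} [Quandle X] [QuandleSet X Y] [CommGroup A]

/-- Colorings correspond if the colorings of each diagram extend over the new crossings, respectively
over their deletion. -/
theorem coloringsCorrespond_of_inserts (h : Inserts D D' ι e) (hS : NewEdges D' ι S)
    (outer : SameOuter D D' e S)
    (extend : ∀ q : D.EdgeColoring X Y, ∃ q' : Fin (2 * n + 1) → X × Y,
      (∀ x', x' ∉ S → q' x' = q.1 (pieceMap e x')) ∧
      (∀ x ∉ Set.range ι, IsCrossing (fun s => q' (D'.overAt x s)) (fun s => q' (D'.underAt x s))) ∧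
      ∀ f : QuandleCocycle X Y A,
        ∏ x ∈ (Finset.univ.map ι)ᶜ, D'.edgeWeight f q' x = 1)
    (restrict : ∀ q' : D'.EdgeColoring X Y, ∃ g : Fin (2 * n + 1) → X × Y,
      (∀ x', x' ∉ S → g x' = q'.1 x') ∧
      ∀ l, (D'.pass l).1 ∉ Set.range ι → g l.succ = g l.castSucc)
    (unique : ∀ q₁ q₂ : D'.EdgeColoring X Y, (∀ x', x' ∉ S → q₁.1 x' = q₂.1 x') →
      q₁.1 = q₂.1) :
    ColoringsCorrespond ⟨m, D⟩ ⟨n, D'⟩ X Y A := by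
  refine coloringsCorrespond_of_agree (pieceMap e) S (fun q₁ q₂ hq => ?_) (fun q => ?_)
    (fun q' => ?_) unique ?_
  · funext x
    obtain ⟨x', hx', rfl⟩ := h.exists_piece hS x
    exact hq x' hx'
  · obtain ⟨q', h₁, h₂, h₃⟩ := extend q
    have ho : ∀ c s, q' (D'.overAt (ι c) s) = q.1 (D.overAt c s) := fun c s => by
      rw [h₁ _ (hS.overAt_notMem c s), h.pieceMap_overAt]
    have hu : ∀ c s, q' (D'.underAt (ι c) s) = q.1 (D.underAt c s) := fun c s => by
      rw [h₁ _ (hS.underAt_notMem c s), h.pieceMap_underAt]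
    refine ⟨⟨q', ⟨fun x => ?_, ?_, ?_⟩⟩, h₁, fun f => ?_⟩
    · by_cases hx : x ∈ Set.range ι
      · obtain ⟨c, rfl⟩ := hx
        simp only [ho, hu]
        exact q.2.crossing c
      · exact h₂ x hx
    · rw [h₁ _ hS.zero_notMem, pieceMap_zero]; exact q.2.first
    · rw [h₁ _ hS.last_notMem, pieceMap_last]; exact q.2.last
    -- The old crossings keep their signs and colors, and the new ones contribute `1` in total.
    · rw [← Finset.prod_mul_prod_compl (Finset.univ.map ι), h₃, mul_one, Finset.prod_map]
      refine Finset.prod_congr rfl fun c _ => ?_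
      simp only [GaussCode.edgeWeight, ho, hu, h.1]
  · obtain ⟨g, h₁, h₂⟩ := restrict q'
    -- The adjusted function `g` is constant along all pieces of an old edge, so it descends to the
    -- edges of `D`.
    obtain ⟨q, hq⟩ := exists_eq_comp_pieceMap e g fun l hl => h₂ l (by rwa [← h.mem_range_iff])
    have hq' : ∀ x', x' ∉ S → q'.1 x' = q (pieceMap e x') := fun x' hx' => by
      rw [← h₁ x' hx', hq]
    refine ⟨⟨q, ⟨fun c => ?_, ?_, ?_⟩⟩, hq'⟩
    · have ho : ∀ s, q (D.overAt c s) = q'.1 (D'.overAt (ι c) s) := fun s => by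
        rw [hq' _ (hS.overAt_notMem c s), h.pieceMap_overAt]
      have hu : ∀ s, q (D.underAt c s) = q'.1 (D'.underAt (ι c) s) := fun s => by
        rw [hq' _ (hS.underAt_notMem c s), h.pieceMap_underAt]
      simp only [ho, hu]
      exact q'.2.crossing _
    · rw [← pieceMap_zero e, ← hq' _ hS.zero_notMem]; exact q'.2.first
    · rw [← pieceMap_last e, ← hq' _ hS.last_notMem]; exact q'.2.last
  · obtain ⟨x, x', s, h₁, h₀, h₂, h₃⟩ := outer
    exact ⟨x', s, h₀, by rwa [h₁.pieceMap_eq], h₃⟩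

end KnotoidDiagram

/-! ### The first move -/

section Kink

variable {X Y : Type} [Quandle X] [QuandleSet X Y]

/-- The loop is an over-edge and an under-edge at once. This forces `x = z`, after cancelling and
using idempotency if the loop lies on the left. -/
theorem IsCrossing.kink {o u : Bool → X × Y} (h : IsCrossing o u) {s : Bool} (hs : o s = u s) :
    ∃ y z, (∀ m, o m = overState y z z m) ∧ ∀ m, u m = overState y z z m := by
  obtain ⟨y, x, z, h₁, h₂⟩ := h
  obtain rfl : x = z := by
    rw [h₁, h₂] at hs
    replace hs := congrArg Prod.fst hs
    cases s
    · exact hs.symm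
    · refine (Rack.left_cancel z).1 ?_
      rw [Quandle.fix]
      exact hs.symm
  refine ⟨y, x, h₁, fun m => ?_⟩
  rw [h₂]
  cases m <;> simp [overState, underState]

theorem isCrossing_kink (y : Y) (z : X) : IsCrossing (overState y z z) (overState y z z) := by
  refine ⟨y, z, z, fun _ => rfl, fun s => ?_⟩
  cases s <;> simp [overState, underState]

theorem exists_kink (p : X × Y) (s : Bool) : ∃ y, overState y p.1 p.1 s = p := by
  cases s
  · exact ⟨p.2, rfl⟩
  · obtain ⟨y, hy⟩ := exists_op p.1 p.2
    exact ⟨y, Prod.ext rfl hy⟩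

end Kink

namespace GaussCode

/-- The loop lies on the same side of the crossing as an over-edge and as an under-edge: on the side
`sign c` if the under-passage comes first, on the other one if it comes second. -/
theorem exists_loop_sides {n : ℕ} (G : GaussCode n) {c : Fin n} {i i' : Fin (2 * n)}
    (next : i'.val = i.val + 1) (h : (G.pass i).1 = c) (h' : (G.pass i').1 = c) :
    ∃ s, G.overAt c s = i.succ ∧ G.underAt c s = i.succ ∧
      ((G.overAt c (!s) = i.castSucc ∧ G.underAt c (!s) = i'.succ) ∨
        (G.overAt c (!s) = i'.succ ∧ G.underAt c (!s) = i.castSucc)) := by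
  have hne : (G.pass i).2 ≠ (G.pass i').2 := by
    intro h₂
    have := G.pass.injective (Prod.ext (h.trans h'.symm) h₂)
    rw [this] at next
    omega
  have e₁ : G.pass.symm (c, (G.pass i).2) = i := by
    rw [Equiv.symm_apply_eq]; exact Prod.ext h.symm rfl
  have e₂ : G.pass.symm (c, (G.pass i').2) = i' := by
    rw [Equiv.symm_apply_eq]; exact Prod.ext h'.symm rfl
  have hi : i'.castSucc = i.succ := Fin.ext next
  rcases hb : (G.pass i).2 with _ | _ <;> rcases hb' : (G.pass i').2 with _ | _ <;>
    rw [hb, hb'] at hne <;> simp only [ne_eq, not_true_eq_false] at hne <;>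
    rw [hb] at e₁ <;> rw [hb'] at e₂
  · refine ⟨G.sign c, ?_⟩
    simp [overAt, underAt, e₁, e₂, hi]
  · refine ⟨!G.sign c, ?_⟩
    simp [overAt, underAt, e₁, e₂, hi]

end GaussCode

namespace KnotoidDiagram

variable {X Y A : Type} [Quandle X] [QuandleSet X Y] [CommGroup A]

theorem coloringsCorrespond_r1 {n : ℕ} {D : KnotoidDiagram n} {D' : KnotoidDiagram (n + 1)}
    {ι : Fin n ↪ Fin (n + 1)} {e : Fin (2 * n) ↪o Fin (2 * (n + 1))}
    (inserts : Inserts D D' ι e) {c : Fin (n + 1)} (new : c ∉ Set.range ι)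
    {i i' : Fin (2 * (n + 1))} (next : i'.val = i.val + 1)
    (loop : (D'.pass i).1 = c ∧ (D'.pass i').1 = c) (outer : SameOuter D D' e {i.succ}) :
    ColoringsCorrespond ⟨n, D⟩ ⟨n + 1, D'⟩ X Y A := by
  classical
  obtain ⟨s, ho, hu, hs⟩ := D'.exists_loop_sides next loop.1 loop.2
  have compl : (Finset.univ.map ι)ᶜ = {c} := by
    refine (Finset.eq_of_subset_of_card_le ?_ ?_).symm
    · simpa using new
    · simp [Finset.card_compl]
  have mem_new : ∀ x, x ∉ Set.range ι ↔ x = c := by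
    intro x
    have : x ∈ (Finset.univ.map ι)ᶜ ↔ x = c := by rw [compl, Finset.mem_singleton]
    simpa using this
  have ne₁ : i.castSucc ≠ i.succ := by simp [Fin.ext_iff]
  have ne₂ : i'.succ ≠ i.succ := by simp [Fin.ext_iff, next]
  have hi : i'.castSucc = i.succ := Fin.ext next
  have ends : ∀ P : Fin (2 * (n + 1) + 1) → Prop, P i.castSucc → P i'.succ →
      P (D'.overAt c (!s)) ∧ P (D'.underAt c (!s)) := by
    intro P h₁ h₂
    rcases hs with ⟨h, h'⟩ | ⟨h, h'⟩ <;> rw [h, h'] <;> exact ⟨by assumption, by assumption⟩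
  refine coloringsCorrespond_of_inserts inserts ?_ outer (fun q => ?_) (fun q' => ?_)
    (fun q₁ q₂ h => ?_)
  · rintro _ rfl
    exact ⟨i, i', next, rfl, by rwa [loop.1], by rwa [loop.2]⟩
  · have p₁ : pieceMap e i.succ = pieceMap e i.castSucc :=
      pieceMap_new e (by rwa [inserts.mem_range_iff, loop.1])
    have p₂ : pieceMap e i'.succ = pieceMap e i'.castSucc :=
      pieceMap_new e (by rwa [inserts.mem_range_iff, loop.2])
    rw [hi, p₁] at p₂
    -- The two outer ends of the kink must keep the old color, which fixes `y`; the color of the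
    -- loop is then the state on the side `s`.
    obtain ⟨y, hy⟩ := exists_kink (q.1 (pieceMap e i.castSucc)) (!s)
    generalize (q.1 (pieceMap e i.castSucc)).1 = z at hy
    let q' : Fin (2 * (n + 1) + 1) → X × Y := fun x =>
      if x = i.succ then overState y z z s else q.1 (pieceMap e x)
    have hq' : ∀ x, x ≠ i.succ → q' x = q.1 (pieceMap e x) := fun x hx => if_neg hx
    have hm : q' i.succ = overState y z z s := if_pos rfl
    have both : ∀ m, q' (D'.overAt c m) = overState y z z m ∧
        q' (D'.underAt c m) = overState y z z m := by
      intro m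
      rcases Bool.eq_or_eq_not m s with rfl | rfl
      · rw [ho, hu, hm]; exact ⟨rfl, rfl⟩
      · refine ends (fun x => q' x = overState y z z (!s)) ?_ ?_
        · rw [hq' _ ne₁, hy]
        · rw [hq' _ ne₂, p₂, hy]
    refine ⟨q', fun x hx => hq' x hx, fun x hx => ?_, fun f => ?_⟩
    · obtain rfl := (mem_new x).1 hx
      simp only [both]
      exact isCrossing_kink y z
    · rw [compl, Finset.prod_singleton]
      simp only [GaussCode.edgeWeight, GaussCode.stateWeight, both]
      simp [overState, f.degenerate]
  · obtain ⟨y, z, h₁, h₂⟩ := (q'.2.crossing c).kink (s := s) (by simp only [ho, hu])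
    have he : q'.1 i'.succ = q'.1 i.castSucc := by
      have h₁ := h₁ (!s)
      have h₂ := h₂ (!s)
      rcases hs with ⟨h, h'⟩ | ⟨h, h'⟩ <;> simp only [h, h'] at h₁ h₂ <;> rw [h₁, h₂]
    -- Both ends of the kink have the same color. Giving it to the loop as well makes the function
    -- constant across the two new passages.
    refine ⟨fun x => if x = i.succ then q'.1 i.castSucc else q'.1 x, fun x hx => if_neg hx,
      fun l hl => ?_⟩
    rw [mem_new] at hl
    have hl' : l = i ∨ l = i' := by
      rcases Bool.eq_or_eq_not (D'.pass l).2 (D'.pass i).2 with h | h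
      · exact .inl (D'.pass.injective (Prod.ext (hl.trans loop.1.symm) h))
      · rcases Bool.eq_or_eq_not (D'.pass l).2 (D'.pass i').2 with h' | h'
        · exact .inr (D'.pass.injective (Prod.ext (hl.trans loop.2.symm) h'))
        · have := D'.pass.injective (Prod.ext (loop.1.trans loop.2.symm)
            (Bool.not_inj (h.symm.trans h')))
          rw [this] at next
          omega
    rcases hl' with rfl | rfl
    · simp [ne₁]
    · simp [ne₂, hi, he]
  · have nm := ends (· ∉ ({i.succ} : Set _)) ne₁ ne₂
    have := (q₁.2.crossing c).unique (q₂.2.crossing c) (m := !s) (m' := !s) (s := !s)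
      (congrArg Prod.fst (h _ nm.1)) (h _ nm.2)
    have := congrFun this.1 s
    simp only [ho] at this
    funext x
    by_cases hx : x = i.succ
    · rw [hx, this]
    · exact h x hx

end KnotoidDiagram

/-! ### The second move -/

/-- The crossings `p` and `q` of `G` are the corners of a bigon between the edge after the passage
`i` of the over-strand and the edge after the passage `j` of the under-strand. The bigon lies on the
side `t` of the over-strand and on the side `m` of the under-strand. -/
structure GaussCode.Bigon {n : ℕ} (G : GaussCode n) (p q : Fin n) (i i' j j' : Fin (2 * n))
    (m t : Bool) : Prop where
  next : i'.val = i.val + 1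
  next' : j'.val = j.val + 1
  over_i : G.pass i = (p, true)
  over_i' : G.pass i' = (q, true)
  over₁ : G.overAt p m = i.succ
  over₂ : G.overAt q m = i.succ
  under₁ : G.underAt p t = j.succ
  under₂ : G.underAt q t = j.succ
  over₁' : G.overAt p (!m) = i.castSucc
  over₂' : G.overAt q (!m) = i'.succ
  under' : (G.pass j = (p, false) ∧ G.pass j' = (q, false) ∧ G.underAt p (!t) = j.castSucc ∧
      G.underAt q (!t) = j'.succ) ∨
    (G.pass j = (q, false) ∧ G.pass j' = (p, false) ∧ G.underAt p (!t) = j'.succ ∧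
      G.underAt q (!t) = j.castSucc)
  signs : G.sign q = !G.sign p

namespace GaussCode

variable {n : ℕ} {G : GaussCode n} {p q : Fin n} {i i' j j' : Fin (2 * n)}

/-- The middle over-edge leaves `p` and enters `q`; because the signs are opposite, it is on the
same side `!sign p` of the under-strand at both crossings. The side of the over-strand depends on
which crossing the under-strand meets first. -/
theorem exists_bigon (signs : G.sign p ≠ G.sign q) (next : i'.val = i.val + 1)
    (next' : j'.val = j.val + 1) (overs : G.pass i = (p, true) ∧ G.pass i' = (q, true))
    (unders : ({G.pass j, G.pass j'} : Set (Fin n × Bool)) = {(p, false), (q, false)}) :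
    ∃ m t, G.Bigon p q i i' j j' m t := by
  have key : ∀ {l v}, G.pass l = v → G.pass.symm v = l := fun h => by
    rw [← h, Equiv.symm_apply_apply]
  have e₁ := key overs.1
  have e₂ := key overs.2
  have hi : i'.castSucc = i.succ := Fin.ext next
  have hj : j'.castSucc = j.succ := Fin.ext next'
  have hs : G.sign q = !G.sign p := by
    cases h : G.sign p <;> cases h' : G.sign q <;> simp_all
  have hne : G.pass j ≠ G.pass j' := fun h => by
    have := G.pass.injective h
    rw [this] at next'
    omega
  have h₁ : G.pass j ∈ ({(p, false), (q, false)} : Set _) := by rw [← unders]; simp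
  have h₂ : G.pass j' ∈ ({(p, false), (q, false)} : Set _) := by rw [← unders]; simp
  simp only [Set.mem_insert_iff, Set.mem_singleton_iff] at h₁ h₂
  rcases h₁ with h₁ | h₁ <;> rcases h₂ with h₂ | h₂
  · exact absurd (h₁.trans h₂.symm) hne
  · refine ⟨!G.sign p, G.sign p, next, next', overs.1, overs.2, ?_, ?_, ?_, ?_, ?_, ?_,
      .inl ⟨h₁, h₂, ?_, ?_⟩, hs⟩ <;>
    simp [overAt, underAt, e₁, e₂, key h₁, key h₂, hs, hi, hj]
  · refine ⟨!G.sign p, !G.sign p, next, next', overs.1, overs.2, ?_, ?_, ?_, ?_, ?_, ?_,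
      .inr ⟨h₁, h₂, ?_, ?_⟩, hs⟩ <;>
    simp [overAt, underAt, e₁, e₂, key h₁, key h₂, hs, hi, hj]
  · exact absurd (h₁.trans h₂.symm) hne

variable {m t : Bool}

theorem Bigon.under_ends (B : G.Bigon p q i i' j j' m t) {P : Fin (2 * n + 1) → Prop} :
    P (G.underAt p (!t)) ∧ P (G.underAt q (!t)) ↔ P j.castSucc ∧ P j'.succ := by
  rcases B.under' with ⟨-, -, h, h'⟩ | ⟨-, -, h, h'⟩ <;> rw [h, h']
  exact and_comm

theorem Bigon.pass_j (B : G.Bigon p q i i' j j' m t) :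
    ((G.pass j).1 = p ∨ (G.pass j).1 = q) ∧ (G.pass j).2 = false ∧
      ((G.pass j').1 = p ∨ (G.pass j').1 = q) ∧ (G.pass j').2 = false := by
  rcases B.under' with ⟨h, h', -⟩ | ⟨h, h', -⟩ <;> simp [h, h']

theorem Bigon.ne_passages (B : G.Bigon p q i i' j j' m t) : i ≠ j ∧ i ≠ j' ∧ i' ≠ j ∧ i' ≠ j' := by
  have h := B.pass_j
  refine ⟨?_, ?_, ?_, ?_⟩ <;> rintro rfl
  · simp [B.over_i] at h
  · simp [B.over_i] at h
  · simp [B.over_i'] at h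
  · simp [B.over_i'] at h

theorem Bigon.outside (B : G.Bigon p q i i' j j' m t) : i.succ ≠ j.succ ∧
    i.castSucc ∉ ({i.succ, j.succ} : Set _) ∧ i'.succ ∉ ({i.succ, j.succ} : Set _) ∧
    j.castSucc ∉ ({i.succ, j.succ} : Set _) ∧ j'.succ ∉ ({i.succ, j.succ} : Set _) := by
  have h := B.ne_passages
  have h₁ := B.next
  have h₂ := B.next'
  simp only [ne_eq, Fin.ext_iff, Set.mem_insert_iff, Set.mem_singleton_iff, Fin.val_succ,
    Fin.val_castSucc] at h ⊢
  omega

theorem Bigon.outside' (B : G.Bigon p q i i' j j' m t) :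
    G.overAt p (!m) ∉ ({i.succ, j.succ} : Set _) ∧ G.overAt q (!m) ∉ ({i.succ, j.succ} : Set _) ∧
    G.underAt p (!t) ∉ ({i.succ, j.succ} : Set _) ∧ G.underAt q (!t) ∉ ({i.succ, j.succ} : Set _) := by
  obtain ⟨-, h₁, h₂, h₃, h₄⟩ := B.outside
  have h := (B.under_ends (P := (· ∉ ({i.succ, j.succ} : Set _)))).2 ⟨h₃, h₄⟩
  rw [B.over₁', B.over₂']
  exact ⟨h₁, h₂, h.1, h.2⟩

theorem Bigon.mem_passages (B : G.Bigon p q i i' j j' m t) {l : Fin (2 * n)}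
    (h : (G.pass l).1 = p ∨ (G.pass l).1 = q) : l = i ∨ l = i' ∨ l = j ∨ l = j' := by
  rcases hb : (G.pass l).2 with _ | _
  · rcases B.under' with ⟨h₁, h₂, -⟩ | ⟨h₁, h₂, -⟩ <;> rcases h with h | h
    · exact .inr (.inr (.inl (G.pass.injective (h₁ ▸ Prod.ext h hb))))
    · exact .inr (.inr (.inr (G.pass.injective (h₂ ▸ Prod.ext h hb))))
    · exact .inr (.inr (.inr (G.pass.injective (h₂ ▸ Prod.ext h hb))))
    · exact .inr (.inr (.inl (G.pass.injective (h₁ ▸ Prod.ext h hb))))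
  · rcases h with h | h
    · exact .inl (G.pass.injective (B.over_i ▸ Prod.ext h hb))
    · exact .inr (.inl (G.pass.injective (B.over_i' ▸ Prod.ext h hb)))

/-- A function of the edges that agrees on the four edges that leave the bigon in pairs can be changed
on the bigon such that it does not change at its corners. -/
theorem Bigon.exists_patch (B : G.Bigon p q i i' j j' m t) {α : Type*} (g : Fin (2 * n + 1) → α)
    (h₁ : g (G.overAt p (!m)) = g (G.overAt q (!m)))
    (h₂ : g (G.underAt p (!t)) = g (G.underAt q (!t))) :
    ∃ g' : Fin (2 * n + 1) → α, (∀ x, x ∉ ({i.succ, j.succ} : Set _) → g' x = g x) ∧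
      ∀ l, ((G.pass l).1 = p ∨ (G.pass l).1 = q) → g' l.succ = g' l.castSucc := by
  classical
  obtain ⟨o, o₁, o₂, o₃, o₄⟩ := B.outside
  let g' : Fin (2 * n + 1) → α := fun x =>
    if x = i.succ then g i.castSucc else if x = j.succ then g j.castSucc else g x
  have a₁ : g' i.succ = g i.castSucc := if_pos rfl
  have a₂ : g' j.succ = g j.castSucc := by simp [g', o.symm]
  have a₃ : ∀ x, x ∉ ({i.succ, j.succ} : Set _) → g' x = g x := by
    intro x hx
    simp only [Set.mem_insert_iff, Set.mem_singleton_iff, not_or] at hx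
    simp [g', hx]
  have hi : i'.castSucc = i.succ := Fin.ext B.next
  have hj : j'.castSucc = j.succ := Fin.ext B.next'
  rw [B.over₁', B.over₂'] at h₁
  have h₂ : g j.castSucc = g j'.succ := by
    rcases B.under' with ⟨-, -, h, h'⟩ | ⟨-, -, h, h'⟩ <;> rw [h, h'] at h₂
    · exact h₂
    · exact h₂.symm
  refine ⟨g', a₃, fun l hl => ?_⟩
  rcases B.mem_passages hl with rfl | rfl | rfl | rfl
  · rw [a₁, a₃ _ o₁]
  · rw [hi, a₁, a₃ _ o₂, h₁]
  · rw [a₂, a₃ _ o₃]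
  · rw [hj, a₂, a₃ _ o₄, h₂]

instance : Finite G.Region := inferInstanceAs (Finite (Quot _))

end GaussCode

namespace KnotoidDiagram

/-! ### Planarity in the second move. -/

section Regions

variable {n : ℕ} {D : KnotoidDiagram n} {D' : KnotoidDiagram (n + 2)}
  {ι : Fin n ↪ Fin (n + 2)} {e : Fin (2 * n) ↪o Fin (2 * (n + 2))} {p q : Fin (n + 2)}
  {i i' j j' : Fin (2 * (n + 2))} {m t : Bool}

/-- By planarity, the strands of a second move border on the same region before the move. -/
theorem regionAt_eq_of_bigon (h : Inserts D D' ι e)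
    (B : D'.toGaussCode.Bigon p q i i' j j' m t)
    (hι : ∀ x, x ∉ Set.range ι ↔ x = p ∨ x = q)
    (hS : NewEdges D' ι {i.succ, j.succ}) :
    D.regionAt (pieceMap e (D'.overAt p (!m)), !t) =
      D.regionAt (pieceMap e (D'.underAt p (!t)), !m) := by
  classical
  set r₀ := D'.regionAt (D'.overAt p (!m), !t) with hr₀
  set r₁ := D'.regionAt (D'.overAt q (!m), !t) with hr₁
  -- At the corners `p` and `q` of the bigon, `r₀` and `r₁` are the quadrants opposite to it. They
  -- have to be identified when the strands are pulled apart; they may already coincide.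
  let merge : D'.Region → D'.Region := fun r => if r = r₁ then r₀ else r
  have merge_ends : merge r₀ = merge r₁ := by
    simp only [merge, if_true, ite_self]
  have hO : ∀ s, merge (D'.regionAt (D'.overAt p (!m), s)) =
      merge (D'.regionAt (D'.overAt q (!m), s)) := by
    intro s
    rcases Bool.eq_or_eq_not s t with rfl | rfl
    · rw [D'.regionAt_over, D'.regionAt_over, B.under₁, B.under₂]
    · exact merge_ends
  have hU : ∀ s, merge (D'.regionAt (D'.underAt p (!t), s)) =
      merge (D'.regionAt (D'.underAt q (!t), s)) := by
    intro s
    rw [← D'.regionAt_over, ← D'.regionAt_over]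
    rcases Bool.eq_or_eq_not s m with rfl | rfl
    · rw [B.over₁, B.over₂]
    · exact merge_ends
  have hk : ∀ s, ∃ k : Fin (2 * n + 1) → D'.Region, ∀ x', x' ∉ ({i.succ, j.succ} : Set _) →
      merge (D'.regionAt (x', s)) = k (pieceMap e x') := by
    intro s
    obtain ⟨g, h₁, h₂⟩ := B.exists_patch (fun x => merge (D'.regionAt (x, s))) (hO s) (hU s)
    obtain ⟨k, hk⟩ := exists_eq_comp_pieceMap e g fun l hl => h₂ l (by
      rwa [← hι, ← h.mem_range_iff])
    exact ⟨k, fun x' hx' => by rw [← h₁ x' hx', hk]⟩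
  choose k hk using hk
  -- A region of `D` goes to the merged class of the regions along the pieces of its edges. Merging
  -- makes this independent of the piece, and the old corners are still corners of `D'`.
  let Ψ : D.Region → D'.Region := Quot.lift (fun d => k d.2 d.1) (by
    have key : ∀ c a b, k a (D.overAt c b) = k b (D.underAt c a) := by
      intro c a b
      rw [← h.pieceMap_overAt, ← h.pieceMap_underAt, ← hk _ _ (hS.overAt_notMem c b),
        ← hk _ _ (hS.underAt_notMem c a), D'.regionAt_over]
    intro d d' hd
    rcases D.toGaussCode.corner_cases hd with ⟨c, a, b, rfl, rfl⟩ | ⟨c, a, b, rfl, rfl⟩ |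
      ⟨rfl, rfl⟩ | ⟨rfl, rfl⟩
    · exact key c a b
    · exact (key c a b).symm
    · simp only
      rw [← pieceMap_zero e, ← hk _ _ hS.zero_notMem, ← hk _ _ hS.zero_notMem]
      exact congrArg merge (Quot.sound .first)
    · simp only
      rw [← pieceMap_last e, ← hk _ _ hS.last_notMem, ← hk _ _ hS.last_notMem]
      exact congrArg merge (Quot.sound .last))
  have hΨ : ∀ x' s, x' ∉ ({i.succ, j.succ} : Set _) →
      Ψ (D.regionAt (pieceMap e x', s)) = merge (D'.regionAt (x', s)) := fun x' s hx' =>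
    (hk s x' hx').symm
  clear_value Ψ
  obtain ⟨o₁, o₂, o₃, o₄⟩ := B.outside'
  -- The bigon itself is the only class that need not come from `D`: the outer sides of its two
  -- edges also border on edges away from it.
  have range_merge : Set.range merge ⊆
      insert (merge (D'.regionAt (D'.overAt p m, t))) (Set.range Ψ) := by
    rintro _ ⟨⟨x', s⟩, rfl⟩
    change merge (D'.regionAt (x', s)) ∈ _
    by_cases hx : x' ∈ ({i.succ, j.succ} : Set _)
    · rcases hx with rfl | rfl
      · rcases Bool.eq_or_eq_not s t with rfl | rfl
        · rw [B.over₁]; exact .inl rfl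
        · rw [← B.over₁, D'.regionAt_over p (!t) m, ← hΨ _ _ o₃]
          exact Set.mem_insert_of_mem _ (Set.mem_range_self _)
      · rcases Bool.eq_or_eq_not s m with rfl | rfl
        · rw [← B.under₁, ← D'.regionAt_over]; exact .inl rfl
        · rw [← B.under₁, ← D'.regionAt_over, ← hΨ _ _ o₁]
          exact Set.mem_insert_of_mem _ (Set.mem_range_self _)
    · rw [← hΨ _ _ hx]
      exact Set.mem_insert_of_mem _ (Set.mem_range_self _)
  -- Of the `n + 3` regions at most one is lost by merging.
  have card₁ : n + 2 ≤ (Set.range merge).ncard := by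
    have h₁ : ({r₁}ᶜ : Set D'.Region) ⊆ Set.range merge := fun r hr => ⟨r, if_neg hr⟩
    have h₂ := Set.ncard_add_ncard_compl ({r₁} : Set D'.Region)
    have h₃ : Nat.card D'.Region = n + 2 + 1 := D'.planar
    have h₄ := Set.ncard_le_ncard h₁ (Set.toFinite _)
    rw [Set.ncard_singleton, h₃] at h₂
    omega
  have card₂ := (Set.ncard_le_ncard range_merge (Set.toFinite _)).trans (Set.ncard_insert_le _ _)
  -- Without the bigon at least `n + 1` classes remain in the image of `Ψ`, and `D` has just `n + 1`
  -- regions. The two regions in question have the same image, by the corner at `p`, so they are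
  -- equal.
  have hinj : Function.Injective Ψ := by
    have h₁ : Nat.card D.Region = n + 1 := D.planar
    have h₂ : (Set.range Ψ).ncard ≤ (Set.univ : Set D.Region).ncard := by
      rw [← Set.image_univ]; exact Set.ncard_image_le (Set.toFinite _)
    rw [Set.ncard_univ] at h₂
    have h₃ : (Ψ '' Set.univ).ncard = (Set.univ : Set D.Region).ncard := by
      rw [Set.image_univ, Set.ncard_univ]; omega
    exact Set.injOn_univ.1 ((Set.ncard_image_iff (Set.toFinite _)).1 h₃)
  apply hinj
  rw [hΨ _ _ o₁, hΨ _ _ o₃, D'.regionAt_over]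

end Regions

variable {X Y A : Type} [Quandle X] [QuandleSet X Y] [CommGroup A]

theorem coloringsCorrespond_r2 {n : ℕ} {D : KnotoidDiagram n} {D' : KnotoidDiagram (n + 2)}
    {ι : Fin n ↪ Fin (n + 2)} {e : Fin (2 * n) ↪o Fin (2 * (n + 2))}
    (inserts : Inserts D D' ι e) {p q : Fin (n + 2)} (p_new : p ∉ Set.range ι)
    (q_new : q ∉ Set.range ι) {i i' j j' : Fin (2 * (n + 2))} {m t : Bool}
    (B : D'.toGaussCode.Bigon p q i i' j j' m t) (outer : SameOuter D D' e {i.succ, j.succ}) :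
    ColoringsCorrespond ⟨n, D⟩ ⟨n + 2, D'⟩ X Y A := by
  classical
  have hpq : p ≠ q := by
    rintro rfl
    have := B.signs
    simp at this
  have compl : (Finset.univ.map ι)ᶜ = {p, q} := by
    refine (Finset.eq_of_subset_of_card_le ?_ ?_).symm
    · intro x hx
      simp only [Finset.mem_insert, Finset.mem_singleton] at hx
      rcases hx with rfl | rfl
      · simpa using p_new
      · simpa using q_new
    · simp [Finset.card_compl, hpq]
  have mem_new : ∀ x, x ∉ Set.range ι ↔ x = p ∨ x = q := by
    intro x
    have : x ∈ (Finset.univ.map ι)ᶜ ↔ x = p ∨ x = q := by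
      rw [compl, Finset.mem_insert, Finset.mem_singleton]
    simpa using this
  obtain ⟨o₁, o₂, o₃, o₄⟩ := B.outside'
  have hpj := B.pass_j
  have hS : NewEdges D' ι {i.succ, j.succ} := by
    rintro _ (rfl | rfl)
    · exact ⟨i, i', B.next, rfl, by rwa [B.over_i], by rwa [B.over_i']⟩
    · exact ⟨j, j', B.next', rfl, (mem_new _).2 hpj.1, (mem_new _).2 hpj.2.2.1⟩
  have two_sides : ∀ {P : Bool → Prop} (x : Bool), P x → P (!x) → ∀ y, P y := by
    intro P x h₁ h₂ y
    cases x <;> cases y <;> assumption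
  refine coloringsCorrespond_of_inserts inserts hS outer (fun col => ?_) (fun col' => ?_)
    (fun c₁ c₂ h => ?_)
  · have region := congrArg col.region (regionAt_eq_of_bigon inserts B mem_new hS)
    rw [EdgeColoring.region_regionAt, EdgeColoring.region_regionAt] at region
    simp only at region
    have notMem : ∀ {l}, (D'.pass l).1 = p ∨ (D'.pass l).1 = q → l ∉ Set.range e := fun {l} hl => by
      rwa [inserts.mem_range_iff, mem_new]
    have hi : i'.castSucc = i.succ := Fin.ext B.next
    have hj : j'.castSucc = j.succ := Fin.ext B.next'
    have po : pieceMap e (D'.overAt q (!m)) = pieceMap e (D'.overAt p (!m)) := by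
      rw [B.over₁', B.over₂', pieceMap_new e (notMem (by simp [B.over_i'])), hi,
        pieceMap_new e (notMem (by simp [B.over_i]))]
    have pj : pieceMap e j'.succ = pieceMap e j.castSucc := by
      rw [pieceMap_new e (notMem hpj.2.2.1), hj, pieceMap_new e (notMem hpj.1)]
    have pu : pieceMap e (D'.underAt q (!t)) = pieceMap e (D'.underAt p (!t)) := by
      rcases B.under' with ⟨-, -, h, h'⟩ | ⟨-, -, h, h'⟩ <;> rw [h, h', pj]
    -- The old colors of the under-strand and the over-color `z` determine one pattern, which is
    -- used at both new crossings.
    obtain ⟨y, x, hu⟩ := exists_underState (col.1 (pieceMap e (D'.overAt p (!m)))).1 (!t)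
      (col.1 (pieceMap e (D'.underAt p (!t))))
    generalize hz : (col.1 (pieceMap e (D'.overAt p (!m)))).1 = z at hu
    -- This is where the common region enters: the pattern reproduces the region color of the
    -- over-strand only because both strands border on that region.
    have ho : overState y x z (!m) = col.1 (pieceMap e (D'.overAt p (!m))) := by
      refine sideColor_injective (!t) hz.symm ?_
      rw [region, sideColor_over, hu]
    let col' : Fin (2 * (n + 2) + 1) → X × Y := fun v =>
      if v = i.succ then overState y x z m else if v = j.succ then underState y x z t
      else col.1 (pieceMap e v)
    have hc₁ : col' i.succ = overState y x z m := if_pos rfl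
    have hc₂ : col' j.succ = underState y x z t := by simp [col', B.outside.1.symm]
    have hc : ∀ v, v ∉ ({i.succ, j.succ} : Set _) → col' v = col.1 (pieceMap e v) := by
      intro v hv
      simp only [Set.mem_insert_iff, Set.mem_singleton_iff, not_or] at hv
      simp [col', hv]
    have hP : ∀ s, col' (D'.overAt p s) = overState y x z s :=
      two_sides m (by rw [B.over₁, hc₁]) (by rw [hc _ o₁, ho])
    have hQ : ∀ s, col' (D'.overAt q s) = overState y x z s :=
      two_sides m (by rw [B.over₂, hc₁]) (by rw [hc _ o₂, po, ho])
    have hP' : ∀ s, col' (D'.underAt p s) = underState y x z s :=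
      two_sides t (by rw [B.under₁, hc₂]) (by rw [hc _ o₃, hu])
    have hQ' : ∀ s, col' (D'.underAt q s) = underState y x z s :=
      two_sides t (by rw [B.under₂, hc₂]) (by rw [hc _ o₄, pu, hu])
    refine ⟨col', hc, fun v hv => ?_, fun f => ?_⟩
    · rcases (mem_new v).1 hv with rfl | rfl
      · exact ⟨y, x, z, hP, hP'⟩
      · exact ⟨y, x, z, hQ, hQ'⟩
    · rw [compl, Finset.prod_pair hpq]
      simp only [GaussCode.edgeWeight, GaussCode.stateWeight, hP, hQ, hP', hQ', B.signs]
      cases D'.sign p <;> simp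
  · have h := (col'.2.crossing p).unique (col'.2.crossing q) (m := m) (m' := m) (s := t)
      (by simp only [B.over₁, B.over₂]) (by simp only [B.under₁, B.under₂])
    obtain ⟨g, h₁, h₂⟩ := B.exists_patch col'.1 (congrFun h.1 (!m)) (congrFun h.2 (!t))
    exact ⟨g, h₁, fun l hl => h₂ l ((mem_new _).1 hl)⟩
  · have hp := (c₁.2.crossing p).unique (c₂.2.crossing p) (m := !m) (m' := !m) (s := !t)
      (congrArg Prod.fst (h _ o₁)) (h _ o₃)
    have h₁ := congrFun hp.1 m
    have h₂ := congrFun hp.2 t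
    simp only [B.over₁, B.under₁] at h₁ h₂
    funext v
    by_cases hv : v ∈ ({i.succ, j.succ} : Set _)
    · rcases hv with rfl | rfl <;> assumption
    · exact h v hv

/-- Renumbering the crossings and Reidemeister moves keep the colorings. -/
theorem Move.coloringsCorrespond {x y : Σ n, KnotoidDiagram n} (h : Move x y) :
    ColoringsCorrespond x y X Y A := by
  cases h with
  | @renumber n D D' ρ sign pass outer =>
    have hs : ∀ c b, D'.pass.symm (ρ c, b) = D.pass.symm (c, b) := by
      intro c b
      rw [Equiv.symm_apply_eq, pass, Equiv.apply_symm_apply]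
    have ho : ∀ c s, D'.overAt (ρ c) s = D.overAt c s := by
      intro c s
      simp [GaussCode.overAt, hs, sign]
    have hu : ∀ c s, D'.underAt (ρ c) s = D.underAt c s := by
      intro c s
      simp [GaussCode.underAt, hs, sign]
    refine coloringsCorrespond_of_agree id ∅ (fun q₁ q₂ h => funext fun x => h x (by simp))
      (fun q => ⟨⟨q.1, fun c => ?_, q.2.first, q.2.last⟩, fun _ _ => rfl, fun f => ?_⟩)
      (fun q => ⟨⟨q.1, fun c => ?_, q.2.first, q.2.last⟩, fun _ _ => rfl⟩)
      (fun q₁ q₂ h => funext fun x => h x (by simp)) ?_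
    · obtain ⟨c, rfl⟩ := ρ.surjective c
      simp only [ho, hu]
      exact q.2.crossing c
    · rw [← Equiv.prod_comp ρ]
      simp only [GaussCode.edgeWeight, ho, hu, sign]
    · simp only [← ho, ← hu]
      exact q.2.crossing (ρ c)
    · obtain ⟨⟨x, s⟩, h₁, h₂⟩ := outer
      exact ⟨x, s, by simp, h₁, h₂⟩
  | r1 D D' ι e inserts c new i i' next loop outer =>
    exact coloringsCorrespond_r1 inserts new next loop outer
  | r2 D D' ι e inserts p q p_new q_new signs i i' j j' next next' overs unders outer =>
    obtain ⟨m, t, B⟩ := GaussCode.exists_bigon signs next next' overs unders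
    exact coloringsCorrespond_r2 inserts p_new q_new B outer
  | r3 D D' p q r hpq hpr hqr i i' j j' k k' hi hj hk top middle bottom s t u c₁ c₂ c₃ sign
      s₁ s₂ s₃ others outer =>
    refine coloringsCorrespond_of_triangle (triangle_of_r3 hpq hpr hqr hi hj hk top middle bottom
      c₁ c₂ c₃ sign s₁ s₂ s₃ others) ?_ X Y A
    obtain ⟨d, h₁, h₂, h₃, h₄⟩ := outer
    exact ⟨d, by simp [h₁, h₂, h₃], h₄⟩

variable (X Y) in
/-- The number of colorings is an invariant of knotoids. -/
theorem card_edgeColoring_congr {m n : ℕ} {D : KnotoidDiagram m} {E : KnotoidDiagram n}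
    (h : D.knotoid = E.knotoid) : Nat.card (D.EdgeColoring X Y) = Nat.card (E.EdgeColoring X Y) :=
  congrArg (Quot.lift (fun x : Σ n, KnotoidDiagram n => Nat.card (x.2.EdgeColoring X Y))
    fun _ _ h => by
      -- Weights play no role for the count; any coefficient group would serve.
      obtain ⟨φ, hφ, -⟩ := Move.coloringsCorrespond (X := X) (Y := Y) (A := Z3) h
      exact Nat.card_eq_of_bijective φ hφ) h

variable [Finite X] [Finite Y]

theorem Move.shadowInvariant_eq {x y : Σ n, KnotoidDiagram n} (h : Move x y)
    (f : QuandleCocycle X Y A) (Y₀ : Set Y) :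
    x.2.shadowInvariant f Y₀ = y.2.shadowInvariant f Y₀ := by
  obtain ⟨φ, hφ, h⟩ := h.coloringsCorrespond (X := X) (Y := Y) (A := A)
  rw [KnotoidDiagram.shadowInvariant_eq, KnotoidDiagram.shadowInvariant_eq]
  refine finsum_eq_of_bijective φ hφ fun q => ?_
  rw [(h q).1, (h q).2]

/-- The shadow quandle cocycle invariant is an invariant of knotoids. -/
theorem shadowInvariant_congr {m n : ℕ} {D : KnotoidDiagram m} {E : KnotoidDiagram n}
    (h : D.knotoid = E.knotoid) (f : QuandleCocycle X Y A) (Y₀ : Set Y) :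
    D.shadowInvariant f Y₀ = E.shadowInvariant f Y₀ :=
  congrArg (Quot.lift (fun x : Σ n, KnotoidDiagram n => x.2.shadowInvariant f Y₀)
    fun _ _ h => Move.shadowInvariant_eq h f Y₀) h

end KnotoidDiagram

/-! ### Colorings of the twist diagrams -/

/-- The numbers of the edges at the crossings of the twist diagram. -/
theorem twistCode_edges (n : ℕ) (c : Fin (n + 2)) {o₀ o₁ u₀ u₁ : ℕ}
    (ho₀ : o₀ = ((twistCode n).overAt c false).val) (ho₁ : o₁ = ((twistCode n).overAt c true).val)
    (hu₀ : u₀ = ((twistCode n).underAt c false).val)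
    (hu₁ : u₁ = ((twistCode n).underAt c true).val) :
    (n % 2 = 0 ∧ c.val = 0 ∧ (twistCode n).sign c = true ∧
      o₀ = n + 2 ∧ o₁ = n + 1 ∧ u₀ = 0 ∧ u₁ = 1) ∨
    (n % 2 = 1 ∧ c.val = 0 ∧ (twistCode n).sign c = false ∧
      o₀ = n + 2 ∧ o₁ = n + 3 ∧ u₀ = 1 ∧ u₁ = 0) ∨
    (n % 2 = 0 ∧ c.val = n + 1 ∧ (twistCode n).sign c = true ∧
      o₀ = 2 * n + 4 ∧ o₁ = 2 * n + 3 ∧ u₀ = n + 2 ∧ u₁ = n + 3) ∨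
    (n % 2 = 1 ∧ c.val = n + 1 ∧ (twistCode n).sign c = false ∧
      o₀ = 2 * n + 3 ∧ o₁ = 2 * n + 4 ∧ u₀ = n + 2 ∧ u₁ = n + 1) ∨
    ((1 ≤ c.val ∧ c.val ≤ n) ∧ c.val % 2 = 0 ∧ (twistCode n).sign c = false ∧
      o₀ + c = 2 * n + 3 ∧ o₁ + c = 2 * n + 4 ∧ u₀ = c + 1 ∧ u₁ = c) ∨
    ((1 ≤ c.val ∧ c.val ≤ n) ∧ c.val % 2 = 1 ∧ (twistCode n).sign c = false ∧
      o₀ = c ∧ o₁ = c + 1 ∧ u₀ + c = 2 * n + 4 ∧ u₁ + c = 2 * n + 3) := by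
  have hs : (twistCode n).sign c = true ↔ ((c.val = 0 ∨ c.val = n + 1) ∧ n % 2 = 0) := by
    simp [twistCode, Nat.even_iff]
  have h := twistCode_cases n c _ _ rfl rfl
  have hc := c.isLt
  simp only [GaussCode.toRight, GaussCode.toLeft] at h
  simp only [GaussCode.overAt, GaussCode.underAt] at ho₀ ho₁ hu₀ hu₁
  generalize (twistCode n).sign c = σ at *
  generalize (twistCode n).pass.symm = f at *
  generalize c.val = k at *
  cases σ <;> simp only [Bool.not_true, Bool.not_false, if_true, Bool.false_eq_true,
    Bool.true_eq_false, if_false, Fin.val_succ, Fin.val_castSucc] at ho₀ ho₁ hu₀ hu₁ h <;>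
    simp only [false_iff, true_iff, Bool.false_eq_true] at hs <;>
    generalize (f (c, true)).val = x at * <;> generalize (f (c, false)).val = y at * <;>
    subst ho₀ ho₁ hu₀ hu₁ <;> clear f
  · rcases h with h | h | h | h | h | h
    · exact absurd ⟨.inl h.2.1, h.1⟩ hs
    · refine .inr (.inl ⟨h.1, h.2.1, rfl, ?_⟩); omega
    · exact absurd ⟨.inr h.2.1, h.1⟩ hs
    · refine .inr (.inr (.inr (.inl ⟨h.1, h.2.1, rfl, ?_⟩))); omega
    · refine .inr (.inr (.inr (.inr (.inl ⟨⟨h.1, h.2.1⟩, h.2.2.1, rfl, ?_⟩)))); omega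
    · refine .inr (.inr (.inr (.inr (.inr ⟨⟨h.1, h.2.1⟩, h.2.2.1, rfl, ?_⟩)))); omega
  · rcases hs with ⟨h₁ | h₁, hn⟩
    · refine .inl ⟨hn, h₁, rfl, ?_⟩; omega
    · refine .inr (.inr (.inl ⟨hn, h₁, rfl, ?_⟩)); omega

/-! ### Colorings by dihedral quandles of odd order. -/

section Dihedral

variable {N : ℕ}

theorem isCrossing_dihedral_iff {o u : Bool → ZMod N × ZMod N} :
    IsCrossing (X := Quandle.Dihedral N) (Y := Quandle.Dihedral N) o u ↔
      (o true).1 = (o false).1 ∧ (o false).2 = (u false).2 ∧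
        (o true).2 = 2 * (u false).1 - (u false).2 ∧ (u true).1 = 2 * (o false).1 - (u false).1 ∧
        (u true).2 = 2 * (o false).1 - (u false).2 := by
  constructor
  · rintro ⟨y, x, z, h₁, h₂⟩
    rw [h₁, h₁, h₂, h₂]
    exact ⟨rfl, rfl, rfl, rfl, rfl⟩
  · rintro ⟨h₁, h₂, h₃, h₄, h₅⟩
    refine ⟨(u false).2, (u false).1, (o false).1, fun m => ?_, fun s => ?_⟩
    · cases m
      · exact Prod.ext rfl h₂
      · exact Prod.ext h₁ h₃
    · cases s
      · rfl
      · exact Prod.ext h₄ h₅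

/-- As `2` is invertible, the endpoint condition makes the region at an end take the color of the
arc ending there. -/
theorem eq_of_two_mul_sub_eq (hN : Odd N) {a b : ZMod N} (h : 2 * a - b = b) : b = a := by
  have h₂ : IsUnit (2 : ZMod N) := by
    have := (ZMod.isUnit_iff_coprime 2 N).2 (Nat.coprime_two_left.2 hN)
    exact_mod_cast this
  refine h₂.mul_left_cancel ?_
  linear_combination -h

variable {n : ℕ}

/-- With respect to a dihedral quandle of odd order, a coloring is determined by the colors of
the arcs. -/
theorem dihedral_coloring_ext (hN : Odd N) {G : GaussCode n}
    {q q' : Fin (2 * n + 1) → Quandle.Dihedral N × Quandle.Dihedral N} (h : G.IsEdgeColoring q)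
    (h' : G.IsEdgeColoring q') (arcs : ∀ e, (q e).1 = (q' e).1) : q = q' := by
  funext e
  refine Prod.ext (arcs e) ?_
  -- The region at the start is fixed by the endpoint condition. Each passage then reflects the
  -- color of the region on the right in the color of the arc that is crossed.
  induction e using Fin.induction with
  | zero =>
    have h₁ := eq_of_two_mul_sub_eq (N := N) hN h.first
    have h₂ := eq_of_two_mul_sub_eq (N := N) hN h'.first
    rw [h₁, h₂, arcs]
  | succ l ih =>
    obtain ⟨⟨c, b⟩, hl⟩ : ∃ w, G.pass.symm w = l := ⟨G.pass l, by simp⟩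
    have h₁ := isCrossing_dihedral_iff.1 (h.crossing c)
    have h₂ := isCrossing_dihedral_iff.1 (h'.crossing c)
    have ao := arcs (G.overAt c false)
    have au := arcs (G.underAt c false)
    have step : ∀ (f : Bool → ZMod N) (f' : Bool → ZMod N) (z : ZMod N) (s : Bool),
        f true = 2 * z - f false → f' true = 2 * z - f' false → f s = f' s → f (!s) = f' (!s) := by
      intro f f' z s h h' hs
      cases s
      · rw [Bool.not_false, h, h', hs]
      · rw [h, h'] at hs
        exact sub_right_injective hs
    cases b
    · have hu := G.underAt_sign c
      rw [hl] at hu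
      rw [← hu.1] at ih
      rw [← hu.2, ← Bool.not_not (G.sign c)]
      refine step (fun s => (q (G.underAt c s)).2) (fun s => (q' (G.underAt c s)).2)
        (q (G.overAt c false)).1 _ h₁.2.2.2.2 ?_ ih
      rw [ao]; exact h₂.2.2.2.2
    · have ho := G.overAt_sign c
      rw [hl] at ho
      rw [← ho.1] at ih
      rw [← ho.2]
      refine step (fun s => (q (G.overAt c s)).2) (fun s => (q' (G.overAt c s)).2)
        (q (G.underAt c false)).1 _ ?_ ?_ ih
      · rw [h₁.2.1]; exact h₁.2.2.1
      · rw [h₂.2.1, au]; exact h₂.2.2.1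

end Dihedral

/-- The color of the arc at the edge `e` of the twist diagram. -/
def twistArc {N : ℕ} (n : ℕ) (b d : ZMod N) (e : ℕ) : ZMod N :=
  if e = 0 ∨ e = 2 * n + 4 then b
  else if e ≤ n + 1 then (if e % 2 = 1 then b + e * d else b + (e - 1) * d)
  else if e = n + 2 then b + (n + 1) * d
  else if e % 2 = 1 then b + (2 - e) * d else b + (3 - e) * d

/-- The color of the region to the right of the edge `e` of the twist diagram. -/
def twistRight {N : ℕ} (n : ℕ) (b d : ZMod N) (e : ℕ) : ZMod N :=
  if e = 0 ∨ e = 2 * n + 4 then b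
  else if e ≤ n + 1 then (if e % 2 = 1 then b + (2 * e - 1) * d else b - d)
  else if e = n + 2 then (if n % 2 = 0 then b else b + d)
  else if e % 2 = 1 then b + (5 - 2 * e) * d else b + d

section TwistValues

variable {N n e : ℕ} (b d : ZMod N)

theorem twist_zero : twistArc n b d 0 = b ∧ twistRight n b d 0 = b := by
  simp [twistArc, twistRight]

theorem twist_last (h : e = 2 * n + 4) : twistArc n b d e = b ∧ twistRight n b d e = b := by
  simp [twistArc, twistRight, h]

theorem twist_low_odd (h : e ≤ n + 1) (h' : e % 2 = 1) :
    twistArc n b d e = b + e * d ∧ twistRight n b d e = b + (2 * e - 1) * d := by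
  have : ¬ (e = 0 ∨ e = 2 * n + 4) := by omega
  simp [twistArc, twistRight, this, h, h']

theorem twist_low_even (h₀ : 1 ≤ e) (h : e ≤ n + 1) (h' : e % 2 = 0) :
    twistArc n b d e = b + (e - 1) * d ∧ twistRight n b d e = b - d := by
  have : ¬ (e = 0 ∨ e = 2 * n + 4) := by omega
  simp [twistArc, twistRight, this, h, h']

theorem twist_mid (h : e = n + 2) : twistArc n b d e = b + (n + 1) * d ∧
    (n % 2 = 0 → twistRight n b d e = b) ∧ (n % 2 = 1 → twistRight n b d e = b + d) := by
  have h₁ : ¬ (e = 0 ∨ e = 2 * n + 4) := by omega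
  have h₂ : ¬ e ≤ n + 1 := by omega
  refine ⟨by rw [twistArc, if_neg h₁, if_neg h₂, if_pos h], fun h' => ?_, fun h' => ?_⟩
  · rw [twistRight, if_neg h₁, if_neg h₂, if_pos h, if_pos h']
  · rw [twistRight, if_neg h₁, if_neg h₂, if_pos h, if_neg (by omega)]

theorem twist_high_odd (h₀ : n + 3 ≤ e) (h' : e % 2 = 1) :
    twistArc n b d e = b + (2 - e) * d ∧ twistRight n b d e = b + (5 - 2 * e) * d := by
  have h₁ : ¬ (e = 0 ∨ e = 2 * n + 4) := by omega
  have h₂ : ¬ e ≤ n + 1 := by omega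
  have h₃ : ¬ e = n + 2 := by omega
  simp only [twistArc, twistRight, h₁, h₂, h₃, h', if_true, if_false, and_self]

theorem twist_high_even (h₀ : n + 3 ≤ e) (h : e ≤ 2 * n + 3) (h' : e % 2 = 0) :
    twistArc n b d e = b + (3 - e) * d ∧ twistRight n b d e = b + d := by
  have h₁ : ¬ (e = 0 ∨ e = 2 * n + 4) := by omega
  have h₂ : ¬ e ≤ n + 1 := by omega
  have h₃ : ¬ e = n + 2 := by omega
  simp only [twistArc, twistRight, h₁, h₂, h₃, h', zero_ne_one, if_false, and_self]

end TwistValues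

section TwistColoring

variable {N : ℕ} {n : ℕ} {b d : ZMod N}

/-- The colors at the edges of the twist diagram. -/
def twistState (n : ℕ) (b d : ZMod N) (e : Fin (2 * (n + 2) + 1)) :
    Quandle.Dihedral N × Quandle.Dihedral N :=
  (twistArc n b d e.val, twistRight n b d e.val)

/-- At every crossing the rule is linear in `b` and `d`, and its defect is a multiple of `(2n + 1)
d`. Edges on the way back have numbers `2n + 3 - c` or `2n + 4 - c`, which produces this multiple.
-/
theorem isEdgeColoring_twistState (h : (2 * n + 1) * d = 0) :
    (twistCode n).IsEdgeColoring (twistState n b d) := by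
  have h₀ := twist_zero (n := n) b d
  refine ⟨fun c => ?_, ?_, ?_⟩
  · refine isCrossing_dihedral_iff.2 ?_
    simp only [twistState]
    have hv := twistCode_edges n c rfl rfl rfl rfl
    generalize ((twistCode n).overAt c false).val = o₀ at *
    generalize ((twistCode n).overAt c true).val = o₁ at *
    generalize ((twistCode n).underAt c false).val = u₀ at *
    generalize ((twistCode n).underAt c true).val = u₁ at *
    generalize c.val = c at *
    rcases hv with ⟨hn, hc, -, ho₀, ho₁, hu₀, hu₁⟩ | ⟨hn, hc, -, ho₀, ho₁, hu₀, hu₁⟩ |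
      ⟨hn, hc, -, ho₀, ho₁, hu₀, hu₁⟩ | ⟨hn, hc, -, ho₀, ho₁, hu₀, hu₁⟩ |
      ⟨hn, hc, -, ho₀, ho₁, hu₀, hu₁⟩ | ⟨hn, hc, -, ho₀, ho₁, hu₀, hu₁⟩
    · have a₁ := twist_mid b d ho₀
      have a₂ := twist_low_odd (n := n) (e := o₁) b d (by omega) (by omega)
      have a₃ := twist_low_odd (n := n) (e := u₁) b d (by omega) (by omega)
      simp only [a₁, a₂, a₃, hu₀, h₀, hn]
      subst ho₁ hu₁
      push_cast
      refine ⟨?_, ?_, ?_, ?_, ?_⟩ <;> first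
        | trivial | ring1 | linear_combination h | linear_combination -h
    · have a₁ := twist_mid b d ho₀
      have a₂ := twist_high_even (n := n) (e := o₁) b d (by omega) (by omega) (by omega)
      have a₃ := twist_low_odd (n := n) (e := u₀) b d (by omega) (by omega)
      simp only [a₁, a₂, a₃, hu₁, h₀, hn]
      subst ho₁ hu₀
      push_cast
      refine ⟨?_, ?_, ?_, ?_, ?_⟩ <;> first
        | trivial | ring1 | linear_combination h | linear_combination -h
    · have a₁ := twist_last b d ho₀
      have a₂ := twist_high_odd (n := n) (e := o₁) b d (by omega) (by omega)
      have a₃ := twist_mid b d hu₀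
      have a₄ := twist_high_odd (n := n) (e := u₁) b d (by omega) (by omega)
      simp only [a₁, a₂, a₃, a₄, hn]
      subst ho₁ hu₁
      push_cast
      refine ⟨?_, ?_, ?_, ?_, ?_⟩ <;> first
        | trivial | ring1 | linear_combination h | linear_combination -h | linear_combination 2 * h
        | linear_combination -2 * h | linear_combination 3 * h | linear_combination -3 * h
    · have a₁ := twist_high_odd (n := n) (e := o₀) b d (by omega) (by omega)
      have a₂ := twist_last b d ho₁
      have a₃ := twist_mid b d hu₀
      have a₄ := twist_low_even (n := n) (e := u₁) b d (by omega) (by omega) (by omega)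
      simp only [a₁, a₂, a₃, a₄, hn]
      subst ho₀ hu₁
      push_cast
      refine ⟨?_, ?_, ?_, ?_, ?_⟩ <;> first
        | trivial | ring1 | linear_combination h | linear_combination -h | linear_combination 2 * h
        | linear_combination -2 * h | linear_combination 3 * h
    · have a₁ := twist_high_odd (n := n) (e := o₀) b d (by omega) (by omega)
      have a₂ := twist_high_even (n := n) (e := o₁) b d (by omega) (by omega) (by omega)
      have a₃ := twist_low_odd (n := n) (e := u₀) b d (by omega) (by omega)
      have a₄ := twist_low_even (n := n) (e := u₁) b d (by omega) (by omega) (by omega)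
      have c₁ : (o₀ : ZMod N) = 2 * n + 3 - c := by
        rw [eq_sub_iff_add_eq]; exact_mod_cast congrArg Nat.cast ho₀
      have c₂ : (o₁ : ZMod N) = 2 * n + 4 - c := by
        rw [eq_sub_iff_add_eq]; exact_mod_cast congrArg Nat.cast ho₁
      simp only [a₁, a₂, a₃, a₄, c₁, c₂]
      subst hu₀ hu₁
      push_cast
      refine ⟨?_, ?_, ?_, ?_, ?_⟩ <;> first
        | trivial | ring1 | linear_combination h | linear_combination -h | linear_combination 2 * h
        | linear_combination -2 * h
    · have a₁ := twist_low_odd (n := n) (e := o₀) b d (by omega) (by omega)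
      have a₂ := twist_low_even (n := n) (e := o₁) b d (by omega) (by omega) (by omega)
      have a₃ := twist_high_odd (n := n) (e := u₀) b d (by omega) (by omega)
      have a₄ := twist_high_even (n := n) (e := u₁) b d (by omega) (by omega) (by omega)
      have c₁ : (u₀ : ZMod N) = 2 * n + 4 - c := by
        rw [eq_sub_iff_add_eq]; exact_mod_cast congrArg Nat.cast hu₀
      have c₂ : (u₁ : ZMod N) = 2 * n + 3 - c := by
        rw [eq_sub_iff_add_eq]; exact_mod_cast congrArg Nat.cast hu₁
      simp only [a₁, a₂, a₃, a₄, c₁, c₂]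
      subst ho₀ ho₁
      push_cast
      refine ⟨?_, ?_, ?_, ?_, ?_⟩ <;> first
        | trivial | ring1 | linear_combination h | linear_combination -h | linear_combination 2 * h
        | linear_combination -2 * h
  · change 2 * twistArc n b d 0 - twistRight n b d 0 = twistRight n b d 0
    rw [h₀.1, h₀.2]; ring
  · have h₁ := twist_last (n := n) b d (e := 2 * (n + 2)) (by ring)
    change 2 * twistArc n b d (2 * (n + 2)) - twistRight n b d (2 * (n + 2)) =
      twistRight n b d (2 * (n + 2))
    rw [h₁.1, h₁.2]; ring

end TwistColoring

/-! ### All colorings of the twist diagrams; the twist knotoids are distinct. -/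

section TwistClassification

variable {N n : ℕ}

/-- The coloring rule for the arcs at the crossings of the twist diagram. -/
theorem twist_arc_relations {q : Fin (2 * (n + 2) + 1) → Quandle.Dihedral N × Quandle.Dihedral N}
    (h : (twistCode n).IsEdgeColoring q) {a : ℕ → ZMod N}
    (ha : ∀ e : Fin (2 * (n + 2) + 1), a e.val = (q e).1) (c : Fin (n + 2)) : ∃ o₀ o₁ u₀ u₁,
    o₀ = ((twistCode n).overAt c false).val ∧ o₁ = ((twistCode n).overAt c true).val ∧
    u₀ = ((twistCode n).underAt c false).val ∧ u₁ = ((twistCode n).underAt c true).val ∧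
    a o₁ = a o₀ ∧ a u₁ = 2 * a o₀ - a u₀ := by
  obtain ⟨h₁, -, -, h₂, -⟩ := isCrossing_dihedral_iff.1 (h.crossing c)
  refine ⟨_, _, _, _, rfl, rfl, rfl, rfl, ?_, ?_⟩
  · rw [ha, ha]; exact h₁
  · rw [ha, ha, ha]; exact h₂

/-- Each half-twist reflects the color of one strand in that of the other, so the two colors stay
consecutive terms of a progression of difference `d`. The parity of `c` tells which strand is over
and hence keeps its color. -/
theorem twist_arc_chain {a : ℕ → ZMod N} {b d : ZMod N} (hb : a (2 * n + 3) = b) (hd : a 1 = b + d)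
    (even : ∀ c, 1 ≤ c → c ≤ n → c % 2 = 0 → a (2 * n + 4 - c) = a (2 * n + 3 - c) ∧
      a c = 2 * a (2 * n + 3 - c) - a (c + 1))
    (odd : ∀ c, 1 ≤ c → c ≤ n → c % 2 = 1 → a (c + 1) = a c ∧
      a (2 * n + 3 - c) = 2 * a c - a (2 * n + 4 - c)) (c : ℕ) (hc : c ≤ n) :
    (c % 2 = 0 → a (c + 1) = b + (c + 1) * d ∧ a (2 * n + 3 - c) = b + c * d) ∧
      (c % 2 = 1 → a (c + 1) = b + c * d ∧ a (2 * n + 3 - c) = b + (c + 1) * d) := by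
  induction c with
  | zero => simp [hb, hd]
  | succ c ih =>
    have ih := ih (by omega)
    have h₁ := even (c + 1) (by omega) hc
    have h₂ := odd (c + 1) (by omega) hc
    rw [show 2 * n + 4 - (c + 1) = 2 * n + 3 - c by omega] at h₁ h₂
    refine ⟨fun h => ?_, fun h => ?_⟩
    · obtain ⟨i₁, i₂⟩ := ih.2 (by omega)
      obtain ⟨e₁, e₂⟩ := h₁ h
      rw [i₂] at e₁
      rw [← e₁, i₁] at e₂
      generalize a (2 * n + 3 - (c + 1)) = v at *
      push_cast
      refine ⟨?_, ?_⟩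
      · linear_combination e₂
      · linear_combination -e₁
    · obtain ⟨i₁, i₂⟩ := ih.1 (by omega)
      obtain ⟨e₁, e₂⟩ := h₂ h
      rw [i₁] at e₁
      rw [i₁, i₂] at e₂
      generalize a (2 * n + 3 - (c + 1)) = v at *
      push_cast
      refine ⟨?_, ?_⟩
      · linear_combination e₁
      · linear_combination e₂

/-- The colors of the arcs of the twist diagram. -/
theorem exists_twistArc {q : Fin (2 * (n + 2) + 1) → Quandle.Dihedral N × Quandle.Dihedral N}
    (h : (twistCode n).IsEdgeColoring q) : ∃ b d : ZMod N, (2 * n + 1) * d = 0 ∧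
      ∀ e, twistArc n b d e.val = (q e).1 := by
  obtain ⟨a, ha⟩ : ∃ a : ℕ → ZMod N, ∀ e : Fin (2 * (n + 2) + 1), a e.val = (q e).1 :=
    ⟨fun e => (q (Fin.ofNat _ e)).1, fun e => congrArg (fun e => (q e).1) (Fin.ofNat_val_eq_self e)⟩
  have rel : ∀ c : ℕ, c < n + 2 → ∃ o₀ o₁ u₀ u₁, (a o₁ = a o₀ ∧ a u₁ = 2 * a o₀ - a u₀) ∧
      ((n % 2 = 0 ∧ c = 0 ∧ o₀ = n + 2 ∧ o₁ = n + 1 ∧ u₀ = 0 ∧ u₁ = 1) ∨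
      (n % 2 = 1 ∧ c = 0 ∧ o₀ = n + 2 ∧ o₁ = n + 3 ∧ u₀ = 1 ∧ u₁ = 0) ∨
      (n % 2 = 0 ∧ c = n + 1 ∧ o₀ = 2 * n + 4 ∧ o₁ = 2 * n + 3 ∧ u₀ = n + 2 ∧ u₁ = n + 3) ∨
      (n % 2 = 1 ∧ c = n + 1 ∧ o₀ = 2 * n + 3 ∧ o₁ = 2 * n + 4 ∧ u₀ = n + 2 ∧ u₁ = n + 1) ∨
      ((1 ≤ c ∧ c ≤ n) ∧ c % 2 = 0 ∧ o₀ + c = 2 * n + 3 ∧ o₁ + c = 2 * n + 4 ∧ u₀ = c + 1 ∧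
        u₁ = c) ∨
      ((1 ≤ c ∧ c ≤ n) ∧ c % 2 = 1 ∧ o₀ = c ∧ o₁ = c + 1 ∧ u₀ + c = 2 * n + 4 ∧
        u₁ + c = 2 * n + 3)) := by
    intro c hc
    obtain ⟨o₀, o₁, u₀, u₁, e₁, e₂, e₃, e₄, h'⟩ := twist_arc_relations h ha ⟨c, hc⟩
    have hv := twistCode_edges n ⟨c, hc⟩ e₁ e₂ e₃ e₄
    refine ⟨o₀, o₁, u₀, u₁, h', ?_⟩
    rcases hv with ⟨h₁, h₂, -, h₃⟩ | ⟨h₁, h₂, -, h₃⟩ | ⟨h₁, h₂, -, h₃⟩ | ⟨h₁, h₂, -, h₃⟩ |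
      ⟨h₁, h₂, -, h₃⟩ | ⟨h₁, h₂, -, h₃⟩
    · exact .inl ⟨h₁, h₂, h₃⟩
    · exact .inr (.inl ⟨h₁, h₂, h₃⟩)
    · exact .inr (.inr (.inl ⟨h₁, h₂, h₃⟩))
    · exact .inr (.inr (.inr (.inl ⟨h₁, h₂, h₃⟩)))
    · exact .inr (.inr (.inr (.inr (.inl ⟨h₁, h₂, h₃⟩))))
    · exact .inr (.inr (.inr (.inr (.inr ⟨h₁, h₂, h₃⟩))))
  have even : ∀ c, 1 ≤ c → c ≤ n → c % 2 = 0 → a (2 * n + 4 - c) = a (2 * n + 3 - c) ∧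
      a c = 2 * a (2 * n + 3 - c) - a (c + 1) := by
    intro c h₁ h₂ h₃
    obtain ⟨o₀, o₁, u₀, u₁, h', hv⟩ := rel c (by omega)
    obtain ⟨rfl, rfl, rfl, rfl⟩ : o₀ = 2 * n + 3 - c ∧ o₁ = 2 * n + 4 - c ∧ u₀ = c + 1 ∧ u₁ = c := by
      omega
    exact h'
  have odd : ∀ c, 1 ≤ c → c ≤ n → c % 2 = 1 → a (c + 1) = a c ∧
      a (2 * n + 3 - c) = 2 * a c - a (2 * n + 4 - c) := by
    intro c h₁ h₂ h₃
    obtain ⟨o₀, o₁, u₀, u₁, h', hv⟩ := rel c (by omega)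
    obtain ⟨rfl, rfl, rfl, rfl⟩ : o₀ = c ∧ o₁ = c + 1 ∧ u₀ = 2 * n + 4 - c ∧
        u₁ = 2 * n + 3 - c := by
      omega
    exact h'
  -- The edges `2n + 3` and `1` are the two edges by which the strands leave the twist region on the
  -- side of the crossing `1`; all colors are computed from this end.
  obtain ⟨b, hb⟩ : ∃ b, a (2 * n + 3) = b := ⟨_, rfl⟩
  obtain ⟨d, hd⟩ : ∃ d, a 1 = b + d := ⟨a 1 - b, by ring⟩
  have chain := twist_arc_chain hb hd even odd
  -- The clasp crossing `n + 1` compares the far end of the progression with its beginning and gives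
  -- the condition on `d`; the crossing `0` then shows that the first arc also has color `b`.
  have clasp : (2 * n + 1) * d = 0 ∧ a 0 = b ∧ a (2 * n + 4) = b ∧ a (n + 2) = b + (n + 1) * d := by
    obtain ⟨o₀, o₁, u₀, u₁, ⟨r₁, r₂⟩, hv⟩ := rel 0 (by omega)
    obtain ⟨o₀', o₁', u₀', u₁', ⟨s₁, s₂⟩, hv'⟩ := rel (n + 1) (by omega)
    have last := chain n le_rfl
    rw [show 2 * n + 3 - n = n + 3 by omega] at last
    rcases Nat.mod_two_eq_zero_or_one n with hn | hn
    · obtain ⟨rfl, rfl, rfl, rfl⟩ : o₀ = n + 2 ∧ o₁ = n + 1 ∧ u₀ = 0 ∧ u₁ = 1 := by omega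
      obtain ⟨rfl, rfl, rfl, rfl⟩ : o₀' = 2 * n + 4 ∧ o₁' = 2 * n + 3 ∧ u₀' = n + 2 ∧
        u₁' = n + 3 := by omega
      obtain ⟨l₁, l₂⟩ := last.1 hn
      have k : (2 * n + 1) * d = 0 := by
        rw [← s₁, ← r₁, l₁, l₂, hb] at s₂
        linear_combination s₂
      refine ⟨k, ?_, ?_, ?_⟩
      · rw [← r₁, l₁, hd] at r₂
        linear_combination k + r₂
      · rw [← s₁, hb]
      · rw [← r₁, l₁]
    · obtain ⟨rfl, rfl, rfl, rfl⟩ : o₀ = n + 2 ∧ o₁ = n + 3 ∧ u₀ = 1 ∧ u₁ = 0 := by omega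
      obtain ⟨rfl, rfl, rfl, rfl⟩ : o₀' = 2 * n + 3 ∧ o₁' = 2 * n + 4 ∧ u₀' = n + 2 ∧
        u₁' = n + 1 := by omega
      obtain ⟨l₁, l₂⟩ := last.2 hn
      have k : (2 * n + 1) * d = 0 := by
        rw [← r₁, l₁, l₂, hb] at s₂
        linear_combination s₂
      refine ⟨k, ?_, ?_, ?_⟩
      · rw [← r₁, l₂, hd] at r₂
        linear_combination k + r₂
      · rw [s₁, hb]
      · rw [← r₁, l₂]
  obtain ⟨k, a₀, a₁, a₂⟩ := clasp
  refine ⟨b, d, k, fun e => ?_⟩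
  rw [← ha]
  have he := e.isLt
  generalize e.val = e at *
  by_cases h₀ : e = 0
  · rw [h₀, a₀, (twist_zero ..).1]
  by_cases h₁ : e = 2 * n + 4
  · rw [(twist_last _ _ h₁).1, h₁, a₁]
  by_cases h₂ : e ≤ n + 1
  · obtain ⟨c, rfl⟩ : ∃ c, e = c + 1 := ⟨e - 1, by omega⟩
    have := chain c (by omega)
    rcases Nat.mod_two_eq_zero_or_one c with hc | hc
    · rw [(twist_low_odd _ _ h₂ (by omega)).1, (this.1 hc).1]; push_cast; ring
    · rw [(twist_low_even _ _ (by omega) h₂ (by omega)).1, (this.2 hc).1]; push_cast; ring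
  by_cases h₃ : e = n + 2
  · rw [(twist_mid _ _ h₃).1, h₃, a₂]
  obtain ⟨c, hc⟩ : ∃ c, e + c = 2 * n + 3 := ⟨2 * n + 3 - e, by omega⟩
  have := chain c (by omega)
  rw [show 2 * n + 3 - c = e by omega] at this
  have cast : (e : ZMod N) + c = 2 * n + 3 := by exact_mod_cast congrArg Nat.cast hc
  rcases Nat.mod_two_eq_zero_or_one e with h' | h'
  · rw [(twist_high_even _ _ (by omega) (by omega) h').1, (this.2 (by omega)).2]
    linear_combination -d * cast - k
  · rw [(twist_high_odd _ _ (by omega) h').1, (this.1 (by omega)).2]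
    linear_combination -d * cast - k

/-- The coloring of the twist diagram with two given parameters. -/
def twistColoring (n N : ℕ) (p : {p : ZMod N × ZMod N // (2 * n + 1) * p.2 = 0}) :
    (twistDiagram n).EdgeColoring (Quandle.Dihedral N) (Quandle.Dihedral N) :=
  ⟨twistState n p.1.1 p.1.2, isEdgeColoring_twistState p.2⟩

/-- The edges `0` and `1` have arc colors `b` and `b + d`, so the parameters can be recovered.
Conversely the arcs of any coloring have this form, and for odd order the arcs determine the
regions. -/
theorem twistColoring_bijective (hN : Odd N) : Function.Bijective (twistColoring n N) := by
  constructor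
  · rintro ⟨⟨b, d⟩, h⟩ ⟨⟨b', d'⟩, h'⟩ hq
    have arcs : ∀ e : Fin (2 * (n + 2) + 1), twistArc n b d e.val = twistArc n b' d' e.val :=
      fun e => congrArg Prod.fst (congrFun (congrArg Subtype.val hq) e)
    have h₀ := arcs 0
    have h₁ := arcs ⟨1, by omega⟩
    rw [Fin.val_zero, (twist_zero ..).1, (twist_zero ..).1] at h₀
    simp only [(twist_low_odd (n := n) (e := 1) _ _ (by omega) rfl).1] at h₁
    obtain rfl : b = b' := h₀
    simpa using h₁
  · intro q
    obtain ⟨b, d, h, arcs⟩ := exists_twistArc q.2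
    exact ⟨⟨(b, d), h⟩, Subtype.ext (dihedral_coloring_ext hN (isEdgeColoring_twistState h) q.2
      arcs)⟩

/-- Different twist diagrams represent different knotoids. -/
theorem twistKnotoid_injective : Function.Injective twistKnotoid := by
  have key : ∀ n n', n < n' → twistKnotoid n ≠ twistKnotoid n' := by
    intro n n' hlt h
    -- Modulo this `N` every `d` is allowed for `T_n'`. For `T_n` the value `d = 1` is excluded,
    -- since `0 < 2n + 1 < N`. So the numbers of colorings differ.
    set N := 2 * n' + 1 with hN
    have odd : Odd N := ⟨n', rfl⟩
    have h₁ := KnotoidDiagram.card_edgeColoring_congr (Quandle.Dihedral N) (Quandle.Dihedral N) h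
    rw [← Nat.card_eq_of_bijective _ (twistColoring_bijective odd),
      ← Nat.card_eq_of_bijective _ (twistColoring_bijective odd)] at h₁
    have zero : (2 * n' + 1 : ZMod N) = 0 := by
      exact_mod_cast ZMod.natCast_self N
    have : NeZero N := ⟨by omega⟩
    have h₂ : Nat.card {p : ZMod N × ZMod N // (2 * (n' : ZMod N) + 1) * p.2 = 0} =
        Nat.card (ZMod N × ZMod N) := by
      refine Nat.card_congr (Equiv.subtypeUnivEquiv fun p => ?_)
      rw [zero, zero_mul]
    have h₃ : Nat.card {p : ZMod N × ZMod N // (2 * (n : ZMod N) + 1) * p.2 = 0} <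
        Nat.card (ZMod N × ZMod N) := by
      rw [Nat.card_eq_fintype_card, Nat.card_eq_fintype_card]
      refine Fintype.card_subtype_lt (x := (0, 1)) fun h => ?_
      have : ((2 * n + 1 : ℕ) : ZMod N) = 0 := by push_cast; simpa using h
      rw [ZMod.natCast_eq_zero_iff] at this
      have := Nat.le_of_dvd (by omega) this
      omega
    omega
  intro n n' h
  rcases lt_trichotomy n n' with hlt | rfl | hlt
  · exact absurd h (key _ _ hlt)
  · rfl
  · exact absurd h.symm (key _ _ hlt)

end TwistClassification

/-! ### The invariant of the twist diagrams and of their mirror images -/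

section Weights

theorem stateWeight_theta3 (s : Bool) (y x z : ZMod 3) :
    GaussCode.stateWeight theta3 s y x z =
      Multiplicative.ofAdd (if s then thetaExponent y x z else -thetaExponent y x z) := by
  cases s <;> rfl

variable {n : ℕ}

/-- At the crossing `0` the specified region and the under-arc have the same color, so a factor of
the exponent vanishes, in accordance with `c = 0`. At `n + 1` the over-arc has color `0`. In the
twist region all colors are multiples of `d` with coefficients in `c`, and since `n` is `1` modulo
three only the residues of `c` and `d` matter. -/
theorem twist_edgeWeight (hn : (n : ZMod 3) = 1) (d : ZMod 3) (c : Fin (n + 2)) :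
    (twistCode n).edgeWeight theta3 (twistState n 0 d) c =
      Multiplicative.ofAdd (if c.val = n + 1 then 0 else -((c.val : ZMod 3) ^ 2 * d ^ 2)) := by
  rw [GaussCode.edgeWeight, twistState, twistState, stateWeight_theta3]
  congr 1
  have hv := twistCode_edges n c rfl rfl rfl rfl
  generalize ((twistCode n).overAt c false).val = o₀ at *
  generalize ((twistCode n).overAt c true).val = o₁ at *
  generalize ((twistCode n).underAt c false).val = u₀ at *
  generalize ((twistCode n).underAt c true).val = u₁ at *
  generalize (twistCode n).sign c = σ at *
  generalize c.val = c at *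
  have h₀ := twist_zero (n := n) (0 : ZMod 3) d
  rcases hv with ⟨-, hc, -, -, -, hu, -⟩ | ⟨-, hc, -, -, -, hu, -⟩ |
    ⟨-, hc, -, ho, -⟩ | ⟨-, hc, -, ho, -⟩ |
    ⟨hc, hc', hs, ho, -, hu, -⟩ | ⟨hc, hc', hs, ho, -, hu, -⟩
  · simp [hc, hu, h₀, thetaExponent]
  · have h₁ := twist_low_odd (n := n) (e := u₀) 0 d (by omega) (by omega)
    rw [h₁.1, h₁.2, hu, hc, if_neg (show 0 ≠ n + 1 by omega)]
    have : ∀ z : ZMod 3, thetaExponent (0 + (2 * (1 : ℕ) - 1) * d) (0 + (1 : ℕ) * d) z = 0 := by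
      intro z; simp only [thetaExponent]; push_cast; ring
    simp only [this]
    simp
  · rw [if_pos hc, (twist_last 0 d ho).1]
    simp [thetaExponent]
  · have h₁ := twist_high_odd (n := n) (e := o₀) 0 d (by omega) (by omega)
    have : twistArc n 0 d o₀ = 0 := by
      rw [h₁.1, ho]; push_cast; rw [hn]; ring_nf; clear h₀ h₁; revert d; decide
    rw [if_pos hc, this]
    simp [thetaExponent]
  · have h₁ := twist_low_odd (n := n) (e := u₀) 0 d (by omega) (by omega)
    have h₂ := twist_high_odd (n := n) (e := o₀) 0 d (by omega) (by omega)
    have cast : (o₀ : ZMod 3) = 2 * n + 3 - c := by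
      rw [eq_sub_iff_add_eq]; exact_mod_cast congrArg Nat.cast ho
    rw [if_neg (show c ≠ n + 1 by omega), hs, if_neg Bool.false_ne_true, h₁.1, h₁.2, h₂.1, hu, cast, hn]
    push_cast
    clear h₀ h₁ h₂ cast
    generalize (c : ZMod 3) = x
    revert x d
    decide
  · have h₁ := twist_low_odd (n := n) (e := o₀) 0 d (by omega) (by omega)
    have h₂ := twist_high_odd (n := n) (e := u₀) 0 d (by omega) (by omega)
    have cast : (u₀ : ZMod 3) = 2 * n + 4 - c := by
      rw [eq_sub_iff_add_eq]; exact_mod_cast congrArg Nat.cast hu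
    rw [if_neg (show c ≠ n + 1 by omega), hs, if_neg Bool.false_ne_true, h₁.1, h₂.1, h₂.2, ho, cast, hn]
    clear h₀ h₁ h₂ cast
    generalize (c : ZMod 3) = x
    revert x d
    decide

/-- Three consecutive squares add up to `2` modulo three, so it takes nine consecutive crossings for
the weights to cancel. -/
theorem prod_range_nine_mul (d : ZMod 3) (k : ℕ) :
    ∏ i ∈ Finset.range (9 * k), Multiplicative.ofAdd (-((i : ZMod 3) ^ 2 * d ^ 2)) = 1 := by
  induction k with
  | zero => simp
  | succ k ih =>
    have h : ((9 * k : ℕ) : ZMod 3) = 0 := by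
      push_cast; rw [show (9 : ZMod 3) = 0 by decide, zero_mul]
    rw [mul_add, mul_one]
    simp only [Finset.prod_range_succ, ih, Nat.cast_add, h]
    clear ih h
    revert d
    decide

theorem twist_prod_edgeWeight {m : ℕ} (hm : 9 ∣ m) (d : ZMod 3) :
    ∏ c, (twistCode (m + 1)).edgeWeight theta3 (twistState (m + 1) 0 d) c =
      Multiplicative.ofAdd (-d ^ 2) := by
  obtain ⟨k, rfl⟩ := hm
  have h : ((9 * k : ℕ) : ZMod 3) = 0 := by
    push_cast; rw [show (9 : ZMod 3) = 0 by decide, zero_mul]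
  have hn : ((9 * k + 1 : ℕ) : ZMod 3) = 1 := by rw [Nat.cast_add, h]; rfl
  rw [Finset.prod_congr rfl fun c _ => twist_edgeWeight hn d c,
    Fin.prod_univ_eq_prod_range (fun c => Multiplicative.ofAdd
      (if c = 9 * k + 1 + 1 then 0 else -((c : ZMod 3) ^ 2 * d ^ 2))) (9 * k + 1 + 2),
    Finset.prod_range_succ, if_pos rfl, ofAdd_zero, mul_one]
  rw [Finset.prod_congr rfl fun c hc => by
    rw [if_neg (by have := Finset.mem_range.1 hc; omega)]]
  -- Only the crossings `9k` and `9k + 1` remain, with squares `0` and `1` modulo three.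
  rw [Finset.prod_range_succ, Finset.prod_range_succ, prod_range_nine_mul, hn, h]
  revert d
  decide

end Weights

/-! ### The symmetry between a twist diagram and its mirror image. -/

section Mirror

variable {n : ℕ}

namespace GaussCode

theorem mirror_overAt (G : GaussCode n) (c : Fin n) (s : Bool) :
    G.mirror.overAt c s = G.underAt c s := by
  cases s <;> cases h : G.sign c <;> simp [overAt, underAt, mirror, Equiv.boolNot, h]

theorem mirror_underAt (G : GaussCode n) (c : Fin n) (s : Bool) :
    G.mirror.underAt c s = G.overAt c s := by
  cases s <;> cases h : G.sign c <;> simp [overAt, underAt, mirror, Equiv.boolNot, h]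

end GaussCode

/-- The exchange of the two crossings of the clasp. -/
def claspSwap (n : ℕ) : Equiv.Perm (Fin (n + 2)) := Equiv.swap 0 (Fin.last (n + 1))

theorem claspSwap_val (c : Fin (n + 2)) : (c.val = 0 ∧ (claspSwap n c).val = n + 1) ∨
    (c.val = n + 1 ∧ (claspSwap n c).val = 0) ∨
    ((1 ≤ c.val ∧ c.val ≤ n) ∧ (claspSwap n c).val = c.val) := by
  by_cases h₀ : c = 0
  · subst h₀; exact .inl ⟨rfl, by simp [claspSwap]⟩
  by_cases h₁ : c = Fin.last (n + 1)
  · subst h₁; exact .inr (.inl ⟨rfl, by simp [claspSwap]⟩)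
  · have hc := c.isLt
    refine .inr (.inr ⟨?_, by simp [claspSwap, Equiv.swap_apply_of_ne_of_ne h₀ h₁]⟩)
    simp only [Fin.ext_iff, Fin.val_zero, Fin.val_last] at h₀ h₁
    omega

/-- Up to the exchange of the clasp crossings, the reversal of the strand exchanges the over- and the
under-strands of the twist diagram. -/
theorem twistCode_rev (n : ℕ) (c : Fin (n + 2)) :
    (∀ s, (twistCode n).underAt c s = Fin.rev ((twistCode n).overAt (claspSwap n c) s)) ∧
    (∀ s, (twistCode n).overAt c s = Fin.rev ((twistCode n).underAt (claspSwap n c) s)) ∧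
    (twistCode n).sign (claspSwap n c) = (twistCode n).sign c := by
  have h₁ := twistCode_edges n c rfl rfl rfl rfl
  have h₂ := twistCode_edges n (claspSwap n c) rfl rfl rfl rfl
  have h := claspSwap_val c
  simp only [Bool.forall_bool, Fin.ext_iff, Fin.val_rev]
  generalize (claspSwap n c).val = c' at *
  generalize c.val = c at *
  rcases h₁ with ⟨a₁, a₂, a₃, h₁⟩ | ⟨a₁, a₂, a₃, h₁⟩ | ⟨a₁, a₂, a₃, h₁⟩ | ⟨a₁, a₂, a₃, h₁⟩ |
    ⟨a₁, a₂, a₃, h₁⟩ | ⟨a₁, a₂, a₃, h₁⟩ <;>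
  rcases h₂ with ⟨b₁, b₂, b₃, h₂⟩ | ⟨b₁, b₂, b₃, h₂⟩ | ⟨b₁, b₂, b₃, h₂⟩ | ⟨b₁, b₂, b₃, h₂⟩ |
    ⟨b₁, b₂, b₃, h₂⟩ | ⟨b₁, b₂, b₃, h₂⟩ <;>
  first
  | (exfalso; clear h₁ h₂; omega)
  | (refine ⟨?_, ?_, b₃.trans a₃.symm⟩ <;> clear a₃ b₃ <;> omega)

variable {X Y A : Type} [Quandle X] [QuandleSet X Y] [CommGroup A]

/-- The mirror image exchanges over- and under-edges on each side, and so does reading the strand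
backwards with the clasp crossings exchanged. The two exchanges cancel, leaving the same rule at
each crossing; the two end conditions change places. -/
theorem mirror_isEdgeColoring_iff {q : Fin (2 * (n + 2) + 1) → X × Y} :
    (twistCode n).mirror.IsEdgeColoring (q ∘ Fin.rev) ↔ (twistCode n).IsEdgeColoring q := by
  constructor
  · refine fun h => ⟨fun c => ?_, by simpa using h.last, by simpa using h.first⟩
    have := h.crossing (claspSwap n c)
    simpa only [GaussCode.mirror_overAt, GaussCode.mirror_underAt, Function.comp_apply,
      ← (twistCode_rev n c).1, ← (twistCode_rev n c).2.1] using this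
  · refine fun h => ⟨fun c => ?_, by simpa using h.last, by simpa using h.first⟩
    have := h.crossing (claspSwap n c)
    simpa only [GaussCode.mirror_overAt, GaussCode.mirror_underAt, Function.comp_apply,
      (twistCode_rev n c).1, (twistCode_rev n c).2.1, Fin.rev_rev] using this

/-- Corresponding crossings carry the same three colors, including that of the specified region, but
opposite signs. -/
theorem mirror_prod_edgeWeight (f : QuandleCocycle X Y A) (q : Fin (2 * (n + 2) + 1) → X × Y) :
    ∏ c, (twistCode n).mirror.edgeWeight f (q ∘ Fin.rev) c =
      (∏ c, (twistCode n).edgeWeight f q c)⁻¹ := by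
  rw [← Equiv.prod_comp (claspSwap n), ← Finset.prod_inv_distrib]
  refine Finset.prod_congr rfl fun c _ => ?_
  have hs : (twistCode n).mirror.sign (claspSwap n c) = !(twistCode n).sign c := by
    rw [← (twistCode_rev n c).2.2]; rfl
  simp only [GaussCode.edgeWeight, GaussCode.mirror_overAt, GaussCode.mirror_underAt,
    Function.comp_apply, ← (twistCode_rev n c).1, ← (twistCode_rev n c).2.1, hs,
    GaussCode.stateWeight]
  cases (twistCode n).sign c <;> simp

/-- The colorings of the mirror image of the twist diagram. -/
def mirrorColoring (n : ℕ) (q : (twistDiagram n).EdgeColoring X Y) :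
    (twistDiagram n).mirror.EdgeColoring X Y :=
  ⟨q.1 ∘ Fin.rev, mirror_isEdgeColoring_iff.2 q.2⟩

theorem mirrorColoring_bijective :
    Function.Bijective (mirrorColoring (X := X) (Y := Y) n) := by
  have rev : ∀ q : Fin (2 * (n + 2) + 1) → X × Y, (q ∘ Fin.rev) ∘ Fin.rev = q := by
    intro q; funext e; simp
  constructor
  · intro q q' h
    refine Subtype.ext ?_
    rw [← rev q.1, ← rev q'.1]
    exact congrArg (· ∘ Fin.rev) (congrArg Subtype.val h)
  · intro q
    refine ⟨⟨q.1 ∘ Fin.rev, mirror_isEdgeColoring_iff.1 ?_⟩, Subtype.ext (rev _)⟩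
    rw [rev]; exact q.2

end Mirror

/-! ### Evaluation of the invariant. -/

section Invariant

/-- The colorings of the twist diagram by the dihedral quandle of order three. -/
def twistColoring₃ {m : ℕ} (hm : 9 ∣ m) (p : ZMod 3 × ZMod 3) :
    (twistDiagram (m + 1)).EdgeColoring R3 R3 :=
  twistColoring (m + 1) 3 ⟨p, by
    obtain ⟨k, rfl⟩ := hm
    push_cast
    rw [show (9 : ZMod 3) = 0 by decide, zero_mul, show (2 * (0 + 1) + 1 : ZMod 3) = 0 by decide,
      zero_mul]⟩

theorem twistColoring₃_bijective {m : ℕ} (hm : 9 ∣ m) : Function.Bijective (twistColoring₃ hm) := by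
  refine (twistColoring_bijective (by decide)).comp
    ⟨fun p p' h => congrArg Subtype.val h, fun p => ⟨p.1, rfl⟩⟩

theorem twistColoring₃_outer {m : ℕ} (hm : 9 ∣ m) (p : ZMod 3 × ZMod 3) :
    (twistColoring₃ hm p).region (twistDiagram (m + 1)).outer = p.1 := by
  have h := twist_zero (n := m + 1) p.1 p.2
  change 2 * twistArc (m + 1) p.1 p.2 0 - twistRight (m + 1) p.1 p.2 0 = p.1
  rw [h.1, h.2]; ring

/-- The reversal turns the first edge into the last one, where arc and region also have color `b`.
So the condition at infinity is again `b = 0`. -/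
theorem mirror_twistColoring₃_outer {m : ℕ} (hm : 9 ∣ m) (p : ZMod 3 × ZMod 3) :
    (mirrorColoring (m + 1) (twistColoring₃ hm p)).region (twistDiagram (m + 1)).mirror.outer =
      p.1 := by
  have h := twist_last (n := m + 1) p.1 p.2 (e := 2 * (m + 1 + 2)) (by ring)
  change 2 * twistArc (m + 1) p.1 p.2 (2 * (m + 1 + 2)) -
    twistRight (m + 1) p.1 p.2 (2 * (m + 1 + 2)) = p.1
  rw [h.1, h.2]; ring

theorem finsum_pair {M : Type*} [AddCommMonoid M] (g : ZMod 3 → M) :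
    ∑ᶠ (p : ZMod 3 × ZMod 3) (_ : p.1 = 0), g p.2 = g 0 + g 1 + g 2 := by
  rw [finsum_eq_sum_of_fintype]
  simp only [finsum_eq_if]
  rw [Fintype.sum_prod_type_right]
  simp only [Finset.sum_ite_eq', Finset.mem_univ, if_true]
  exact Fin.sum_univ_three g

theorem theta3Invariant_twist {m : ℕ} (hm : 9 ∣ m) :
    (twistDiagram (m + 1)).theta3Invariant = 1 + 2 * uGen ^ 2 := by
  rw [KnotoidDiagram.theta3Invariant, KnotoidDiagram.shadowInvariant_eq,
    ← finsum_eq_of_bijective (f := fun p : ZMod 3 × ZMod 3 => ∑ᶠ _ : p.1 = 0,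
      MonoidAlgebra.of ℤ Z3 (Multiplicative.ofAdd (-p.2 ^ 2))) _ (twistColoring₃_bijective hm),
    finsum_pair fun d => MonoidAlgebra.of ℤ Z3 (Multiplicative.ofAdd (-d ^ 2))]
  -- Both nonzero values of `d` give the exponent `-1 = 2`, hence the term `2u²`.
  · rw [uGen, ← map_pow, ← ofAdd_nsmul, show -(0 : ZMod 3) ^ 2 = 0 by decide,
      show -(1 : ZMod 3) ^ 2 = 2 • 1 by decide, show -(2 : ZMod 3) ^ 2 = 2 • 1 by decide,
      ofAdd_zero, map_one]
    ring
  · rintro ⟨b, d⟩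
    rw [twistColoring₃_outer]
    refine finsum_congr fun h => ?_
    obtain rfl : b = 0 := h
    exact congrArg _ (twist_prod_edgeWeight hm d).symm

theorem theta3Invariant_mirror_twist {m : ℕ} (hm : 9 ∣ m) :
    (twistDiagram (m + 1)).mirror.theta3Invariant = 1 + 2 * uGen := by
  rw [KnotoidDiagram.theta3Invariant, KnotoidDiagram.shadowInvariant_eq,
    ← finsum_eq_of_bijective (f := fun p : ZMod 3 × ZMod 3 => ∑ᶠ _ : p.1 = 0,
      MonoidAlgebra.of ℤ Z3 (Multiplicative.ofAdd (p.2 ^ 2))) _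
      (mirrorColoring_bijective.comp (twistColoring₃_bijective hm)),
    finsum_pair fun d => MonoidAlgebra.of ℤ Z3 (Multiplicative.ofAdd (d ^ 2))]
  · rw [uGen, show (0 : ZMod 3) ^ 2 = 0 by decide, show (1 : ZMod 3) ^ 2 = 1 by decide,
      show (2 : ZMod 3) ^ 2 = 1 by decide, ofAdd_zero, map_one]
    ring
  · rintro ⟨b, d⟩
    rw [Function.comp_apply, mirror_twistColoring₃_outer]
    refine finsum_congr fun h => ?_
    obtain rfl : b = 0 := h
    refine congrArg _ (Eq.symm ((mirror_prod_edgeWeight _ _).trans ?_))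
    rw [inv_eq_iff_eq_inv, ← ofAdd_neg]
    exact twist_prod_edgeWeight hm d

/-- The coefficients of `u` are `0` and `2`. -/
theorem one_add_two_uGen_ne : (1 + 2 * uGen ^ 2 : MonoidAlgebra ℤ Z3) ≠ 1 + 2 * uGen := by
  intro h
  have h₁ := congrArg (fun x => x.coeff (Multiplicative.ofAdd 1)) (add_left_cancel h)
  rw [uGen, ← map_pow, ← ofAdd_nsmul, two_mul, two_mul] at h₁
  have ne : (2 : ZMod 3) ≠ 1 := by decide
  simp [MonoidAlgebra.of_apply, ne] at h₁

theorem twistKnotoid_isKnotType (n : ℕ) : (twistKnotoid n).IsKnotType := by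
  refine ⟨n + 2, twistDiagram n, rfl, rfl, ?_⟩
  obtain ⟨h₁, h₂, -⟩ := twistRep_outer n
  change (twistCode n).regionAt (0, true) = (twistCode n).regionAt (Fin.last (2 * (n + 2)), true)
  rw [← twistSide_val, ← twistSide_val]
  exact h₁.trans h₂.symm

end Invariant

theorem theorem5p3 :
    -- infinitely many knot-type knotoids are distinguished from their mirrors by the invariant
    {κ : Knotoid | κ.IsKnotType ∧
      ∀ (m n : ℕ) (D : KnotoidDiagram m) (E : KnotoidDiagram n),
        D.knotoid = κ → E.knotoid = κ.mirror → D.theta3Invariant ≠ E.theta3Invariant}.Infinite ∧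
    -- the examples
    {κ : Knotoid | ∃ m : ℕ, 9 ∣ m ∧ κ = twistKnotoid (m + 1)}.Infinite ∧
    ∀ m : ℕ, 9 ∣ m →
      (twistKnotoid (m + 1)).IsKnotType ∧
      (∀ (n : ℕ) (D : KnotoidDiagram n), D.knotoid = twistKnotoid (m + 1) →
        D.theta3Invariant = 1 + 2 * uGen ^ 2) ∧
      (∀ (n : ℕ) (D : KnotoidDiagram n), D.knotoid = (twistKnotoid (m + 1)).mirror →
        D.theta3Invariant = 1 + 2 * uGen) := by
  have values : ∀ m : ℕ, 9 ∣ m →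
      (∀ (n : ℕ) (D : KnotoidDiagram n), D.knotoid = twistKnotoid (m + 1) →
        D.theta3Invariant = 1 + 2 * uGen ^ 2) ∧
      (∀ (n : ℕ) (D : KnotoidDiagram n), D.knotoid = (twistKnotoid (m + 1)).mirror →
        D.theta3Invariant = 1 + 2 * uGen) := by
    refine fun m hm => ⟨fun n D h => ?_, fun n D h => ?_⟩
    · rw [← theta3Invariant_twist hm]
      exact KnotoidDiagram.shadowInvariant_congr h theta3 _
    · rw [← theta3Invariant_mirror_twist hm]
      exact KnotoidDiagram.shadowInvariant_congr (E := (twistDiagram (m + 1)).mirror) h theta3 _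
  have infinite : {κ : Knotoid | ∃ m : ℕ, 9 ∣ m ∧ κ = twistKnotoid (m + 1)}.Infinite := by
    -- Infinitude is a statement about knotoids, not diagrams, so it rests on the coloring counts
    -- behind `twistKnotoid_injective`.
    refine Set.infinite_of_injective_forall_mem (f := fun k : ℕ => twistKnotoid (9 * k + 1))
      (fun k k' h => ?_) fun k => ⟨9 * k, dvd_mul_right 9 k, rfl⟩
    have := twistKnotoid_injective h
    omega
  refine ⟨infinite.mono ?_, infinite, fun m hm => ⟨twistKnotoid_isKnotType _, values m hm⟩⟩
  rintro _ ⟨m, hm, rfl⟩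
  refine ⟨twistKnotoid_isKnotType _, fun k n D E hD hE => ?_⟩
  rw [(values m hm).1 k D hD, (values m hm).2 n E hE]
  exact one_add_two_uGen_ne
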